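/- Write $\langle x\rangle=(1+|x|^2)^{1/2}$, and let $\widehat f(\xi)$ and $\widetilde u(\tau,\xi)$ denote the Fourier transform on $\mathbb R$ and the space-time Fourier transform on $\mathbb R^{1+1}$ (for instance $\widetilde u(\tau,\xi)=\int e^{-i(t\tau+x\xi)}u(t,x)\,dt\,dx$). For either choice of sign and $s,b\in\mathbb R$ define, for (complex-valued, tempered) distributions, $$\|f\|_{H^s}=\|\langle\xi\rangle^s\widehat f\|_{L^2(\mathbb R)},\qquad \|u\|_{Z^{s,b}_\pm}=\big\|\langle\tau\mp\xi\rangle^s\langle\tau\pm\xi\rangle^b\,\widetilde u(\tau,\xi)\big\|_{L^2_{\tau,\xi}},\qquad \|u\|_{Y^{s,b}_\pm}=\big\|\langle\xi\rangle^s\langle\tau\pm\xi\rangle^b\,\widetilde u(\tau,\xi)\big\|_{L^2_\xi L^1_\tau},$$ with value $\infty$ if the Fourier transform is not a function. For $T>0$ let $S_T=[-T,T]\times\mathbb R$; equality of distributions on $S_T$ means equality on its interior, and $\|u\|_{Z^{s,b}_\pm(S_T)}=\inf\{\|g\|_{Z^{s,b}_\pm}: g=u\text{ on }S_T\}$. **Corollary.**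 Let $-\tfrac12<s<0$, $0<\epsilon<\tfrac16$ and $\tfrac12<b<\min\{1+\epsilon,1+s\}$. There is a constant $C$, depending only on $s$, $\epsilon$ and $b$, such that for either sign, every $0<T<1$, and every $\psi$ which on $S_T$ is a solution (in the sense of distributions) of $$\partial_t\psi\pm\partial_x\psi=F,\qquad \psi(0)=f,$$ where $\psi$ is weakly continuous in $t\in(-T,T)$ with values in $\mathcal S'(\mathbb R)$, one has $$\|\psi\|_{Z^{s,b}_\pm(S_T)}\le C\Big(T^{\frac12-b}\|f\|_{H^s}+T^{\epsilon}\inf_{F'=F\text{ on }S_T}\big(\|F'\|_{Y^{s,-1+2\epsilon}_\pm}+\|F'\|_{Z^{s,b-1+2\epsilon}_\pm}\big)\Big).$$ Here the infimum is over all tempered distributions $F'$ on $\mathbb R^{1+1}$ with $F'=F$ on $S_T$, and the right-hand side is $\infty$ if no such $F'$ has both norms finite. -/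

import Mathlib

open MeasureTheory Set
open scoped SchwartzMap FourierTransform LineDeriv ENNReal NNReal

namespace NullSobolev

/-- The space-time `ℝ^{1+1}`; the coordinate `p 0` is the time `t` (or its dual variable `τ`), and
the coordinate `p 1` is the space variable `x` (or its dual variable `ξ`). -/
abbrev SpaceTime : Type := EuclideanSpace ℝ (Fin 2)

/-- The bracket `⟨x⟩ = (1 + |x|²)^{1/2}`. -/
noncomputable def bracket (x : ℝ) : ℝ := Real.sqrt (1 + x ^ 2)

/-- The Fourier transform of the tempered distribution `u`, in the normalization
`û(ξ) = ∫ e^{-i x·ξ} u(x) dx`, is the function `G`. Mathlib's `𝓕` is taken with respect to the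
character `e^{-2πi x·k}`, so that `𝓕 u (k) = û(2πk)`. -/
def IsFourierTransform {E : Type*} [NormedAddCommGroup E] [InnerProductSpace ℝ E]
    [FiniteDimensional ℝ E] [MeasurableSpace E] [BorelSpace E]
    (u : 𝓢'(E, ℂ)) (G : E → ℂ) : Prop :=
  Measurable G ∧ ∀ φ : 𝓢(E, ℂ),
    Integrable (fun k : E => G ((2 * Real.pi) • k) * φ k) ∧
      (𝓕 u) φ = ∫ k : E, G ((2 * Real.pi) • k) * φ k

/-- The norm `‖f‖_{H^s} = ‖⟨ξ⟩^s f̂(ξ)‖_{L²}` of a tempered distribution on `ℝ`. It is `∞` if `f̂` is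
not a function. (The function `f̂` is unique up to null sets, so the infimum is over
representatives that all give the same value; the same holds for the two norms below.) -/
noncomputable def HNorm (s : ℝ) (f : 𝓢'(ℝ, ℂ)) : ℝ≥0∞ :=
  ⨅ (G : ℝ → ℂ) (_ : IsFourierTransform f G),
    (∫⁻ ξ : ℝ, (ENNReal.ofReal (bracket ξ ^ s) * ‖G ξ‖ₑ) ^ 2) ^ (1 / 2 : ℝ)

/-- The norm `‖u‖_{Z^{s,b}_±} = ‖⟨τ ∓ ξ⟩^s ⟨τ ± ξ⟩^b ũ(τ, ξ)‖_{L²_{τ,ξ}}`, where `σ = ±1` is the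
sign. -/
noncomputable def ZNorm (σ s b : ℝ) (u : 𝓢'(SpaceTime, ℂ)) : ℝ≥0∞ :=
  ⨅ (G : SpaceTime → ℂ) (_ : IsFourierTransform u G),
    (∫⁻ p : SpaceTime,
      (ENNReal.ofReal (bracket (p 0 - σ * p 1) ^ s * bracket (p 0 + σ * p 1) ^ b) * ‖G p‖ₑ) ^ 2)
      ^ (1 / 2 : ℝ)

/-- The norm `‖u‖_{Y^{s,b}_±} = ‖⟨ξ⟩^s ⟨τ ± ξ⟩^b ũ(τ, ξ)‖_{L²_ξ L¹_τ}`, where `σ = ±1` is the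
sign. -/
noncomputable def YNorm (σ s b : ℝ) (u : 𝓢'(SpaceTime, ℂ)) : ℝ≥0∞ :=
  ⨅ (G : SpaceTime → ℂ) (_ : IsFourierTransform u G),
    (∫⁻ ξ : ℝ, (∫⁻ τ : ℝ,
      ENNReal.ofReal (bracket ξ ^ s * bracket (τ + σ * ξ) ^ b) * ‖G !₂[τ, ξ]‖ₑ) ^ 2) ^ (1 / 2 : ℝ)

/-- The (interior of the) strip `S_T = [-T, T] × ℝ`. -/
def strip (T : ℝ) : Set SpaceTime := {p | p 0 ∈ Ioo (-T) T}

/-- `u = v` on `S_T`, in the sense of distributions. -/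
def EqOnStrip (T : ℝ) (u v : 𝓢'(SpaceTime, ℂ)) : Prop :=
  Distribution.IsVanishingOn (u - v : 𝓢'(SpaceTime, ℂ)) (strip T)

/-- The norm of the restriction space `Z^{s,b}_±(S_T)`. -/
noncomputable def ZNormStrip (σ s b T : ℝ) (u : 𝓢'(SpaceTime, ℂ)) : ℝ≥0∞ :=
  ⨅ (g : 𝓢'(SpaceTime, ℂ)) (_ : EqOnStrip T g u), ZNorm σ s b g

/-- The transport operator `∂_t ± ∂_x` on tempered distributions. -/
noncomputable def transport (σ : ℝ) (u : 𝓢'(SpaceTime, ℂ)) : 𝓢'(SpaceTime, ℂ) :=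
  ∂_{EuclideanSpace.single (0 : Fin 2) (1 : ℝ)} u +
    (σ : ℂ) • ∂_{EuclideanSpace.single (1 : Fin 2) (1 : ℝ)} u

/-- `ψ(0) = f`: on the strip, `ψ` is (given by) a curve `t ↦ ψ(t)` in `C((-T, T), 𝓢'(ℝ))`, where
`𝓢'(ℝ)` has the weak topology, that is, `⟨ψ, η ⊗ χ⟩ = ∫ η(t) ⟨ψ(t), χ⟩ dt` for all `χ ∈ 𝓢(ℝ)` and
all test functions `η` supported in `(-T, T)`; and the value of this curve at `t = 0` is `f`. -/
def HasInitialValue (T : ℝ) (ψ : 𝓢'(SpaceTime, ℂ)) (f : 𝓢'(ℝ, ℂ)) : Prop :=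
  ∃ u : ℝ → 𝓢'(ℝ, ℂ), ContinuousOn u (Ioo (-T) T) ∧ u 0 = f ∧
    ∀ (η χ : 𝓢(ℝ, ℂ)) (Φ : 𝓢(SpaceTime, ℂ)), tsupport η ⊆ Ioo (-T) T →
      (∀ p : SpaceTime, Φ p = η (p 0) * χ (p 1)) → ψ Φ = ∫ t : ℝ, η t * u t χ

/-- `ψ` solves `(∂_t ± ∂_x) ψ = F` on `S_T` with `ψ(0) = f`. -/
def IsSolution (σ T : ℝ) (ψ F : 𝓢'(SpaceTime, ℂ)) (f : 𝓢'(ℝ, ℂ)) : Prop :=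
  EqOnStrip T (transport σ ψ) F ∧ HasInitialValue T ψ f

end NullSobolev

/-! ### Elementary inequalities for the bracket. -/

namespace NullSobolev

/-! With θ = τ + σξ, the operator ∂_t + σ∂_x becomes multiplication by iθ and the Z-weight becomes
⟨θ - 2σξ⟩^s ⟨θ⟩^b, so everything happens for one ξ at a time. Let B(θ) denote the `symbol` of a test
function supported in the strip, at fixed ξ. Up to the factor (2π)^{-2} and integration in ξ,
Duhamel's formula says that the solution pairs with it as 2π f̂(ξ) B(0) + ∫ F̃'(θ,ξ) (B(θ) -
B(0))/(iθ) dθ. It suffices to exhibit one function on the frequency side that has this pairing and a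
good Z-norm, and to know that solutions in the strip are unique.

The function is `duhamel`. Its profile K is the transform of a time cutoff equal to 1 on [-1,1]. The
free wave is K(θ) f̂(ξ), cut off at unit scale, which costs no power of T. The forcing is split at
|θ| = 1/T. High frequencies keep F̃'/(iθ) without a cutoff, and a free wave cut off at unit scale
corrects the initial value. There 1/|θ| ≤ 2 T^{2ε} ⟨θ⟩^{-1+2ε}, so the first piece is bounded by the
Z-norm of F' and the correction by its Y-norm. Low frequencies are cut off at scale T. The
difference in `lowKernel` cancels the singularity at θ = 0 and leaves a profile T²⟨Tω⟩^{-2}.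
Cauchy-Schwarz against the dual weight then gives the factors (1/T + |k|)^{2s} and (1/T + |k|)^{-2s}
with k = 2σξ, which cancel, and the powers of T multiply to T^{4ε} for the squared norm
(`exists_low_part_le`). The condition s > -1/2 is the local integrability of |u|^{2s}.

For uniqueness, a test function in the strip whose integrals along all characteristics vanish is a
characteristic derivative of another one (`exists_antiderivative`). A homogeneous solution therefore
sees only these integrals, and testing it on approximate identities in time at t = 0 shows that it
vanishes (`isVanishingOn_of_transport`). The extension satisfies the equation by
`extension_lineDerivOp` and takes the initial value by `tendsto_extension`. -/

theorem one_le_bracket (x : ℝ) : 1 ≤ bracket x := by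
  unfold bracket
  rw [Real.one_le_sqrt]
  nlinarith [sq_nonneg x]

theorem bracket_pos (x : ℝ) : 0 < bracket x := one_pos.trans_le (one_le_bracket x)

theorem bracket_sq (x : ℝ) : bracket x ^ 2 = 1 + x ^ 2 :=
  Real.sq_sqrt (by positivity)

theorem abs_le_bracket (x : ℝ) : |x| ≤ bracket x :=
  Real.abs_le_sqrt (by linarith)

theorem bracket_le_one_add_abs (x : ℝ) : bracket x ≤ 1 + |x| := by
  refine abs_le_of_sq_le_sq' ?_ (by positivity) |>.2
  rw [bracket_sq]
  nlinarith [sq_abs x, abs_nonneg x]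

theorem one_add_abs_sq_le (x : ℝ) : (1 + |x|) ^ 2 ≤ 2 * bracket x ^ 2 := by
  rw [bracket_sq]
  nlinarith [sq_abs x, sq_nonneg (1 - |x|)]

theorem one_add_abs_le (x : ℝ) : 1 + |x| ≤ 2 * bracket x := by
  linarith [one_le_bracket x, abs_le_bracket x]

@[fun_prop]
theorem continuous_bracket : Continuous bracket := by
  unfold bracket
  fun_prop

@[fun_prop]
theorem measurable_bracket : Measurable bracket := continuous_bracket.measurable

theorem bracket_le_mul (x y : ℝ) : bracket (x + y) ≤ 2 * bracket x * bracket y := by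
  have hx := one_add_abs_sq_le x
  have hy := one_add_abs_sq_le y
  have h1 : bracket (x + y) ≤ (1 + |x|) * (1 + |y|) := by
    have := bracket_le_one_add_abs (x + y)
    nlinarith [abs_add_le x y, mul_nonneg (abs_nonneg x) (abs_nonneg y)]
  refine h1.trans (abs_le_of_sq_le_sq' ?_ ?_).2
  · have := mul_le_mul hx hy (by positivity) (by positivity)
    nlinarith
  · have := bracket_pos x
    have := bracket_pos y
    positivity

/-- Peetre's inequality for a negative exponent. -/
theorem bracket_sub_rpow_le {s : ℝ} (hs : s ≤ 0) (θ k : ℝ) :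
    bracket (θ - k) ^ s ≤ 2 ^ (-s) * bracket k ^ s * bracket θ ^ (-s) := by
  have hp := bracket_pos (θ - k)
  have hq := bracket_pos k
  have hr := bracket_pos θ
  have h : bracket k ≤ 2 * bracket (θ - k) * bracket θ := by
    have h' := bracket_le_mul (k - θ) θ
    have e : bracket (k - θ) = bracket (θ - k) := by
      unfold bracket; congr 1; ring
    rw [e] at h'
    simpa using h'
  have h2 : bracket (θ - k) ^ s ≤ (bracket k / (2 * bracket θ)) ^ s := by
    apply Real.rpow_le_rpow_of_nonpos (by positivity) _ hs
    rw [div_le_iff₀ (by positivity)]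
    linarith
  refine h2.trans (le_of_eq ?_)
  rw [Real.div_rpow hq.le (by positivity), Real.mul_rpow (by positivity) hr.le,
    Real.rpow_neg (by positivity), Real.rpow_neg hr.le]
  field_simp

theorem bracket_two_mul_rpow_le {s : ℝ} (hs : s ≤ 0) {σ : ℝ} (hσ : σ = 1 ∨ σ = -1) (ξ : ℝ) :
    bracket (2 * σ * ξ) ^ s ≤ bracket ξ ^ s := by
  apply Real.rpow_le_rpow_of_nonpos (bracket_pos ξ) _ hs
  unfold bracket
  apply Real.sqrt_le_sqrt
  rcases hσ with rfl | rfl <;> nlinarith [sq_nonneg ξ]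

theorem integrable_bracket_rpow {r : ℝ} (hr : r < -1) : Integrable fun x => bracket x ^ r := by
  have h := integrable_rpow_neg_one_add_norm_sq (E := ℝ) (μ := volume) (r := -r)
    (by simp; linarith)
  refine h.congr (.of_forall fun x => ?_)
  simp only [bracket, Real.sqrt_eq_rpow, Real.norm_eq_abs, sq_abs]
  rw [← Real.rpow_mul (by positivity)]
  congr 1
  ring

theorem bracket_rpow_mul_rpow (x a b : ℝ) : bracket x ^ a * bracket x ^ b = bracket x ^ (a + b) :=
  (Real.rpow_add (bracket_pos x) a b).symm

/-- Rapid decay of a Schwartz function on the line. -/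
theorem exists_norm_le_bracket_rpow (K : 𝓢(ℝ, ℂ)) (N : ℕ) :
    ∃ C : ℝ, 0 ≤ C ∧ ∀ x, ‖K x‖ ≤ C * bracket x ^ (-N : ℝ) := by
  refine ⟨2 ^ N * (Finset.Iic (N, 0)).sup (fun m => SchwartzMap.seminorm ℝ m.1 m.2) K,
    by positivity, fun x => ?_⟩
  have h := SchwartzMap.one_add_le_sup_seminorm_apply (𝕜 := ℝ) (m := (N, 0)) le_rfl le_rfl K x
  simp only [norm_iteratedFDeriv_zero] at h
  have hb := bracket_pos x
  rw [Real.rpow_neg hb.le, Real.rpow_natCast, ← div_eq_mul_inv, le_div_iff₀ (by positivity)]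
  refine le_trans ?_ h
  rw [mul_comm]
  gcongr
  exact bracket_le_one_add_abs x

/-! ### Weighted L² bounds for cutoff profiles, uniform in T and in the spatial frequency. -/

/-- The weight of a rapidly decaying profile: the cutoff costs no more than `⟨ξ⟩^s`. -/
theorem exists_weighted_profile_le (s b : ℝ) (hs' : s ≤ 0) (K : 𝓢(ℝ, ℂ)) :
    ∃ C : ℝ≥0, ∀ σ : ℝ, σ = 1 ∨ σ = -1 → ∀ ξ : ℝ,
      ∫⁻ θ, (ENNReal.ofReal (bracket (θ - 2 * σ * ξ) ^ s * bracket θ ^ b) * ‖K θ‖ₑ) ^ 2 ≤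
        C * ENNReal.ofReal (bracket ξ ^ s) ^ 2 := by
  obtain ⟨N, hN⟩ := exists_nat_gt (-s + b + 1)
  -- N is large enough to absorb ⟨θ⟩^b and the loss ⟨θ⟩^{-s} from Peetre's inequality, and still
  -- leave an integrable square.
  obtain ⟨A, hA0, hA⟩ := exists_norm_le_bracket_rpow K N
  have hint : Integrable fun θ => bracket θ ^ (2 * (-s + b - N)) :=
    integrable_bracket_rpow (by linarith)
  set D : ℝ := (2 ^ (-s) * A) ^ 2 * ∫ θ, bracket θ ^ (2 * (-s + b - N)) with hD
  refine ⟨D.toNNReal, fun σ hσ ξ => ?_⟩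
  have hpt : ∀ θ, (ENNReal.ofReal (bracket (θ - 2 * σ * ξ) ^ s * bracket θ ^ b) * ‖K θ‖ₑ) ^ 2 ≤
      ENNReal.ofReal (bracket ξ ^ s) ^ 2 *
        ENNReal.ofReal ((2 ^ (-s) * A) ^ 2 * bracket θ ^ (2 * (-s + b - N))) := by
    intro θ
    have hb := bracket_pos θ
    have hξ := bracket_pos ξ
    have h1 : bracket (θ - 2 * σ * ξ) ^ s * bracket θ ^ b * ‖K θ‖ ≤
        bracket ξ ^ s * (2 ^ (-s) * A * bracket θ ^ (-s + b - N)) := by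
      calc bracket (θ - 2 * σ * ξ) ^ s * bracket θ ^ b * ‖K θ‖
          ≤ (2 ^ (-s) * bracket ξ ^ s * bracket θ ^ (-s)) * bracket θ ^ b *
              (A * bracket θ ^ (-N : ℝ)) := by
            have := bracket_sub_rpow_le hs' θ (2 * σ * ξ)
            have h2 := bracket_two_mul_rpow_le hs' hσ ξ
            have h3 := hA θ
            gcongr
            refine this.trans ?_
            gcongr
        _ = bracket ξ ^ s * (2 ^ (-s) * A * (bracket θ ^ (-s) * bracket θ ^ b *
              bracket θ ^ (-N : ℝ))) := by ring
        _ = _ := by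
            rw [bracket_rpow_mul_rpow, bracket_rpow_mul_rpow, ← sub_eq_add_neg]
    rw [← ofReal_norm, ← ENNReal.ofReal_mul (by
        have := bracket_pos (θ - 2 * σ * ξ); positivity),
      ← ENNReal.ofReal_pow (by have := bracket_pos (θ - 2 * σ * ξ); positivity),
      ← ENNReal.ofReal_pow (by positivity), ← ENNReal.ofReal_mul (by positivity)]
    apply ENNReal.ofReal_le_ofReal
    have h4 : bracket θ ^ (2 * (-s + b - N)) = (bracket θ ^ (-s + b - N)) ^ 2 := by
      rw [← Real.rpow_mul_natCast hb.le]; congr 1; push_cast; ring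
    rw [h4, ← mul_pow, ← mul_pow]
    have := bracket_pos (θ - 2 * σ * ξ)
    gcongr
  calc _ ≤ ∫⁻ θ, ENNReal.ofReal (bracket ξ ^ s) ^ 2 *
        ENNReal.ofReal ((2 ^ (-s) * A) ^ 2 * bracket θ ^ (2 * (-s + b - N))) :=
        lintegral_mono hpt
    _ = ENNReal.ofReal (bracket ξ ^ s) ^ 2 * ENNReal.ofReal D := by
        rw [lintegral_const_mul']
        · rw [hD, ← integral_const_mul, ofReal_integral_eq_lintegral_ofReal (hint.const_mul _)]
          exact .of_forall fun x => by have := bracket_pos x; positivity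
        · exact ENNReal.pow_ne_top ENNReal.ofReal_ne_top
    _ = _ := by rw [mul_comm]; rfl

theorem integrable_indicator_abs_rpow {r D : ℝ} (hr : -1 < r) (hD : 0 < D) :
    Integrable (fun u : ℝ => (Iio D).indicator (fun x => x ^ r) |u|) ∧
      ∫ u : ℝ, (Iio D).indicator (fun x => x ^ r) |u| = 2 * (D ^ (r + 1) / (r + 1)) := by
  have h : ∫ u : ℝ, (Iio D).indicator (fun x => x ^ r) |u| = 2 * (D ^ (r + 1) / (r + 1)) := by
    rw [integral_comp_abs, setIntegral_indicator measurableSet_Iio, Ioi_inter_Iio,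
      ← integral_Ioc_eq_integral_Ioo, ← intervalIntegral.integral_of_le hD.le,
      integral_rpow (Or.inl hr), Real.zero_rpow (by linarith), sub_zero]
  refine ⟨not_imp_comm.1 integral_undef ?_, h⟩
  rw [h]
  have : 0 < r + 1 := by linarith
  positivity

theorem bracket_le_inv_mul {T : ℝ} (hT : 0 < T) (hT1 : T ≤ 1) (θ : ℝ) :
    bracket θ ≤ T⁻¹ * bracket (T * θ) := by
  refine (abs_le_of_sq_le_sq' ?_ (by have := bracket_pos (T * θ); positivity)).2
  rw [mul_pow, bracket_sq, bracket_sq]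
  have : 1 ≤ (T⁻¹) ^ 2 := one_le_pow₀ ((one_le_inv₀ hT).2 hT1)
  have e : T⁻¹ ^ 2 * (1 + (T * θ) ^ 2) = T⁻¹ ^ 2 + θ ^ 2 := by
    field_simp
  rw [e]
  linarith

theorem bracket_rpow_neg_two (x : ℝ) : bracket x ^ (-2 : ℝ) = (1 + x ^ 2)⁻¹ := by
  rw [Real.rpow_neg (bracket_pos x).le, ← bracket_sq]
  norm_cast

/-- Two regimes meet at distance D = (1/T + |k|)/2 from k. Far from k the first factor is at most
D^{2s}. Near k one has |k| ≤ |θ| + D, hence TD ≤ 1 + T|θ|, so the second factor is O((TD)^{-2})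
while the singularity |θ - k|^{2s} is kept. The point θ = k is excluded because Lean's value of
0^{2s} is 0. -/
theorem bracket_sub_rpow_mul_le {s T : ℝ} (hs' : s < 0) (hT : 0 < T) {θ k D : ℝ}
    (hne : θ ≠ k) (hD : 2 * D = T⁻¹ + |k|) :
    bracket (θ - k) ^ (2 * s) * bracket (T * θ) ^ (-2 : ℝ) ≤
      D ^ (2 * s) * (1 + (T * θ) ^ 2)⁻¹ +
        2 / (T * D) ^ 2 * (Iio D).indicator (fun x => x ^ (2 * s)) |θ - k| := by
  have hTi : 0 < T⁻¹ := by positivity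
  have hD0 : 0 < D := by have := abs_nonneg k; linarith
  have hb := bracket_pos (θ - k)
  rw [bracket_rpow_neg_two]
  by_cases h : |θ - k| < D
  · rw [indicator_of_mem (by exact h)]
    have h1 : bracket (θ - k) ^ (2 * s) ≤ |θ - k| ^ (2 * s) :=
      Real.rpow_le_rpow_of_nonpos (abs_pos.2 (sub_ne_zero.2 hne)) (abs_le_bracket _) (by linarith)
    have h2 : (1 + (T * θ) ^ 2)⁻¹ ≤ 2 / (T * D) ^ 2 := by
      have h3 := one_add_abs_sq_le (T * θ)
      rw [bracket_sq, abs_mul, abs_of_pos hT] at h3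
      have h4 : |k| ≤ |θ| + D := by
        have := abs_sub_abs_le_abs_sub k θ
        rw [abs_sub_comm] at this
        linarith
      have h5 : T * D ≤ 1 + T * |θ| := by
        have : T * (2 * D) = 1 + T * |k| := by rw [hD]; field_simp
        nlinarith
      have h6 : (T * D) ^ 2 ≤ (1 + T * |θ|) ^ 2 := by gcongr
      rw [inv_eq_one_div, div_le_div_iff₀ (by positivity) (by positivity)]
      linarith
    have h7 : 0 ≤ D ^ (2 * s) * (1 + (T * θ) ^ 2)⁻¹ := by positivity
    calc _ ≤ |θ - k| ^ (2 * s) * (2 / (T * D) ^ 2) := by gcongr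
      _ ≤ _ := by linarith
  · rw [indicator_of_notMem (by exact h), mul_zero, add_zero]
    gcongr ?_ * _
    refine Real.rpow_le_rpow_of_nonpos hD0 ?_ (by linarith)
    exact (not_lt.1 h).trans (abs_le_bracket _)

/-- The factor ⟨θ⟩^{2b} costs T^{-2b}⟨Tθ⟩², since 0 ≤ b ≤ 1 and T ≤ 1. What remains is the integral
of ⟨θ-k⟩^{2s}⟨Tθ⟩^{-2}, and both regimes of `bracket_sub_rpow_mul_le` contribute a multiple of
D^{2s}/T: the far one by scaling, the near one because 2s > -1 makes |u|^{2s} integrable at 0 and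
1/D ≤ 2T. -/
theorem exists_low_profile_le {s b : ℝ} (hs : -1 / 2 < s) (hs' : s < 0) (hb : 0 ≤ b)
    (hb' : b ≤ 1) :
    ∃ C : ℝ, 0 ≤ C ∧ ∀ T : ℝ, 0 < T → T ≤ 1 → ∀ k : ℝ,
      ∫⁻ θ, ENNReal.ofReal (bracket (θ - k) ^ s * bracket θ ^ b *
          (T ^ 2 * bracket (T * θ) ^ (-2 : ℝ))) ^ 2 ≤
        ENNReal.ofReal (C * ((T⁻¹ + |k|) ^ (2 * s) * T ^ (3 - 2 * b))) := by
  have hs2 : 0 < 2 * s + 1 := by linarith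
  refine ⟨2 * (Real.pi + 8 / (2 * s + 1)), by have := Real.pi_pos; positivity,
    fun T hT hT1 k => ?_⟩
  have hTi : 0 < T⁻¹ := by positivity
  obtain ⟨D, hD⟩ : ∃ D, 2 * D = T⁻¹ + |k| := ⟨(T⁻¹ + |k|) / 2, by ring⟩
  have hD0 : 0 < D := by have := abs_nonneg k; linarith
  obtain ⟨hi1, he1⟩ := integrable_indicator_abs_rpow (r := 2 * s) (D := D) (by linarith) hD0
  have hi2 : Integrable fun θ : ℝ => (1 + (T * θ) ^ 2)⁻¹ :=
    integrable_inv_one_add_sq.comp_mul_left' hT.ne'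
  have he2 : ∫ θ : ℝ, (1 + (T * θ) ^ 2)⁻¹ = T⁻¹ * Real.pi := by
    rw [Measure.integral_comp_mul_left (fun x : ℝ => (1 + x ^ 2)⁻¹), integral_univ_inv_one_add_sq,
      abs_of_pos hTi, smul_eq_mul]
  set f : ℝ → ℝ := fun θ => T ^ (4 - 2 * b) * (D ^ (2 * s) * (1 + (T * θ) ^ 2)⁻¹ +
    2 / (T * D) ^ 2 * (Iio D).indicator (fun x => x ^ (2 * s)) |θ - k|) with hf
  have hfi : Integrable f :=
    ((hi2.const_mul _).add ((hi1.comp_sub_right k).const_mul _)).const_mul _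
  have hf0 : ∀ θ, 0 ≤ f θ := fun θ => by
    have : 0 ≤ (Iio D).indicator (fun x => x ^ (2 * s)) |θ - k| :=
      indicator_apply_nonneg fun _ => by positivity
    simp only [hf]
    positivity
  have hpt : ∀ θ, θ ≠ k → (bracket (θ - k) ^ s * bracket θ ^ b *
      (T ^ 2 * bracket (T * θ) ^ (-2 : ℝ))) ^ 2 ≤ f θ := by
    intro θ hne
    have h1 := bracket_sub_rpow_mul_le hs' hT hne hD
    have hp := bracket_pos (θ - k)
    have hq := bracket_pos θ
    have hr := bracket_pos (T * θ)
    have h2 : bracket θ ^ (2 * b) ≤ T ^ (-(2 * b)) * bracket (T * θ) ^ (2 : ℝ) := by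
      calc bracket θ ^ (2 * b) ≤ (T⁻¹ * bracket (T * θ)) ^ (2 * b) := by
            gcongr; exact bracket_le_inv_mul hT hT1 θ
        _ = T ^ (-(2 * b)) * bracket (T * θ) ^ (2 * b) := by
            rw [Real.mul_rpow hTi.le hr.le, Real.inv_rpow hT.le, Real.rpow_neg hT.le]
        _ ≤ _ := by
            gcongr
            · exact one_le_bracket _
            · linarith
    calc (bracket (θ - k) ^ s * bracket θ ^ b * (T ^ 2 * bracket (T * θ) ^ (-2 : ℝ))) ^ 2
        = bracket (θ - k) ^ (2 * s) * bracket θ ^ (2 * b) * T ^ (4 : ℝ) *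
            (bracket (T * θ) ^ (-2 : ℝ) * bracket (T * θ) ^ (-2 : ℝ)) := by
          rw [mul_comm 2 s, mul_comm 2 b, Real.rpow_mul hp.le, Real.rpow_mul hq.le]
          norm_cast
          ring
      _ ≤ bracket (θ - k) ^ (2 * s) * (T ^ (-(2 * b)) * bracket (T * θ) ^ (2 : ℝ)) *
            T ^ (4 : ℝ) * (bracket (T * θ) ^ (-2 : ℝ) * bracket (T * θ) ^ (-2 : ℝ)) := by
          gcongr
      _ = (T ^ (4 : ℝ) * T ^ (-(2 * b))) * (bracket (θ - k) ^ (2 * s) *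
            ((bracket (T * θ) ^ (2 : ℝ) * bracket (T * θ) ^ (-2 : ℝ)) *
              bracket (T * θ) ^ (-2 : ℝ))) := by ring
      _ = T ^ (4 - 2 * b) * (bracket (θ - k) ^ (2 * s) * bracket (T * θ) ^ (-2 : ℝ)) := by
          rw [← Real.rpow_add hT, bracket_rpow_mul_rpow, ← sub_eq_add_neg]
          norm_num
      _ ≤ f θ := by
          simp only [hf]
          gcongr
  have hint : ∫ θ, f θ ≤ 2 * (Real.pi + 8 / (2 * s + 1)) *
      ((T⁻¹ + |k|) ^ (2 * s) * T ^ (3 - 2 * b)) := by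
    have e1 : ∫ θ, f θ = T ^ (4 - 2 * b) * (D ^ (2 * s) * (T⁻¹ * Real.pi) +
        2 / (T * D) ^ 2 * (2 * (D ^ (2 * s + 1) / (2 * s + 1)))) := by
      simp only [hf]
      rw [integral_const_mul, integral_add (hi2.const_mul _)
        ((hi1.comp_sub_right k).const_mul _), integral_const_mul, integral_const_mul, he2,
        integral_sub_right_eq_self (fun u => (Iio D).indicator (fun x => x ^ (2 * s)) |u|) k, he1]
    have e2 : D ^ (2 * s + 1) = D ^ (2 * s) * D := by
      rw [Real.rpow_add hD0, Real.rpow_one]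
    have e3 : T ^ (4 - 2 * b) = T ^ (3 - 2 * b) * T := by
      rw [show (4 - 2 * b) = (3 - 2 * b) + 1 by ring, Real.rpow_add hT, Real.rpow_one]
    have e4 : D ^ (2 * s) ≤ 2 * (T⁻¹ + |k|) ^ (2 * s) := by
      rw [← hD, Real.mul_rpow (by norm_num) hD0.le, ← mul_assoc]
      have : (1 : ℝ) ≤ 2 * 2 ^ (2 * s) := by
        have h : (2 : ℝ) * 2 ^ (2 * s) = 2 ^ (2 * s + 1) := by
          rw [Real.rpow_add (by norm_num), Real.rpow_one, mul_comm]
        rw [h]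
        exact Real.one_le_rpow (by norm_num) hs2.le
      exact le_mul_of_one_le_left (by positivity) this
    have e5 : D⁻¹ ≤ 2 * T := by
      rw [inv_le_comm₀ hD0 (by positivity), mul_inv]
      have := abs_nonneg k
      linarith
    rw [e1, e2, e3]
    have e6 : T ^ (3 - 2 * b) * T * (D ^ (2 * s) * (T⁻¹ * Real.pi) +
        2 / (T * D) ^ 2 * (2 * (D ^ (2 * s) * D / (2 * s + 1)))) =
        T ^ (3 - 2 * b) * D ^ (2 * s) * (Real.pi + 4 * (T⁻¹ * D⁻¹) / (2 * s + 1)) := by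
      field_simp
      ring
    have e7 : T⁻¹ * D⁻¹ ≤ 2 := by
      calc T⁻¹ * D⁻¹ ≤ T⁻¹ * (2 * T) := by gcongr
        _ = 2 := by field_simp
    rw [e6]
    calc _ ≤ T ^ (3 - 2 * b) * (2 * (T⁻¹ + |k|) ^ (2 * s)) *
          (Real.pi + 4 * 2 / (2 * s + 1)) := by
          have := Real.pi_pos
          gcongr
      _ = _ := by ring
  calc _ ≤ ∫⁻ θ, ENNReal.ofReal (f θ) := by
        refine lintegral_mono_ae ?_
        filter_upwards [compl_mem_ae_iff.2 (measure_singleton k)] with θ hθ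
        rw [← ENNReal.ofReal_pow (by
          have := bracket_pos (θ - k)
          have := bracket_pos θ
          have := bracket_pos (T * θ)
          positivity)]
        exact ENNReal.ofReal_le_ofReal (hpt θ hθ)
    _ = ENNReal.ofReal (∫ θ, f θ) :=
        (ofReal_integral_eq_lintegral_ofReal hfi (.of_forall hf0)).symm
    _ ≤ _ := ENNReal.ofReal_le_ofReal hint

/-- The dual weight on low frequencies. -/
theorem exists_low_dual_weight_le {s r : ℝ} (hs : -1 / 2 < s) (hs' : s < 0) (hr : -1 / 3 < r)
    (hr' : r ≤ 1) :
    ∃ C : ℝ, 0 ≤ C ∧ ∀ T : ℝ, 0 < T → T ≤ 1 → ∀ k : ℝ,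
      ∫⁻ θ in {θ : ℝ | |θ| ≤ T⁻¹}, ENNReal.ofReal (bracket (θ - k) ^ (-s) * bracket θ ^ r) ^ 2 ≤
        ENNReal.ofReal (C * ((T⁻¹ + |k|) ^ (-(2 * s)) * T ^ (-(2 * r) - 1))) := by
  -- On |θ| ≤ 1/T the first weight, squared, is at most 2(1/T + |k|)^{-2s}. The other is written
  -- ⟨θ⟩^{2r+2/3}⟨θ⟩^{-2/3}: since r > -1/3 the first exponent is positive, and |θ|^{-2/3} is
  -- integrable at 0. The constant is 96 = 12·8, where 12 comes from 2 and the integral of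
  -- |θ|^{-2/3}, and 8 bounds 2^{2r+1}.
  refine ⟨96, by norm_num, fun T hT hT1 k => ?_⟩
  have hTi : 0 < T⁻¹ := by positivity
  have hTi1 : 1 ≤ T⁻¹ := (one_le_inv₀ hT).2 hT1
  have hR : 0 < T⁻¹ + |k| := by positivity
  obtain ⟨hi, he⟩ := integrable_indicator_abs_rpow (r := -2 / 3) (D := 2 * T⁻¹) (by norm_num)
    (by positivity)
  set A : ℝ := 2 * (T⁻¹ + |k|) ^ (-(2 * s)) * (2 * T⁻¹) ^ (2 * r + 2 / 3) with hA
  have hA0 : 0 ≤ A := by positivity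
  have hpt : ∀ θ : ℝ, θ ≠ 0 → |θ| ≤ T⁻¹ → (bracket (θ - k) ^ (-s) * bracket θ ^ r) ^ 2 ≤
      A * (Iio (2 * T⁻¹)).indicator (fun x => x ^ (-2 / 3 : ℝ)) |θ| := by
    intro θ h0 hθ
    have hp := bracket_pos (θ - k)
    have hq := bracket_pos θ
    rw [indicator_of_mem (by simp only [mem_Iio]; linarith)]
    have h1 : bracket (θ - k) ^ (-(2 * s)) ≤ 2 * (T⁻¹ + |k|) ^ (-(2 * s)) := by
      have h2 : bracket (θ - k) ≤ 2 * (T⁻¹ + |k|) := by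
        have := bracket_le_one_add_abs (θ - k)
        have := abs_sub θ k
        have := abs_nonneg k
        linarith
      calc bracket (θ - k) ^ (-(2 * s)) ≤ (2 * (T⁻¹ + |k|)) ^ (-(2 * s)) :=
            Real.rpow_le_rpow hp.le h2 (by linarith)
        _ = 2 ^ (-(2 * s)) * (T⁻¹ + |k|) ^ (-(2 * s)) := by
            rw [Real.mul_rpow (by norm_num) hR.le]
        _ ≤ 2 * (T⁻¹ + |k|) ^ (-(2 * s)) := by
            gcongr
            calc (2 : ℝ) ^ (-(2 * s)) ≤ 2 ^ (1 : ℝ) :=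
                  Real.rpow_le_rpow_of_exponent_le (by norm_num) (by linarith)
              _ = 2 := Real.rpow_one 2
    have h3 : bracket θ ^ (2 * r) ≤ (2 * T⁻¹) ^ (2 * r + 2 / 3) * |θ| ^ (-2 / 3 : ℝ) := by
      calc bracket θ ^ (2 * r) = bracket θ ^ (2 * r + 2 / 3) * bracket θ ^ (-2 / 3 : ℝ) := by
            rw [bracket_rpow_mul_rpow]; congr 1; ring
        _ ≤ _ := by
            refine mul_le_mul (Real.rpow_le_rpow hq.le ?_ (by linarith))
              (Real.rpow_le_rpow_of_nonpos (abs_pos.2 h0) (abs_le_bracket θ) (by norm_num))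
              (by positivity) (by positivity)
            have := bracket_le_one_add_abs θ
            linarith
    calc (bracket (θ - k) ^ (-s) * bracket θ ^ r) ^ 2
        = bracket (θ - k) ^ (-(2 * s)) * bracket θ ^ (2 * r) := by
          rw [show -(2 * s) = -s * (2 : ℕ) by push_cast; ring, mul_comm 2 r,
            Real.rpow_mul_natCast hp.le, Real.rpow_mul hq.le]
          norm_cast
          ring
      _ ≤ (2 * (T⁻¹ + |k|) ^ (-(2 * s))) *
            ((2 * T⁻¹) ^ (2 * r + 2 / 3) * |θ| ^ (-2 / 3 : ℝ)) := by gcongr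
      _ = _ := by rw [hA]; ring
  have hI : ∫ θ, A * (Iio (2 * T⁻¹)).indicator (fun x => x ^ (-2 / 3 : ℝ)) |θ| ≤
      96 * ((T⁻¹ + |k|) ^ (-(2 * s)) * T ^ (-(2 * r) - 1)) := by
    rw [integral_const_mul, he, hA]
    have e1 : (2 * T⁻¹) ^ (2 * r + 2 / 3) * (2 * T⁻¹) ^ (-2 / 3 + 1 : ℝ) ≤
        8 * T ^ (-(2 * r) - 1) := by
      rw [← Real.rpow_add (by positivity), Real.mul_rpow (by norm_num) hTi.le,
        Real.inv_rpow hT.le, ← Real.rpow_neg hT.le]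
      have : (2 : ℝ) ^ (2 * r + 2 / 3 + (-2 / 3 + 1)) ≤ 2 ^ (3 : ℝ) :=
        Real.rpow_le_rpow_of_exponent_le (by norm_num) (by linarith)
      have h8 : (2 : ℝ) ^ (3 : ℝ) = 8 := by norm_num
      rw [show -(2 * r + 2 / 3 + (-2 / 3 + 1)) = -(2 * r) - 1 by ring]
      gcongr
      linarith
    calc _ = 12 * (T⁻¹ + |k|) ^ (-(2 * s)) *
          ((2 * T⁻¹) ^ (2 * r + 2 / 3) * (2 * T⁻¹) ^ (-2 / 3 + 1 : ℝ)) := by ring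
      _ ≤ 12 * (T⁻¹ + |k|) ^ (-(2 * s)) * (8 * T ^ (-(2 * r) - 1)) := by gcongr
      _ = _ := by ring
  have hg0 : ∀ θ : ℝ, 0 ≤ A * (Iio (2 * T⁻¹)).indicator (fun x => x ^ (-2 / 3 : ℝ)) |θ| :=
    fun θ => mul_nonneg hA0 (indicator_apply_nonneg fun _ => by positivity)
  calc _ ≤ ∫⁻ θ in {θ : ℝ | |θ| ≤ T⁻¹},
        ENNReal.ofReal (A * (Iio (2 * T⁻¹)).indicator (fun x => x ^ (-2 / 3 : ℝ)) |θ|) := by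
        refine lintegral_mono_ae ?_
        filter_upwards [ae_restrict_of_ae (compl_mem_ae_iff.2 (measure_singleton (0 : ℝ))),
          ae_restrict_mem (measurableSet_le measurable_norm measurable_const)] with θ h0 hθ
        rw [← ENNReal.ofReal_pow (by
          have := bracket_pos (θ - k)
          have := bracket_pos θ
          positivity)]
        exact ENNReal.ofReal_le_ofReal (hpt θ h0 hθ)
    _ ≤ ∫⁻ θ, ENNReal.ofReal (A * (Iio (2 * T⁻¹)).indicator (fun x => x ^ (-2 / 3 : ℝ)) |θ|) :=
        setLIntegral_le_lintegral _ _
    _ = _ := (ofReal_integral_eq_lintegral_ofReal (hi.const_mul A) (.of_forall hg0)).symm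
    _ ≤ _ := ENNReal.ofReal_le_ofReal hI

theorem lintegral_mul_sq_le {α : Type*} [MeasurableSpace α] {μ : Measure α} {f g : α → ℝ≥0∞}
    (hf : AEMeasurable f μ) (hg : AEMeasurable g μ) :
    (∫⁻ x, f x * g x ∂μ) ^ 2 ≤ (∫⁻ x, f x ^ 2 ∂μ) * ∫⁻ x, g x ^ 2 ∂μ := by
  have h := ENNReal.lintegral_mul_le_Lp_mul_Lq μ Real.HolderConjugate.two_two hf hg
  calc (∫⁻ x, f x * g x ∂μ) ^ 2 ≤ ((∫⁻ x, f x ^ (2 : ℝ) ∂μ) ^ (1 / 2 : ℝ) *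
        (∫⁻ x, g x ^ (2 : ℝ) ∂μ) ^ (1 / 2 : ℝ)) ^ 2 := by gcongr; exact h
    _ = _ := by
        rw [mul_pow, ← ENNReal.rpow_mul_natCast, ← ENNReal.rpow_mul_natCast]
        norm_num

/-- The low frequency part of the Duhamel term: the loss from cutting off at scale `T` is balanced
by the dual weight. -/
theorem exists_low_part_le {s b ε : ℝ} (hs : -1 / 2 < s) (hs' : s < 0) (hb : 1 / 2 < b)
    (hb' : b < 1) (hε : 0 < ε) (hε' : ε < 1 / 6) :
    ∃ C : ℝ≥0, ∀ T : ℝ, 0 < T → T ≤ 1 → ∀ (k : ℝ) (h : ℝ → ℝ≥0∞), Measurable h →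
      ∫⁻ ω, (ENNReal.ofReal (bracket (ω - k) ^ s * bracket ω ^ b *
          (T ^ 2 * bracket (T * ω) ^ (-2 : ℝ))) * ∫⁻ θ in {θ : ℝ | |θ| ≤ T⁻¹}, h θ) ^ 2 ≤
        C * ENNReal.ofReal (T ^ (2 * ε)) ^ 2 *
          ∫⁻ θ, (ENNReal.ofReal (bracket (θ - k) ^ s * bracket θ ^ (b - 1 + 2 * ε)) * h θ) ^ 2 := by
  obtain ⟨C₁, hC₁, h₁⟩ := exists_low_profile_le hs hs' (b := b) (by linarith) hb'.le
  -- The exponent is dual to b - 1 + 2ε; it exceeds -1/3 because b < 1 and ε < 1/6.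
  obtain ⟨C₂, hC₂, h₂⟩ := exists_low_dual_weight_le hs hs' (r := 1 - b - 2 * ε) (by linarith)
    (by linarith)
  refine ⟨(C₁ * C₂).toNNReal, fun T hT hT1 k h hh => ?_⟩
  have hR : 0 < T⁻¹ + |k| := by positivity
  have hmeas : ∀ u v : ℝ, Measurable fun θ =>
      ENNReal.ofReal (bracket (θ - k) ^ u * bracket θ ^ v) := fun u v => by fun_prop
  have hcs : (∫⁻ θ in {θ : ℝ | |θ| ≤ T⁻¹}, h θ) ^ 2 ≤
      (∫⁻ θ in {θ : ℝ | |θ| ≤ T⁻¹},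
        ENNReal.ofReal (bracket (θ - k) ^ (-s) * bracket θ ^ (1 - b - 2 * ε)) ^ 2) *
      ∫⁻ θ, (ENNReal.ofReal (bracket (θ - k) ^ s * bracket θ ^ (b - 1 + 2 * ε)) * h θ) ^ 2 := by
    have e : ∀ θ, h θ = ENNReal.ofReal (bracket (θ - k) ^ (-s) * bracket θ ^ (1 - b - 2 * ε)) *
        (ENNReal.ofReal (bracket (θ - k) ^ s * bracket θ ^ (b - 1 + 2 * ε)) * h θ) := fun θ => by
      have hp := bracket_pos (θ - k)
      have hq := bracket_pos θ
      rw [← mul_assoc, ← ENNReal.ofReal_mul (by positivity)]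
      have : bracket (θ - k) ^ (-s) * bracket θ ^ (1 - b - 2 * ε) *
          (bracket (θ - k) ^ s * bracket θ ^ (b - 1 + 2 * ε)) = 1 := by
        calc _ = (bracket (θ - k) ^ (-s) * bracket (θ - k) ^ s) *
              (bracket θ ^ (1 - b - 2 * ε) * bracket θ ^ (b - 1 + 2 * ε)) := by ring
          _ = 1 := by
              rw [bracket_rpow_mul_rpow, bracket_rpow_mul_rpow]
              ring_nf
              simp
      rw [this]
      simp
    calc _ = (∫⁻ θ in {θ : ℝ | |θ| ≤ T⁻¹},
          ENNReal.ofReal (bracket (θ - k) ^ (-s) * bracket θ ^ (1 - b - 2 * ε)) *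
          (ENNReal.ofReal (bracket (θ - k) ^ s * bracket θ ^ (b - 1 + 2 * ε)) * h θ)) ^ 2 := by
          congr 1
          exact lintegral_congr e
      _ ≤ _ := lintegral_mul_sq_le (hmeas _ _).aemeasurable ((hmeas _ _).mul hh).aemeasurable
      _ ≤ _ := by
          gcongr
          exact Measure.restrict_le_self
  simp_rw [mul_pow _ (∫⁻ θ in {θ : ℝ | |θ| ≤ T⁻¹}, h θ)]
  rw [lintegral_mul_const _ (by fun_prop)]
  calc _ ≤ ENNReal.ofReal (C₁ * ((T⁻¹ + |k|) ^ (2 * s) * T ^ (3 - 2 * b))) *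
        (ENNReal.ofReal (C₂ * ((T⁻¹ + |k|) ^ (-(2 * s)) * T ^ (-(2 * (1 - b - 2 * ε)) - 1))) *
        ∫⁻ θ, (ENNReal.ofReal (bracket (θ - k) ^ s * bracket θ ^ (b - 1 + 2 * ε)) * h θ) ^ 2) := by
        gcongr
        · exact h₁ T hT hT1 k
        · refine hcs.trans ?_
          gcongr
          exact h₂ T hT hT1 k
    _ = _ := by
        rw [← mul_assoc, ← ENNReal.ofReal_mul (by positivity)]
        congr 1
        rw [← ENNReal.ofReal_pow (by positivity)]
        change _ = ENNReal.ofReal _ * _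
        rw [← ENNReal.ofReal_mul (by positivity)]
        congr 1
        -- The ξ-dependent factors of profile and dual weight are exact inverses, and the exponents
        -- of T add up to (3 - 2b) - 2(1 - b - 2ε) - 1 = 4ε.
        have e1 : (T⁻¹ + |k|) ^ (2 * s) * (T⁻¹ + |k|) ^ (-(2 * s)) = 1 := by
          rw [← Real.rpow_add hR]; simp
        have e2 : T ^ (3 - 2 * b) * T ^ (-(2 * (1 - b - 2 * ε)) - 1) = (T ^ (2 * ε)) ^ 2 := by
          rw [← Real.rpow_add hT, ← Real.rpow_mul_natCast hT.le]
          congr 1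
          push_cast
          ring
        calc _ = C₁ * C₂ * ((T⁻¹ + |k|) ^ (2 * s) * (T⁻¹ + |k|) ^ (-(2 * s))) *
              (T ^ (3 - 2 * b) * T ^ (-(2 * (1 - b - 2 * ε)) - 1)) := by ring
          _ = _ := by rw [e1, e2, mul_one]

/-- By the mean value theorem: when |θ| ≤ 1/T, the points Tω and T(ω - θ) are at distance at most 1,
the derivative of K near Tω is O(⟨Tω⟩^{-2}), and the increment T|θ| cancels the division by θ. At θ
= 0 the quotient is 0 by convention. -/
theorem exists_difference_quotient_le (K : 𝓢(ℝ, ℂ)) :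
    ∃ A : ℝ, 0 ≤ A ∧ ∀ T : ℝ, 0 < T → ∀ θ ω : ℝ, |θ| ≤ T⁻¹ →
      ‖(T * K (T * (ω - θ)) - T * K (T * ω)) / (Complex.I * θ)‖ ≤
        A * (T ^ 2 * bracket (T * ω) ^ (-2 : ℝ)) := by
  obtain ⟨A, hA, h⟩ := exists_norm_le_bracket_rpow (SchwartzMap.derivCLM ℂ ℂ K) 2
  -- 16 = 4²: brackets at points of distance at most 1 differ by a factor at most 4.
  refine ⟨16 * A, by positivity, fun T hT θ ω hθ => ?_⟩
  have hb := bracket_pos (T * ω)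
  rcases eq_or_ne θ 0 with rfl | h0
  · simp only [Complex.ofReal_zero, mul_zero, div_zero, norm_zero]
    positivity
  have hd : ∀ z ∈ Metric.closedBall (T * ω) 1,
      ‖deriv K z‖ ≤ 16 * A * bracket (T * ω) ^ (-2 : ℝ) := by
    intro z hz
    rw [Metric.mem_closedBall, Real.dist_eq] at hz
    have hbz := bracket_pos z
    have h1 := h z
    simp only [SchwartzMap.derivCLM_apply, Nat.cast_ofNat] at h1
    refine h1.trans ?_
    have h2 : bracket (T * ω) ≤ 4 * bracket z := by
      have := bracket_le_one_add_abs (T * ω)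
      have := one_add_abs_le z
      have := abs_sub_abs_le_abs_sub (T * ω) z
      have := one_le_bracket z
      rw [abs_sub_comm] at hz
      linarith
    have h3 : bracket z ^ (-2 : ℝ) ≤ (bracket (T * ω) / 4) ^ (-2 : ℝ) :=
      Real.rpow_le_rpow_of_nonpos (by positivity) (by linarith) (by norm_num)
    rw [Real.div_rpow hb.le (by norm_num)] at h3
    have h4 : (4 : ℝ) ^ (-2 : ℝ) = 1 / 16 := by
      rw [Real.rpow_neg (by norm_num)]; norm_num
    rw [h4] at h3
    calc A * bracket z ^ (-2 : ℝ) ≤ A * (bracket (T * ω) ^ (-2 : ℝ) / (1 / 16)) := by gcongr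
      _ = _ := by ring
  have hmvt := (convex_closedBall (T * ω) 1).norm_image_sub_le_of_norm_deriv_le
    (fun z _ => K.differentiableAt) hd (x := T * ω) (y := T * (ω - θ))
    (Metric.mem_closedBall_self zero_le_one) (by
      rw [Metric.mem_closedBall, Real.dist_eq]
      rw [show T * (ω - θ) - T * ω = -(T * θ) by ring, abs_neg, abs_mul, abs_of_pos hT]
      calc T * |θ| ≤ T * T⁻¹ := by gcongr
        _ = 1 := mul_inv_cancel₀ hT.ne')
  rw [show T * (ω - θ) - T * ω = -(T * θ) by ring, norm_neg, norm_mul, Real.norm_of_nonneg hT.le,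
    Real.norm_eq_abs] at hmvt
  rw [← mul_sub, norm_div, norm_mul, norm_mul, Complex.norm_I, one_mul, Complex.norm_real,
    Complex.norm_real, Real.norm_of_nonneg hT.le, Real.norm_eq_abs, div_le_iff₀ (abs_pos.2 h0)]
  calc T * ‖K (T * (ω - θ)) - K (T * ω)‖ ≤
        T * (16 * A * bracket (T * ω) ^ (-2 : ℝ) * (T * |θ|)) := by gcongr
    _ = _ := by ring

/-! ### Schwartz functions sheared along the characteristics. -/

section SmoothFunctions

open scoped ContDiff

theorem norm_iteratedFDeriv_comp_continuousLinearMap_le {E F : Type*} [NormedAddCommGroup E]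
    [NormedSpace ℝ E] [NormedAddCommGroup F] [NormedSpace ℝ F] {f : ℝ → F} (hf : ContDiff ℝ ∞ f)
    (L : E →L[ℝ] ℝ) (n : ℕ) (x : E) :
    ‖iteratedFDeriv ℝ n (fun y => f (L y)) x‖ ≤ ‖L‖ ^ n * ‖iteratedFDeriv ℝ n f (L x)‖ := by
  have h := L.iteratedFDeriv_comp_right hf x (i := n) (mod_cast le_top)
  change ‖iteratedFDeriv ℝ n (f ∘ L) x‖ ≤ _
  rw [h]
  refine (ContinuousMultilinearMap.norm_compContinuousLinearMap_le _ _).trans ?_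
  simp [mul_comm]

/-- The functional `p ↦ x - σ t`. -/
noncomputable def transverse (σ : ℝ) : SpaceTime →L[ℝ] ℝ :=
  EuclideanSpace.proj (1 : Fin 2) - σ • EuclideanSpace.proj (0 : Fin 2)

@[simp]
theorem transverse_apply (σ : ℝ) (p : SpaceTime) : transverse σ p = p 1 - σ * p 0 := by
  simp [transverse]

theorem norm_spaceTime_le (p : SpaceTime) : ‖p‖ ≤ |p 0| + |p 1| := by
  rw [EuclideanSpace.norm_eq]
  apply Real.sqrt_le_iff.2
  constructor
  · positivity
  · simp only [Fin.sum_univ_two, Real.norm_eq_abs]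
    nlinarith [abs_nonneg (p 0), abs_nonneg (p 1)]

/-- Polynomial weights in p split into weights in t and in x - σt; this is why a product η(t)χ(x -
σt) is again Schwartz. -/
theorem norm_le_of_transverse (σ : ℝ) (p : SpaceTime) :
    ‖p‖ ≤ (1 + |σ|) * ((1 + |p 0|) * (1 + |transverse σ p|)) := by
  have h := norm_spaceTime_le p
  have h1 : |p 1| ≤ |transverse σ p| + |σ| * |p 0| := by
    rw [transverse_apply, ← abs_mul]
    have := abs_add_le (p 1 - σ * p 0) (σ * p 0)
    simpa using this
  have := abs_nonneg (p 0)
  have := abs_nonneg σ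
  have := abs_nonneg (transverse σ p)
  nlinarith [mul_nonneg (abs_nonneg (p 0)) (abs_nonneg (transverse σ p)),
    mul_nonneg (abs_nonneg σ) (abs_nonneg (transverse σ p)),
    mul_nonneg (abs_nonneg σ)
      (mul_nonneg (abs_nonneg (p 0)) (abs_nonneg (transverse σ p)))]

/-- The Schwartz function `(t, x) ↦ η(t) χ(x - σ t)`. -/
noncomputable def shearTensor (σ : ℝ) (η : 𝓢(ℝ, ℂ)) : 𝓢(ℝ, ℂ) →L[ℂ] 𝓢(SpaceTime, ℂ) := by
  refine SchwartzMap.mkCLM (fun χ p => η (p 0) * χ (transverse σ p))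
    (fun χ χ' p => by simp [mul_add]) (fun c χ p => by simp; ring) (fun χ => ?_) ?_
  · have h1 : ContDiff ℝ ∞ fun p : SpaceTime => η (p 0) :=
      (η.smooth ⊤).comp (EuclideanSpace.proj (𝕜 := ℝ) (0 : Fin 2)).contDiff
    have h2 : ContDiff ℝ ∞ fun p : SpaceTime => χ (transverse σ p) :=
      (χ.smooth ⊤).comp (transverse σ).contDiff
    exact h1.mul h2
  · rintro ⟨k, n⟩
    let P : SpaceTime →L[ℝ] ℝ := EuclideanSpace.proj (0 : Fin 2)
    let Q := transverse σ
    let A : ℝ := 2 ^ k * (Finset.Iic (k, n)).sup (fun m => SchwartzMap.seminorm ℂ m.1 m.2) η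
    have hA : 0 ≤ A := by positivity
    refine ⟨Finset.Iic (k, n), ∑ i ∈ Finset.range (n + 1),
      (1 + |σ|) ^ k * (n.choose i * (‖P‖ ^ i * A) * (‖Q‖ ^ (n - i) * 2 ^ k)),
      by positivity, fun χ p => ?_⟩
    have h1 : ContDiff ℝ ∞ fun p : SpaceTime => η (P p) := (η.smooth ⊤).comp P.contDiff
    have h2 : ContDiff ℝ ∞ fun p : SpaceTime => χ (Q p) := (χ.smooth ⊤).comp Q.contDiff
    have h := norm_iteratedFDeriv_mul_le h1 h2 p (n := n) (mod_cast le_top)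
    change ‖p‖ ^ k * ‖iteratedFDeriv ℝ n (fun y => η (P y) * χ (Q y)) p‖ ≤ _
    refine (mul_le_mul_of_nonneg_left h (by positivity)).trans ?_
    rw [Finset.mul_sum, Finset.sum_mul]
    refine Finset.sum_le_sum fun i hi => ?_
    have hin : i ≤ n := by simpa [Nat.lt_succ_iff] using hi
    have b1 := norm_iteratedFDeriv_comp_continuousLinearMap_le (η.smooth ⊤) P i p
    have b2 := norm_iteratedFDeriv_comp_continuousLinearMap_le (χ.smooth ⊤) Q (n - i) p
    have b3 := SchwartzMap.one_add_le_sup_seminorm_apply (𝕜 := ℂ) (m := (k, n)) le_rfl hin η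
      (P p)
    have b4 := SchwartzMap.one_add_le_sup_seminorm_apply (𝕜 := ℂ) (m := (k, n)) le_rfl
      (Nat.sub_le n i) χ (Q p)
    have b5 : ‖p‖ ^ k ≤ (1 + |σ|) ^ k * ((1 + ‖P p‖) ^ k * (1 + ‖Q p‖) ^ k) := by
      rw [← mul_pow, ← mul_pow]
      gcongr
      exact norm_le_of_transverse σ p
    calc ‖p‖ ^ k * (n.choose i * ‖iteratedFDeriv ℝ i (fun y => η (P y)) p‖ *
          ‖iteratedFDeriv ℝ (n - i) (fun y => χ (Q y)) p‖)
        ≤ ((1 + |σ|) ^ k * ((1 + ‖P p‖) ^ k * (1 + ‖Q p‖) ^ k)) * (n.choose i *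
          (‖P‖ ^ i * ‖iteratedFDeriv ℝ i η (P p)‖) *
          (‖Q‖ ^ (n - i) * ‖iteratedFDeriv ℝ (n - i) χ (Q p)‖)) := by gcongr
      _ = (1 + |σ|) ^ k * (n.choose i *
          (‖P‖ ^ i * ((1 + ‖P p‖) ^ k * ‖iteratedFDeriv ℝ i η (P p)‖)) *
          (‖Q‖ ^ (n - i) * ((1 + ‖Q p‖) ^ k * ‖iteratedFDeriv ℝ (n - i) χ (Q p)‖))) := by ring
      _ ≤ (1 + |σ|) ^ k * (n.choose i * (‖P‖ ^ i * A) *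
          (‖Q‖ ^ (n - i) * (2 ^ k * (Finset.Iic (k, n)).sup
            (fun m => SchwartzMap.seminorm ℂ m.1 m.2) χ))) := by gcongr
      _ = _ := by
        rw [show schwartzSeminormFamily ℂ ℝ ℂ =
          fun m => SchwartzMap.seminorm ℂ m.1 m.2 from rfl]
        ring

@[simp]
theorem shearTensor_apply (σ : ℝ) (η χ : 𝓢(ℝ, ℂ)) (p : SpaceTime) :
    shearTensor σ η χ p = η (p 0) * χ (p 1 - σ * p 0) := by
  change η (p 0) * χ (transverse σ p) = _
  simp

theorem tsupport_shearTensor_subset {T : ℝ} (σ : ℝ) {η : 𝓢(ℝ, ℂ)} (hη : tsupport η ⊆ Ioo (-T) T)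
    (χ : 𝓢(ℝ, ℂ)) : tsupport (shearTensor σ η χ) ⊆ strip T := by
  have hc : IsClosed ((fun p : SpaceTime => p 0) ⁻¹' tsupport η) :=
    (isClosed_tsupport η).preimage (by fun_prop)
  refine (closure_minimal (fun p hp => ?_) hc).trans fun p hp => hη hp
  apply subset_tsupport
  rw [Function.mem_support] at hp ⊢
  contrapose! hp
  simp [hp]

/-- Fourier transforms of integrable functions all of whose moments are finite grow temperately. -/
theorem hasTemperateGrowth_fourier {a : ℝ → ℂ} (ha : AEStronglyMeasurable a)
    (h : ∀ n : ℕ, Integrable fun x => ‖x‖ ^ n * ‖a x‖) : (𝓕 a).HasTemperateGrowth := by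
  refine ⟨Real.contDiff_fourier fun n _ => h n, fun n => ?_⟩
  refine ⟨0, ∫ v, ‖VectorFourier.fourierPowSMulRight (innerSL ℝ) a v n‖, fun x => ?_⟩
  rw [Real.iteratedFDeriv_fourier (N := ⊤) (fun n _ => h n) ha (by exact le_top), pow_zero,
    mul_one]
  exact VectorFourier.norm_fourierIntegral_le_integral_norm _ _ _ _ _

/-! ### Measure-preserving characteristic coordinates in space and in frequency. -/

theorem measurePreserving_pair :
    MeasurePreserving (fun z : ℝ × ℝ => (!₂[z.1, z.2] : SpaceTime)) := by
  have h1 := (volume_preserving_finTwoArrow ℝ).symm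
  have h2 := PiLp.volume_preserving_toLp (Fin 2)
  have e : (fun z : ℝ × ℝ => (!₂[z.1, z.2] : SpaceTime)) =
      (WithLp.toLp 2) ∘ (MeasurableEquiv.finTwoArrow (α := ℝ)).symm := by
    funext z
    ext i
    fin_cases i <;> rfl
  rw [e]
  exact h2.comp h1

/-- Coordinates along the characteristics. -/
def spaceChart (σ : ℝ) (z : ℝ × ℝ) : SpaceTime := !₂[z.1, z.2 + σ * z.1]

/-- Coordinates on the frequency side: `θ = τ + σ ξ` and `ξ`. -/
def freqChart (σ : ℝ) (z : ℝ × ℝ) : SpaceTime := !₂[z.1 - σ * z.2, z.2]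

@[simp] theorem spaceChart_zero (σ : ℝ) (z : ℝ × ℝ) : spaceChart σ z 0 = z.1 := rfl
@[simp] theorem spaceChart_one (σ : ℝ) (z : ℝ × ℝ) : spaceChart σ z 1 = z.2 + σ * z.1 := rfl
@[simp] theorem freqChart_zero (σ : ℝ) (z : ℝ × ℝ) : freqChart σ z 0 = z.1 - σ * z.2 := rfl
@[simp] theorem freqChart_one (σ : ℝ) (z : ℝ × ℝ) : freqChart σ z 1 = z.2 := rfl

theorem continuous_spaceChart (σ : ℝ) : Continuous (spaceChart σ) := by
  unfold spaceChart
  fun_prop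

theorem continuous_freqChart (σ : ℝ) : Continuous (freqChart σ) := by
  unfold freqChart
  fun_prop

theorem measurePreserving_spaceChart (σ : ℝ) : MeasurePreserving (spaceChart σ) := by
  have h : MeasurePreserving (fun z : ℝ × ℝ => (z.1, z.2 + σ * z.1)) :=
    (MeasurePreserving.id volume).skew_product (g := fun t y => y + σ * t) (by fun_prop)
      (.of_forall fun t => map_add_right_eq_self volume (σ * t))
  exact measurePreserving_pair.comp h

theorem measurePreserving_freqChart (σ : ℝ) : MeasurePreserving (freqChart σ) := by
  have h := (measurePreserving_spaceChart (-σ))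
  have h2 : MeasurePreserving (fun z : ℝ × ℝ => (z.1 - σ * z.2, z.2)) := by
    have h3 : MeasurePreserving (fun z : ℝ × ℝ => (z.1, z.2 - σ * z.1)) :=
      (MeasurePreserving.id volume).skew_product (g := fun t y => y - σ * t) (by fun_prop)
        (.of_forall fun t => by
          simpa [sub_eq_add_neg] using map_add_right_eq_self (volume : Measure ℝ) (-(σ * t)))
    exact (Measure.measurePreserving_swap.comp h3).comp Measure.measurePreserving_swap
  exact measurePreserving_pair.comp h2

theorem measurableEmbedding_spaceChart (σ : ℝ) : MeasurableEmbedding (spaceChart σ) := by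
  refine MeasurableEmbedding.of_measurable_inverse (g := fun p => (p 0, p 1 - σ * p 0))
    (continuous_spaceChart σ).measurable ?_ (by fun_prop) fun z => by simp
  have : range (spaceChart σ) = univ := by
    refine eq_univ_of_forall fun p => ⟨(p 0, p 1 - σ * p 0), ?_⟩
    ext i
    fin_cases i <;> simp
  rw [this]
  exact .univ

theorem measurableEmbedding_freqChart (σ : ℝ) : MeasurableEmbedding (freqChart σ) := by
  refine MeasurableEmbedding.of_measurable_inverse (g := fun p => (p 0 + σ * p 1, p 1))
    (continuous_freqChart σ).measurable ?_ (by fun_prop) fun z => by simp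
  have : range (freqChart σ) = univ := by
    refine eq_univ_of_forall fun p => ⟨(p 0 + σ * p 1, p 1), ?_⟩
    ext i
    fin_cases i <;> simp
  rw [this]
  exact .univ

/-! ### Approximation in Schwartz space and explicit Fourier integrals. -/

/-- For 0 < δ < 1 every derivative of g(δx) - 1 is O(δ(1 + |x|)): for order zero by the mean value
theorem and g(0) = 1, for higher order by the chain rule. The linear growth is absorbed by a
seminorm of φ with one more weight, so each seminorm of the difference is O(δ). -/
theorem tendsto_smulLeftCLM_dilation (g φ : 𝓢(ℝ, ℂ)) (hg : g 0 = 1) :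
    Filter.Tendsto (fun δ : ℝ => SchwartzMap.smulLeftCLM ℂ (fun k => g (δ * k)) φ)
      (nhdsWithin 0 (Ioi 0)) (nhds φ) := by
  have hgd : ∀ δ : ℝ, (fun k : ℝ => g (δ * k)).HasTemperateGrowth := fun δ =>
    g.hasTemperateGrowth.comp (δ • ContinuousLinearMap.id ℝ ℝ).hasTemperateGrowth
  have hbd : ∀ i : ℕ, ∃ A : ℝ, 0 ≤ A ∧ ∀ δ : ℝ, 0 < δ → δ < 1 → ∀ x : ℝ,
      ‖iteratedFDeriv ℝ i (fun k => g (δ * k) - 1) x‖ ≤ A * δ * (1 + ‖x‖) := by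
    intro i
    rcases i with _ | i
    · refine ⟨SchwartzMap.seminorm ℝ 0 1 g, by positivity, fun δ hδ hδ1 x => ?_⟩
      have h := Convex.norm_image_sub_le_of_norm_deriv_le (f := g) (s := univ)
        (C := SchwartzMap.seminorm ℝ 0 1 g) (x := 0) (y := δ * x)
        (fun z _ => g.differentiableAt) (fun z _ => by
          have := SchwartzMap.le_seminorm' ℝ 0 1 g z
          simpa using this) convex_univ trivial trivial
      rw [norm_iteratedFDeriv_zero, ← hg]
      refine h.trans ?_
      rw [sub_zero, norm_mul, Real.norm_of_nonneg hδ.le, mul_assoc]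
      have : 0 ≤ SchwartzMap.seminorm ℝ 0 1 g := by positivity
      gcongr
      linarith
    · refine ⟨SchwartzMap.seminorm ℝ 0 (i + 1) g, by positivity, fun δ hδ hδ1 x => ?_⟩
      have e : iteratedDeriv (i + 1) (fun k => g (δ * k) - 1) x =
          δ ^ (i + 1) • iteratedDeriv (i + 1) g (δ * x) := by
        have e1 : deriv (fun k => g (δ * k) - 1) = deriv (fun k => g (δ * k)) := by
          ext k; simp
        rw [iteratedDeriv_succ', e1, ← iteratedDeriv_succ',
          iteratedDeriv_comp_const_smul (g.smooth (i + 1 : ℕ))]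
      rw [norm_iteratedFDeriv_eq_norm_iteratedDeriv, e, norm_smul, norm_pow,
        Real.norm_of_nonneg hδ.le]
      have h1 := SchwartzMap.le_seminorm' ℝ 0 (i + 1) g (δ * x)
      rw [pow_zero, one_mul] at h1
      have h2 : δ ^ (i + 1) ≤ δ := by
        rw [pow_succ]
        exact mul_le_of_le_one_left hδ.le (pow_le_one₀ hδ.le hδ1.le)
      calc δ ^ (i + 1) * ‖iteratedDeriv (i + 1) g (δ * x)‖
          ≤ δ * SchwartzMap.seminorm ℝ 0 (i + 1) g := by gcongr
        _ = SchwartzMap.seminorm ℝ 0 (i + 1) g * δ * 1 := by ring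
        _ ≤ _ := by
          have := norm_nonneg x
          gcongr
          linarith
  choose A hA0 hA using hbd
  rw [(schwartz_withSeminorms ℂ ℝ ℂ).tendsto_nhds]
  rintro ⟨k, n⟩ ε hε
  let B : ℝ := ∑ i ∈ Finset.range (n + 1), n.choose i * A i *
    (2 ^ (k + 1) * (Finset.Iic (k + 1, n)).sup (fun m => SchwartzMap.seminorm ℝ m.1 m.2) φ)
  have hB : 0 ≤ B := Finset.sum_nonneg fun i _ => by have := hA0 i; positivity
  have key : ∀ δ : ℝ, 0 < δ → δ < 1 → SchwartzMap.seminorm ℂ k n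
      (SchwartzMap.smulLeftCLM ℂ (fun k => g (δ * k)) φ - φ) ≤ B * δ := by
    intro δ hδ hδ1
    refine SchwartzMap.seminorm_le_bound ℂ k n _ (by positivity) fun x => ?_
    have e : (⇑(SchwartzMap.smulLeftCLM ℂ (fun k => g (δ * k)) φ - φ) : ℝ → ℂ) =
        fun x => (g (δ * x) - 1) * φ x := by
      ext x
      simp [SchwartzMap.smulLeftCLM_apply_apply (hgd δ), sub_mul]
    rw [e]
    have hs1 : ContDiff ℝ ∞ fun x : ℝ => g (δ * x) - 1 :=
      ((g.smooth ⊤).comp (contDiff_const.mul contDiff_id)).sub contDiff_const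
    have h := norm_iteratedFDeriv_mul_le hs1 (φ.smooth ⊤) x (n := n) (mod_cast le_top)
    refine (mul_le_mul_of_nonneg_left h (by positivity)).trans ?_
    rw [Finset.mul_sum, Finset.sum_mul]
    refine Finset.sum_le_sum fun i hi => ?_
    have b4 := SchwartzMap.one_add_le_sup_seminorm_apply (𝕜 := ℝ) (m := (k + 1, n)) le_rfl
      (Nat.sub_le n i) φ x
    have b5 : ‖x‖ ^ k ≤ (1 + ‖x‖) ^ k := by gcongr; linarith
    have b6 := hA i δ hδ hδ1 x
    have b7 := hA0 i
    calc ‖x‖ ^ k * (n.choose i * ‖iteratedFDeriv ℝ i (fun x => g (δ * x) - 1) x‖ *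
          ‖iteratedFDeriv ℝ (n - i) φ x‖)
        ≤ (1 + ‖x‖) ^ k * (n.choose i * (A i * δ * (1 + ‖x‖)) *
          ‖iteratedFDeriv ℝ (n - i) φ x‖) := by gcongr
      _ = n.choose i * A i * ((1 + ‖x‖) ^ (k + 1) * ‖iteratedFDeriv ℝ (n - i) φ x‖) * δ := by
          ring
      _ ≤ _ := by gcongr
  have hev : ∀ᶠ δ in nhdsWithin (0 : ℝ) (Ioi 0), 0 < δ ∧ δ < 1 ∧ δ < ε / (B + 1) := by
    have h1 : Ioo (0 : ℝ) (min 1 (ε / (B + 1))) ∈ nhdsWithin (0 : ℝ) (Ioi 0) :=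
      Ioo_mem_nhdsGT (by positivity)
    filter_upwards [h1] with δ hδ
    exact ⟨hδ.1, hδ.2.trans_le (min_le_left _ _), hδ.2.trans_le (min_le_right _ _)⟩
  filter_upwards [hev] with δ ⟨h0, h1, h2⟩
  refine (key δ h0 h1).trans_lt ?_
  rw [lt_div_iff₀ (by positivity)] at h2
  nlinarith

theorem fourier_schwartz_apply {V : Type*} [NormedAddCommGroup V] [InnerProductSpace ℝ V]
    [FiniteDimensional ℝ V] [MeasurableSpace V] [BorelSpace V] (Φ : 𝓢(V, ℂ)) (k : V) :
    (𝓕 Φ) k = ∫ p, Complex.exp (↑(-2 * Real.pi * inner ℝ p k) * Complex.I) * Φ p := by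
  rw [SchwartzMap.fourier_coe, Real.fourier_eq']
  rfl

theorem fourierInv_schwartz_apply {V : Type*} [NormedAddCommGroup V] [InnerProductSpace ℝ V]
    [FiniteDimensional ℝ V] [MeasurableSpace V] [BorelSpace V] (Φ : 𝓢(V, ℂ)) (k : V) :
    (𝓕⁻ Φ) k = ∫ p, Complex.exp (↑(2 * Real.pi * inner ℝ p k) * Complex.I) * Φ p := by
  rw [SchwartzMap.fourierInv_coe, Real.fourierInv_eq']
  rfl

theorem inner_spaceTime (p q : SpaceTime) : inner ℝ p q = p 0 * q 0 + p 1 * q 1 := by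
  simp [PiLp.inner_apply, Fin.sum_univ_two, mul_comm]

theorem integrable_comp_spaceChart (σ : ℝ) {F : SpaceTime → ℂ} (hF : Integrable F) :
    Integrable fun z => F (spaceChart σ z) :=
  ((measurePreserving_spaceChart σ).integrable_comp_emb (measurableEmbedding_spaceChart σ)).2 hF

theorem integral_comp_spaceChart (σ : ℝ) (F : SpaceTime → ℂ) :
    ∫ z, F (spaceChart σ z) = ∫ p, F p :=
  (measurePreserving_spaceChart σ).integral_comp (measurableEmbedding_spaceChart σ) F

theorem abs_fst_le_norm (p : SpaceTime) : |p 0| ≤ ‖p‖ := by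
  simpa using PiLp.norm_apply_le p 0

theorem abs_snd_le_norm (p : SpaceTime) : |p 1| ≤ ‖p‖ := by
  simpa using PiLp.norm_apply_le p 1

/-- A Schwartz function on space-time decays like `(1 + t²)⁻¹`, uniformly in `x`. -/
theorem exists_norm_le_inv_one_add_sq (Φ : 𝓢(SpaceTime, ℂ)) :
    ∃ C : ℝ, 0 ≤ C ∧ ∀ p, ‖Φ p‖ ≤ C * (1 + p 0 ^ 2)⁻¹ := by
  refine ⟨SchwartzMap.seminorm ℝ 0 0 Φ + SchwartzMap.seminorm ℝ 2 0 Φ, by positivity, fun p => ?_⟩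
  have h0 := SchwartzMap.norm_le_seminorm ℝ Φ p
  have h2 := SchwartzMap.norm_pow_mul_le_seminorm ℝ Φ 2 p
  rw [← div_eq_mul_inv, le_div_iff₀ (by positivity)]
  have h3 : p 0 ^ 2 ≤ ‖p‖ ^ 2 := by
    rw [← sq_abs]
    have := abs_fst_le_norm p
    gcongr
  nlinarith [norm_nonneg (Φ p)]

/-! ### Integrals along the characteristics. -/

/-- The inclusion of the line `{(-σ k, k)}`. -/
noncomputable def characteristicLine (σ : ℝ) : ℝ →L[ℝ] SpaceTime :=
  ContinuousLinearMap.toSpanSingleton ℝ !₂[-σ, 1]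

@[simp] theorem characteristicLine_zero (σ k : ℝ) : characteristicLine σ k 0 = -(σ * k) := by
  simp [characteristicLine, mul_comm]

@[simp] theorem characteristicLine_one (σ k : ℝ) : characteristicLine σ k 1 = k := by
  simp [characteristicLine]

/-- Restriction of a Schwartz function to the line `{(-σ k, k)}`. -/
noncomputable def restrictLine (σ : ℝ) : 𝓢(SpaceTime, ℂ) →L[ℂ] 𝓢(ℝ, ℂ) :=
  SchwartzMap.compCLM ℂ (characteristicLine σ).hasTemperateGrowth
    ⟨1, 1, fun k => by
      have := abs_snd_le_norm (characteristicLine σ k)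
      rw [characteristicLine_one] at this
      rw [Real.norm_eq_abs]
      linarith⟩

@[simp] theorem restrictLine_apply (σ : ℝ) (Φ : 𝓢(SpaceTime, ℂ)) (k : ℝ) :
    restrictLine σ Φ k = Φ (characteristicLine σ k) := rfl

/-- The integrals of a Schwartz function along the characteristics. -/
noncomputable def lineIntegral (σ : ℝ) (Φ : 𝓢(SpaceTime, ℂ)) : 𝓢(ℝ, ℂ) :=
  𝓕⁻ (restrictLine σ (𝓕 Φ))

/-- This is the Fourier slice theorem: the transform of the characteristic integrals is 𝓕Φ
restricted to the line, and Fourier inversion applies. Defining `lineIntegral` on the frequency side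
makes it Schwartz at once. -/
theorem lineIntegral_apply (σ : ℝ) (Φ : 𝓢(SpaceTime, ℂ)) (y : ℝ) :
    lineIntegral σ Φ y = ∫ t, Φ (spaceChart σ (t, y)) := by
  set L : ℝ → ℂ := fun y => ∫ t, Φ (spaceChart σ (t, y)) with hL
  have hint : Integrable fun z : ℝ × ℝ => Φ (spaceChart σ z) :=
    integrable_comp_spaceChart σ Φ.integrable
  have hLi : Integrable L := hint.integral_prod_right
  have hLc : Continuous L := by
    obtain ⟨C, hC, h⟩ := exists_norm_le_inv_one_add_sq Φ
    refine continuous_of_dominated (bound := fun t => C * (1 + t ^ 2)⁻¹) (fun y => ?_)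
      (fun y => .of_forall fun t => ?_) (integrable_inv_one_add_sq.const_mul C)
      (.of_forall fun t => ?_)
    · exact (Φ.continuous.comp ((continuous_spaceChart σ).comp (by fun_prop))).aestronglyMeasurable
    · simpa using h (spaceChart σ (t, y))
    · exact Φ.continuous.comp ((continuous_spaceChart σ).comp (by fun_prop))
  have hF : 𝓕 L = restrictLine σ (𝓕 Φ) := by
    ext k
    rw [restrictLine_apply, fourier_schwartz_apply, Real.fourier_eq']
    rw [← integral_comp_spaceChart σ]
    have hi2 : Integrable fun p : SpaceTime =>
        Complex.exp (↑(-2 * Real.pi * inner ℝ p (characteristicLine σ k)) * Complex.I) * Φ p := by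
      refine Φ.integrable.bdd_mul (c := 1) ?_ (.of_forall fun p => ?_)
      · exact Continuous.aestronglyMeasurable (by fun_prop)
      · rw [Complex.norm_exp_ofReal_mul_I]
    rw [show (volume : Measure (ℝ × ℝ)) = volume.prod volume from rfl,
      integral_prod_symm _ (integrable_comp_spaceChart σ hi2)]
    refine integral_congr_ae (.of_forall fun y => ?_)
    simp only [hL, smul_eq_mul]
    rw [← integral_const_mul]
    refine integral_congr_ae (.of_forall fun t => ?_)
    simp only [inner_spaceTime, spaceChart_zero, spaceChart_one, characteristicLine_zero,
      characteristicLine_one]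
    congr 4
    simp
    ring
  have hinv := hLc.fourierInv_fourier_eq hLi (by rw [hF]; exact SchwartzMap.integrable _)
  rw [lineIntegral, SchwartzMap.fourierInv_coe, ← hF, hinv]

/-- Averaging along v is the Fourier multiplier k ↦ 𝓕a(⟨k,v⟩), with a the indicator of (0,3]. Since
a has all moments, the multiplier has temperate growth and preserves Schwartz functions. -/
theorem exists_schwartz_average (Φ : 𝓢(SpaceTime, ℂ)) (v : SpaceTime) :
    ∃ A : 𝓢(SpaceTime, ℂ), ∀ p, A p = ∫ r in Ioc (0 : ℝ) 3, Φ (p - r • v) := by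
  set a : ℝ → ℂ := (Ioc (0 : ℝ) 3).indicator 1 with ha
  have hai : Integrable a :=
    (integrable_indicator_iff measurableSet_Ioc).2 (integrableOn_const (by simp))
  have hmom : ∀ n : ℕ, Integrable fun x => ‖x‖ ^ n * ‖a x‖ := by
    intro n
    have : (fun x => ‖x‖ ^ n * ‖a x‖) = (Ioc (0 : ℝ) 3).indicator fun x => ‖x‖ ^ n := by
      ext x
      by_cases hx : x ∈ Ioc (0 : ℝ) 3 <;> simp [ha, hx]
    rw [this, integrable_indicator_iff measurableSet_Ioc]
    exact (Continuous.integrableOn_Icc (by fun_prop)).mono_set Ioc_subset_Icc_self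
  have hm : (fun k : SpaceTime => 𝓕 a (inner ℝ k v)).HasTemperateGrowth :=
    (hasTemperateGrowth_fourier hai.aestronglyMeasurable hmom).comp
      (Function.hasTemperateGrowth_inner_left v)
  refine ⟨𝓕⁻ (SchwartzMap.smulLeftCLM ℂ (fun k : SpaceTime => 𝓕 a (inner ℝ k v)) (𝓕 Φ)),
    fun p => ?_⟩
  rw [fourierInv_schwartz_apply]
  have e1 : ∀ k : SpaceTime, Complex.exp (↑(2 * Real.pi * inner ℝ k p) * Complex.I) *
      SchwartzMap.smulLeftCLM ℂ (fun k : SpaceTime => 𝓕 a (inner ℝ k v)) (𝓕 Φ) k =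
      ∫ r, Complex.exp (↑(2 * Real.pi * inner ℝ k (p - r • v)) * Complex.I) * (a r * (𝓕 Φ) k) := by
    intro k
    rw [SchwartzMap.smulLeftCLM_apply_apply hm, Real.fourier_eq', smul_eq_mul, ← integral_mul_const,
      ← integral_const_mul]
    refine integral_congr_ae (.of_forall fun r => ?_)
    simp only [smul_eq_mul]
    rw [← mul_assoc, ← mul_assoc, ← mul_assoc, ← Complex.exp_add]
    congr 3
    rw [inner_sub_right, inner_smul_right]
    simp
    ring
  simp_rw [e1]
  rw [integral_integral_swap]
  · rw [← integral_indicator measurableSet_Ioc]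
    refine integral_congr_ae (.of_forall fun r => ?_)
    by_cases hr : r ∈ Ioc (0 : ℝ) 3
    · simp only [ha, indicator_of_mem hr, Pi.one_apply, one_mul]
      rw [← fourierInv_schwartz_apply, FourierTransform.fourierInv_fourier_eq]
    · simp [ha, indicator_of_notMem hr]
  · have h1 : Integrable (fun z : SpaceTime × ℝ => a z.2 * (𝓕 Φ) z.1)
        ((volume : Measure SpaceTime).prod volume) := by
      exact (((𝓕 Φ).integrable (μ := volume)).mul_prod hai).congr
        (.of_forall fun z => mul_comm _ _)
    refine h1.bdd_mul (c := 1) ?_ (.of_forall fun z => ?_)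
    · refine Continuous.aestronglyMeasurable ?_
      fun_prop
    · rw [Complex.norm_exp_ofReal_mul_I]

/-- A smooth cutoff to `[-2, 2]` that equals `1` on `[-1, 1]`. -/
theorem exists_cutoff : ∃ ρ : 𝓢(ℝ, ℂ), (∀ t, |t| ≤ 1 → ρ t = 1) ∧ ∀ t, 2 ≤ |t| → ρ t = 0 := by
  let φ : ContDiffBump (0 : ℝ) := ⟨1, 2, one_pos, one_lt_two⟩
  have hc : HasCompactSupport fun t => ((φ t : ℝ) : ℂ) :=
    φ.hasCompactSupport.comp_left Complex.ofReal_zero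
  have hs : ContDiff ℝ ∞ fun t => ((φ t : ℝ) : ℂ) :=
    Complex.ofRealCLM.contDiff.comp φ.contDiff
  refine ⟨hc.toSchwartzMap hs, fun t ht => ?_, fun t ht => ?_⟩
  · change ((φ t : ℝ) : ℂ) = 1
    rw [φ.one_of_mem_closedBall (by simpa [φ] using ht)]
    simp
  · change ((φ t : ℝ) : ℂ) = 0
    rw [φ.zero_of_le_dist (by simpa [φ] using ht)]
    simp

/-! ### Primitives along the characteristics and uniqueness in the strip. -/

/-- The direction of the characteristics. -/
def direction (σ : ℝ) : SpaceTime := !₂[1, σ]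

@[simp] theorem direction_zero (σ : ℝ) : direction σ 0 = 1 := rfl
@[simp] theorem direction_one (σ : ℝ) : direction σ 1 = σ := rfl

theorem eq_zero_of_tsupport_subset_strip {T : ℝ} {Φ : 𝓢(SpaceTime, ℂ)}
    (hΦ : tsupport Φ ⊆ strip T) {p : SpaceTime} (hp : T ≤ |p 0|) : Φ p = 0 := by
  by_contra h
  have h1 : p 0 ∈ Ioo (-T) T := hΦ (subset_tsupport _ h)
  exact absurd (abs_lt.2 h1) (not_lt.2 hp)

theorem integrable_along_direction {σ T : ℝ} {Φ : 𝓢(SpaceTime, ℂ)}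
    (hΦ : tsupport Φ ⊆ strip T) (q : SpaceTime) :
    Integrable fun u : ℝ => Φ (q + u • direction σ) := by
  refine Continuous.integrable_of_hasCompactSupport (by fun_prop) ?_
  refine HasCompactSupport.intro (isCompact_Icc (a := -T - q 0) (b := T - q 0)) fun u hu => ?_
  apply eq_zero_of_tsupport_subset_strip hΦ
  simp only [PiLp.add_apply, PiLp.smul_apply, direction_zero, smul_eq_mul, mul_one]
  by_contra h
  rw [not_le, abs_lt] at h
  exact hu ⟨by linarith [h.1], by linarith [h.2]⟩

/-- A test function in the strip whose integrals along the characteristics vanish is a derivative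
along the characteristics of a test function in the strip. -/
theorem exists_antiderivative {σ T : ℝ} (hT1 : T ≤ 1) {Φ : 𝓢(SpaceTime, ℂ)}
    (hΦ : tsupport Φ ⊆ strip T) (h0 : ∀ q, ∫ u : ℝ, Φ (q + u • direction σ) = 0) :
    ∃ Ψ : 𝓢(SpaceTime, ℂ), tsupport Ψ ⊆ strip T ∧ ∂_{direction σ} Ψ = Φ := by
  have hint := fun q => integrable_along_direction (σ := σ) hΦ q
  obtain ⟨A, hA⟩ := exists_schwartz_average Φ (direction σ)
  obtain ⟨ρ, hρ1, hρ2⟩ := exists_cutoff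
  have hρt : (fun p : SpaceTime => ρ (p 0)).HasTemperateGrowth :=
    ρ.hasTemperateGrowth.comp (EuclideanSpace.proj (𝕜 := ℝ) (0 : Fin 2)).hasTemperateGrowth
  -- The primitive is the integral of Φ from -∞ along the characteristic. For t ≤ 2 an average of
  -- length 3 already reaches below t = -1, where Φ vanishes, so A equals that integral. It vanishes
  -- for t ≤ -T, and for t ≥ T by `h0`. Hence, as T ≤ 1, the cutoff changes nothing for |t| ≤ 2 and
  -- only removes the spurious part of A beyond t = 2.
  set Ψ := SchwartzMap.smulLeftCLM ℂ (fun p : SpaceTime => ρ (p 0)) A with hΨ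
  have hzero : ∀ q : SpaceTime, ∀ u : ℝ, T ≤ |q 0 + u| → Φ (q + u • direction σ) = 0 :=
    fun q u hu => eq_zero_of_tsupport_subset_strip hΦ (by simpa using hu)
  have hsplit : ∀ q, (∫ u in Iic (0 : ℝ), Φ (q + u • direction σ)) =
      -∫ u in Ioi (0 : ℝ), Φ (q + u • direction σ) := by
    intro q
    have := intervalIntegral.integral_Iic_add_Ioi (b := (0 : ℝ)) (hint q).integrableOn
      (hint q).integrableOn
    rw [h0 q] at this
    exact eq_neg_of_add_eq_zero_left this
  have hleft : ∀ q : SpaceTime, q 0 ≤ -T → ∫ u in Iic (0 : ℝ), Φ (q + u • direction σ) = 0 := by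
    intro q hq
    refine setIntegral_eq_zero_of_forall_eq_zero fun u hu => hzero q u ?_
    rw [mem_Iic] at hu
    exact le_abs.2 (Or.inr (by linarith))
  have hright : ∀ q : SpaceTime, T ≤ q 0 → ∫ u in Iic (0 : ℝ), Φ (q + u • direction σ) = 0 := by
    intro q hq
    rw [hsplit, neg_eq_zero]
    refine setIntegral_eq_zero_of_forall_eq_zero fun u hu => hzero q u ?_
    rw [mem_Ioi] at hu
    exact le_abs.2 (Or.inl (by linarith))
  have hAeq : ∀ q : SpaceTime, q 0 ≤ 2 → A q = ∫ u in Iic (0 : ℝ), Φ (q + u • direction σ) := by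
    intro q hq
    have e1 : (∫ u in Iic (0 : ℝ), Φ (q + u • direction σ)) =
        ∫ r in Ioi (0 : ℝ), Φ (q - r • direction σ) := by
      have := integral_comp_neg_Ioi (0 : ℝ) (fun u => Φ (q + u • direction σ))
      simp only [neg_smul, neg_zero, ← sub_eq_add_neg] at this
      exact this.symm
    rw [e1, hA]
    refine (setIntegral_eq_of_subset_of_forall_sdiff_eq_zero measurableSet_Ioi
      Ioc_subset_Ioi_self fun r hr => ?_).symm
    have h1 : 3 < r := by
      by_contra h
      exact hr.2 ⟨hr.1, not_lt.1 h⟩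
    have := hzero q (-r) (le_abs.2 (Or.inr (by linarith)))
    simpa [sub_eq_add_neg] using this
  have hΨeq : ∀ q, Ψ q = ∫ u in Iic (0 : ℝ), Φ (q + u • direction σ) := by
    intro q
    rw [hΨ, SchwartzMap.smulLeftCLM_apply_apply hρt, smul_eq_mul]
    rcases le_or_gt (q 0) (-1) with h | h
    · rw [hAeq q (by linarith), hleft q (by linarith), mul_zero]
    rcases le_or_gt (q 0) 1 with h' | h'
    · rw [hAeq q (by linarith), hρ1 _ (abs_le.2 ⟨h.le, h'⟩), one_mul]
    rcases le_or_gt (q 0) 2 with h'' | h''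
    · rw [hAeq q h'', hright q (by linarith), mul_zero]
    · rw [hright q (by linarith), hρ2 _ (le_abs.2 (Or.inl h''.le)), zero_mul]
  refine ⟨Ψ, fun p hp => ?_, ?_⟩
  · by_contra hps
    have hpΦ : p ∉ tsupport Φ := fun h => hps (hΦ h)
    rw [notMem_tsupport_iff_eventuallyEq, Filter.EventuallyEq, Metric.eventually_nhds_iff] at hpΦ
    obtain ⟨δ, hδ, hball⟩ := hpΦ
    -- For q within d of p, the points with |u| ≤ d stay in the ball where Φ vanishes. Those with
    -- |u| > d lie outside the strip, provided one integrates over the half-line leading away from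
    -- it; `hsplit` allows that choice.
    set d : ℝ := δ / (2 + ‖direction σ‖) with hd
    have hd0 : 0 < d := by positivity
    have hdδ : d * (2 + ‖direction σ‖) = δ := by rw [hd]; field_simp
    have hnear : ∀ q, dist q p < d → ∀ u : ℝ, |u| ≤ d → Φ (q + u • direction σ) = 0 := by
      intro q hq u hu
      apply hball
      calc dist (q + u • direction σ) p ≤ dist (q + u • direction σ) q + dist q p :=
            dist_triangle _ _ _
        _ = |u| * ‖direction σ‖ + dist q p := by simp [dist_eq_norm, norm_smul]
        _ < d * ‖direction σ‖ + d + d := by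
            have : |u| * ‖direction σ‖ ≤ d * ‖direction σ‖ := by gcongr
            linarith
        _ = δ := by rw [← hdδ]; ring
    have hq0 : ∀ q : SpaceTime, dist q p < d → |q 0 - p 0| < d := by
      intro q hq
      have := abs_fst_le_norm (q - p)
      rw [← dist_eq_norm] at this
      exact lt_of_le_of_lt (by simpa using this) hq
    refine (notMem_tsupport_iff_eventuallyEq.2 ?_) hp
    rw [Filter.EventuallyEq, Metric.eventually_nhds_iff]
    refine ⟨d, hd0, fun q hq => ?_⟩
    have h1 := abs_lt.1 (hq0 q hq)
    rw [hΨeq, Pi.zero_apply]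
    have hps' : p 0 ≤ -T ∨ T ≤ p 0 := by
      by_contra h
      push Not at h
      exact hps h
    rcases hps' with h | h
    · refine setIntegral_eq_zero_of_forall_eq_zero fun u hu => ?_
      rw [mem_Iic] at hu
      by_cases hu' : |u| ≤ d
      · exact hnear q hq u hu'
      · rw [abs_of_nonpos hu, not_le] at hu'
        exact hzero q u (le_abs.2 (Or.inr (by linarith)))
    · rw [hsplit, neg_eq_zero]
      refine setIntegral_eq_zero_of_forall_eq_zero fun u hu => ?_
      rw [mem_Ioi] at hu
      by_cases hu' : |u| ≤ d
      · exact hnear q hq u hu'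
      · rw [abs_of_pos hu, not_le] at hu'
        exact hzero q u (le_abs.2 (Or.inl (by linarith)))
  · ext p
    rw [SchwartzMap.lineDerivOp_apply]
    have hline : ∀ t : ℝ, Ψ (p + t • direction σ) =
        Ψ p + ∫ u in (0 : ℝ)..t, Φ (p + u • direction σ) := by
      intro t
      rw [hΨeq, hΨeq, ← intervalIntegral.integral_Iic_sub_Iic (hint p).integrableOn
        (hint p).integrableOn, add_sub_cancel]
      rw [← integral_indicator measurableSet_Iic, ← integral_indicator measurableSet_Iic,
        ← integral_add_right_eq_self ((Iic t).indicator fun x => Φ (p + x • direction σ)) t]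
      refine integral_congr_ae (.of_forall fun u => ?_)
      have hmem : u + t ∈ Iic t ↔ u ∈ Iic (0 : ℝ) := by simp
      by_cases hu : u ∈ Iic (0 : ℝ)
      · simp only [indicator_of_mem hu, indicator_of_mem (hmem.2 hu)]
        congr 1
        module
      · simp only [indicator_of_notMem hu, indicator_of_notMem (fun h => hu (hmem.1 h))]
    have hd : HasDerivAt (fun t : ℝ => Ψ (p + t • direction σ)) (Φ p) 0 := by
      simp_rw [hline]
      have h := intervalIntegral.integral_hasDerivAt_right (a := (0 : ℝ)) (b := 0)
        (f := fun u => Φ (p + u • direction σ)) ((hint p).intervalIntegrable)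
        (Continuous.stronglyMeasurableAtFilter (by fun_prop) _ _)
        (Continuous.continuousAt (by fun_prop))
      simpa using h.const_add (Ψ p)
    exact hd.deriv

/-- An approximate identity, together with its common Fourier transform profile. -/
theorem exists_mollifier : ∃ (g : 𝓢(ℝ, ℂ)) (m : ℝ → 𝓢(ℝ, ℂ)), g 0 = 1 ∧ ∀ δ : ℝ, 0 < δ →
    (∀ k, (𝓕 (m δ)) k = g (δ * k)) ∧ tsupport (m δ) ⊆ Icc (-δ) δ ∧ ∫ t, m δ t = 1 ∧
      ∫ t, ‖m δ t‖ = 1 := by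
  let φ : ContDiffBump (0 : ℝ) := ⟨1 / 2, 1, by norm_num, by norm_num⟩
  let f : ℝ → ℝ := φ.normed volume
  have hf0 : ∀ t, 0 ≤ f t := φ.nonneg_normed
  have hf1 : ∫ t, f t = 1 := φ.integral_normed
  have hfc : HasCompactSupport f := φ.hasCompactSupport_normed
  have hfs : ContDiff ℝ ∞ f := φ.contDiff_normed
  have hft : ∀ t, 1 ≤ |t| → f t = 0 := by
    intro t ht
    have : t ∉ Function.support f := by
      rw [φ.support_normed_eq]
      simpa [φ] using ht
    simpa using this
  have hC : HasCompactSupport fun t => (f t : ℂ) := hfc.comp_left Complex.ofReal_zero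
  have hS : ContDiff ℝ ∞ fun t => (f t : ℂ) := Complex.ofRealCLM.contDiff.comp hfs
  let η : 𝓢(ℝ, ℂ) := hC.toSchwartzMap hS
  have hη : ∀ t, η t = f t := fun t => rfl
  have hex : ∀ δ : ℝ, ∃ m : 𝓢(ℝ, ℂ), 0 < δ → ∀ t, m t = (δ⁻¹ * f (δ⁻¹ * t) : ℝ) := by
    intro δ
    by_cases hδ : 0 < δ
    · refine ⟨(δ⁻¹ : ℂ) • SchwartzMap.compCLMOfContinuousLinearEquiv ℂ
        (ContinuousLinearEquiv.unitsEquivAut ℝ (Units.mk0 δ⁻¹ (by positivity))) η,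
        fun _ t => ?_⟩
      simp [hη, mul_comm]
    · exact ⟨0, fun h => absurd h hδ⟩
  choose m hm using hex
  refine ⟨𝓕 η, m, ?_, fun δ hδ => ⟨fun k => ?_, ?_, ?_, ?_⟩⟩
  · rw [fourier_schwartz_apply]
    simp [hη, integral_complex_ofReal, hf1]
  · rw [fourier_schwartz_apply, fourier_schwartz_apply]
    have h := Measure.integral_comp_mul_left (fun t : ℝ =>
      Complex.exp (↑(-2 * Real.pi * inner ℝ t (δ * k)) * Complex.I) * η t) δ⁻¹
    rw [inv_inv, abs_of_pos hδ] at h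
    have h2 : (∫ t : ℝ, Complex.exp (↑(-2 * Real.pi * inner ℝ t (δ * k)) * Complex.I) * η t) =
        (δ⁻¹ : ℝ) • ∫ t : ℝ, Complex.exp (↑(-2 * Real.pi * inner ℝ (δ⁻¹ * t) (δ * k)) *
          Complex.I) * η (δ⁻¹ * t) := by
      rw [h, smul_smul, inv_mul_cancel₀ hδ.ne', one_smul]
    rw [h2, ← integral_smul]
    refine integral_congr_ae (.of_forall fun t => ?_)
    simp only [hm δ hδ, hη, Complex.real_smul]
    have e : inner ℝ (δ⁻¹ * t) (δ * k) = inner ℝ t k := by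
      simp only [RCLike.inner_apply, conj_trivial]
      field_simp
    rw [e]
    push_cast
    ring
  · refine closure_minimal (fun t ht => ?_) isClosed_Icc
    refine abs_le.1 ?_
    by_contra h
    rw [Function.mem_support, hm δ hδ] at ht
    apply ht
    rw [hft, mul_zero, Complex.ofReal_zero]
    rw [abs_mul, abs_of_pos (by positivity), ← div_eq_inv_mul, le_div_iff₀ hδ]
    linarith
  · simp only [hm δ hδ, integral_complex_ofReal]
    rw [integral_const_mul, Measure.integral_comp_mul_left, hf1, inv_inv, abs_of_pos hδ]
    simp [hδ.ne']
  · have e : ∀ t, ‖m δ t‖ = δ⁻¹ * f (δ⁻¹ * t) := fun t => by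
      rw [hm δ hδ, Complex.norm_real, Real.norm_of_nonneg]
      have := hf0 (δ⁻¹ * t)
      positivity
    simp only [e]
    rw [integral_const_mul, Measure.integral_comp_mul_left, hf1, inv_inv, abs_of_pos hδ]
    simp [hδ.ne']

theorem fourier_tensor (η χ : 𝓢(ℝ, ℂ)) (k : SpaceTime) :
    (𝓕 (shearTensor 0 η χ)) k = (𝓕 η) (k 0) * (𝓕 χ) (k 1) := by
  rw [fourier_schwartz_apply, fourier_schwartz_apply, fourier_schwartz_apply,
    ← integral_comp_spaceChart 0, ← integral_prod_mul]
  refine integral_congr_ae (.of_forall fun z => ?_)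
  simp only [inner_spaceTime, shearTensor_apply, spaceChart_zero, spaceChart_one,
    RCLike.inner_apply, conj_trivial, zero_mul, add_zero, sub_zero]
  have e : Complex.exp (↑(-2 * Real.pi * (z.1 * k 0 + z.2 * k 1)) * Complex.I) =
      Complex.exp (↑(-2 * Real.pi * (k 0 * z.1)) * Complex.I) *
        Complex.exp (↑(-2 * Real.pi * (k 1 * z.2)) * Complex.I) := by
    rw [← Complex.exp_add]
    congr 1
    push_cast
    ring
  rw [e]
  ring

theorem fourierInv_tensor (η χ : 𝓢(ℝ, ℂ)) (k : SpaceTime) :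
    (𝓕⁻ (shearTensor 0 η χ)) k = (𝓕⁻ η) (k 0) * (𝓕⁻ χ) (k 1) := by
  rw [SchwartzMap.fourierInv_coe, Real.fourierInv_eq_fourier_neg, ← SchwartzMap.fourier_coe,
    fourier_tensor, SchwartzMap.fourierInv_coe, SchwartzMap.fourierInv_coe,
    Real.fourierInv_eq_fourier_neg, Real.fourierInv_eq_fourier_neg]
  rfl

/-- Uniqueness for the homogeneous transport equation in the strip. -/
theorem isVanishingOn_of_transport {σ T : ℝ} (hσ : σ = 1 ∨ σ = -1) (hT : 0 < T) (hT1 : T ≤ 1)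
    (w : 𝓢'(SpaceTime, ℂ))
    (hw : ∀ Ψ : 𝓢(SpaceTime, ℂ), tsupport Ψ ⊆ strip T → w (∂_{direction σ} Ψ) = 0)
    {g : 𝓢(ℝ, ℂ)} {m : ℝ → 𝓢(ℝ, ℂ)} (hg : g 0 = 1)
    (hm : ∀ δ : ℝ, 0 < δ → (∀ k, (𝓕 (m δ)) k = g (δ * k)) ∧ tsupport (m δ) ⊆ Icc (-δ) δ ∧
      ∫ t, m δ t = 1 ∧ ∫ t, ‖m δ t‖ = 1)
    (h0 : ∀ χ : 𝓢(ℝ, ℂ), Filter.Tendsto (fun δ => w (shearTensor 0 (m δ) χ))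
      (nhdsWithin 0 (Ioi 0)) (nhds 0)) :
    Distribution.IsVanishingOn w (strip T) := by
  obtain ⟨δ₀, hδ₀, hδ₀T⟩ := exists_between hT
  obtain ⟨-, hsupp, hone, -⟩ := hm δ₀ hδ₀
  set η := m δ₀
  have hη : tsupport η ⊆ Ioo (-T) T := hsupp.trans (Icc_subset_Ioo (by linarith) hδ₀T)
  -- Φ and η(t) times its characteristic integrals have the same characteristic integrals because ∫
  -- η = 1. Their difference is a characteristic derivative, on which w vanishes.
  have hred : ∀ Φ : 𝓢(SpaceTime, ℂ), tsupport Φ ⊆ strip T →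
      w Φ = w (shearTensor σ η (lineIntegral σ Φ)) := by
    intro Φ hΦ
    set N := shearTensor σ η (lineIntegral σ Φ)
    have hN : tsupport N ⊆ strip T := tsupport_shearTensor_subset σ hη _
    have hsub : tsupport (Φ - N) ⊆ strip T :=
      (tsupport_sub _ _).trans (union_subset hΦ hN)
    obtain ⟨Ψ, hΨ, he⟩ := exists_antiderivative (σ := σ) hT1 (Φ := Φ - N) hsub fun q => by
      have e1 : (∫ u : ℝ, Φ (q + u • direction σ)) = lineIntegral σ Φ (q 1 - σ * q 0) := by
        rw [lineIntegral_apply, ← integral_add_right_eq_self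
          (fun t => Φ (spaceChart σ (t, q 1 - σ * q 0))) (q 0)]
        refine integral_congr_ae (.of_forall fun u => ?_)
        simp only
        congr 1
        ext i
        fin_cases i
        · simp [add_comm]
        · simp
          ring
      have e2 : (∫ u : ℝ, N (q + u • direction σ)) = lineIntegral σ Φ (q 1 - σ * q 0) := by
        have : ∀ u : ℝ, N (q + u • direction σ) =
            η (u + q 0) * lineIntegral σ Φ (q 1 - σ * q 0) := by
          intro u
          simp only [N, shearTensor_apply, PiLp.add_apply, PiLp.smul_apply, direction_zero,
            direction_one, smul_eq_mul, mul_one]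
          congr 2
          · ring
          · ring
        simp_rw [this]
        rw [integral_mul_const, integral_add_right_eq_self (fun t => η t) (q 0), hone, one_mul]
      simp only [sub_apply]
      rw [integral_sub (integrable_along_direction hΦ q) (integrable_along_direction hN q), e1, e2,
        sub_self]
    have := hw Ψ hΨ
    rw [he, map_sub, sub_eq_zero] at this
    exact this
  -- On the line (-σk, k) the transform of m_δ is g(-σδk), so the multiplier needs this reflection
  -- of g.
  obtain ⟨g', hg'⟩ : ∃ g' : 𝓢(ℝ, ℂ), ∀ k, g' k = g (-σ * k) := by
    rcases hσ with rfl | rfl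
    · exact ⟨SchwartzMap.compCLMOfContinuousLinearEquiv ℂ (ContinuousLinearEquiv.neg ℝ) g,
        fun k => by simp⟩
    · exact ⟨g, fun k => by simp⟩
  have hg'0 : g' 0 = 1 := by rw [hg', mul_zero, hg]
  -- Apply `hred` to m_δ ⊗ χ. Its characteristic integrals converge to χ in Schwartz space as δ → 0,
  -- while w of it tends to 0 by `h0`; continuity of w identifies the two limits.
  have hN0 : ∀ χ : 𝓢(ℝ, ℂ), w (shearTensor σ η χ) = 0 := by
    intro χ
    have hlim := tendsto_smulLeftCLM_dilation g' (𝓕 χ) hg'0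
    have hcont : Continuous fun φ : 𝓢(ℝ, ℂ) => w (shearTensor σ η (𝓕⁻ φ)) := by
      have h1 : Continuous fun φ : 𝓢(ℝ, ℂ) => 𝓕⁻ φ :=
        (FourierTransform.fourierInvCLM ℂ 𝓢(ℝ, ℂ)).continuous
      exact (map_continuous w).comp ((shearTensor σ η).continuous.comp h1)
    have h2 := (hcont.tendsto (𝓕 χ)).comp hlim
    rw [FourierTransform.fourierInv_fourier_eq] at h2
    refine tendsto_nhds_unique (h2.congr' ?_) (h0 χ)
    have hev : Ioo (0 : ℝ) T ∈ nhdsWithin (0 : ℝ) (Ioi 0) := Ioo_mem_nhdsGT hT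
    filter_upwards [hev] with δ hδ
    obtain ⟨hF, hs, -, -⟩ := hm δ hδ.1
    rw [hred (shearTensor 0 (m δ) χ)
      (tsupport_shearTensor_subset 0 (hs.trans (Icc_subset_Ioo (by linarith [hδ.2]) hδ.2)) χ)]
    simp only [Function.comp]
    congr 3
    ext k
    have hgd : (fun k : ℝ => g' (δ * k)).HasTemperateGrowth :=
      g'.hasTemperateGrowth.comp (δ • ContinuousLinearMap.id ℝ ℝ).hasTemperateGrowth
    rw [SchwartzMap.smulLeftCLM_apply_apply hgd, restrictLine_apply, fourier_tensor, hF, hg',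
      characteristicLine_zero, characteristicLine_one, smul_eq_mul]
    congr 2
    ring
  intro Φ hΦ
  rw [hred Φ hΦ, hN0]

/-! ### Functions that represent Fourier transforms of tempered distributions. -/

section Representatives

variable {E : Type*} [NormedAddCommGroup E] [InnerProductSpace ℝ E] [FiniteDimensional ℝ E]
  [MeasurableSpace E] [BorelSpace E]

theorem two_pi_ne_zero : (2 * Real.pi : ℝ) ≠ 0 := by positivity

theorem quasiMeasurePreserving_smul {r : ℝ} (hr : r ≠ 0) :
    Measure.QuasiMeasurePreserving (fun x : E => r • x) := by
  refine ⟨by fun_prop, ?_⟩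
  rw [Measure.map_addHaar_smul volume hr]
  exact Measure.smul_absolutelyContinuous

/-- Two functions representing the Fourier transform of the same distribution agree almost
everywhere. -/
theorem IsFourierTransform.ae_eq {u : 𝓢'(E, ℂ)} {G G' : E → ℂ} (h : IsFourierTransform u G)
    (h' : IsFourierTransform u G') : G =ᵐ[volume] G' := by
  set c : ℝ := 2 * Real.pi
  have hc : c ≠ 0 := two_pi_ne_zero
  have hloc : ∀ {G : E → ℂ}, IsFourierTransform u G →
      LocallyIntegrable (fun k => G (c • k)) := by
    intro G hG x
    let φ : ContDiffBump x := ⟨1, 2, one_pos, one_lt_two⟩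
    have hφc : HasCompactSupport fun t => ((φ t : ℝ) : ℂ) :=
      φ.hasCompactSupport.comp_left Complex.ofReal_zero
    have hφs : ContDiff ℝ ∞ fun t => ((φ t : ℝ) : ℂ) :=
      Complex.ofRealCLM.contDiff.comp φ.contDiff
    refine ⟨Metric.closedBall x 1, Metric.closedBall_mem_nhds x one_pos, ?_⟩
    have hi := (hG.2 (hφc.toSchwartzMap hφs)).1.integrableOn (s := Metric.closedBall x 1)
    refine hi.congr_fun (fun k hk => ?_) measurableSet_closedBall
    change G (c • k) * ((φ k : ℝ) : ℂ) = _
    rw [φ.one_of_mem_closedBall hk]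
    simp
  have hae : ∀ᵐ k : E, G (c • k) - G' (c • k) = 0 := by
    refine ae_eq_zero_of_integral_contDiff_smul_eq_zero ((hloc h).sub (hloc h')) fun g hg hgc => ?_
    have hφc : HasCompactSupport fun t => ((g t : ℝ) : ℂ) := hgc.comp_left Complex.ofReal_zero
    have hφs : ContDiff ℝ ∞ fun t => ((g t : ℝ) : ℂ) := Complex.ofRealCLM.contDiff.comp hg
    obtain ⟨i1, e1⟩ := h.2 (hφc.toSchwartzMap hφs)
    obtain ⟨i2, e2⟩ := h'.2 (hφc.toSchwartzMap hφs)
    have e3 := integral_sub i1 i2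
    rw [← e1, ← e2, sub_self] at e3
    rw [← e3]
    refine integral_congr_ae (.of_forall fun k => ?_)
    change (g k) • (G (c • k) - G' (c • k)) = G (c • k) * ((g k : ℝ) : ℂ) -
      G' (c • k) * ((g k : ℝ) : ℂ)
    rw [Complex.real_smul]
    ring
  have := (quasiMeasurePreserving_smul (E := E) (inv_ne_zero hc)).ae hae
  filter_upwards [this] with p hp
  rw [smul_inv_smul₀ hc] at hp
  exact sub_eq_zero.1 hp

/-- A function with a finite weighted `L¹` norm is a Fourier transform. -/
theorem exists_isFourierTransform {G : E → ℂ} (hG : Measurable G) (N : ℕ)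
    (hN : ∫⁻ k : E, ENNReal.ofReal ((1 + ‖k‖) ^ (-N : ℝ)) * ‖G ((2 * Real.pi) • k)‖ₑ ≠ ⊤) :
    ∃ u : 𝓢'(E, ℂ), IsFourierTransform u G := by
  set H : E → ℂ := fun k => G ((2 * Real.pi) • k) with hH
  have hHm : Measurable H := hG.comp (by fun_prop)
  set W : E → ℝ := fun k => (1 + ‖k‖) ^ (-N : ℝ) * ‖H k‖ with hW
  have hW0 : ∀ k, 0 ≤ W k := fun k => by positivity
  have hWi : Integrable W := by
    refine ⟨by fun_prop, ?_⟩
    rw [hasFiniteIntegral_iff_ofReal (.of_forall hW0)]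
    refine lt_of_eq_of_lt ?_ (lt_top_iff_ne_top.2 hN)
    refine lintegral_congr fun k => ?_
    rw [hW, ENNReal.ofReal_mul (by positivity), ofReal_norm]
  have hbound : ∀ (φ : 𝓢(E, ℂ)) (k : E), ‖H k * φ k‖ ≤ W k *
      (2 ^ N * (Finset.Iic (N, 0)).sup (fun m => SchwartzMap.seminorm ℂ m.1 m.2) φ) := by
    intro φ k
    have h := SchwartzMap.one_add_le_sup_seminorm_apply (𝕜 := ℂ) (m := (N, 0)) le_rfl le_rfl φ k
    rw [norm_iteratedFDeriv_zero] at h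
    have hk : (0 : ℝ) < 1 + ‖k‖ := by positivity
    calc ‖H k * φ k‖ = (1 + ‖k‖) ^ (-N : ℝ) * ‖H k‖ * ((1 + ‖k‖) ^ N * ‖φ k‖) := by
          rw [norm_mul, Real.rpow_neg hk.le, Real.rpow_natCast]
          field_simp
      _ ≤ _ := by
          simp only [hW]
          gcongr
  have hint : ∀ φ : 𝓢(E, ℂ), Integrable fun k => H k * φ k := fun φ =>
    (hWi.mul_const _).mono' (hHm.aestronglyMeasurable.mul φ.continuous.aestronglyMeasurable)
      (.of_forall (hbound φ))
  let A : 𝓢(E, ℂ) →L[ℂ] ℂ := SchwartzMap.mkCLMtoNormedSpace (𝕜 := ℂ) (𝕜' := ℂ)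
    (σ := RingHom.id ℂ) (fun φ => ∫ k, H k * φ k)
    (fun φ φ' => by
      rw [← integral_add (hint φ) (hint φ')]
      simp [mul_add])
    (fun c φ => by
      rw [RingHom.id_apply, ← integral_smul]
      refine integral_congr_ae (.of_forall fun k => ?_)
      simp only [smul_apply, smul_eq_mul]
      ring)
    ⟨Finset.Iic (N, 0), (∫ k, W k) * 2 ^ N, by
        have : 0 ≤ ∫ k, W k := integral_nonneg fun k => hW0 k
        positivity, fun φ => by
      have := norm_integral_le_of_norm_le (hWi.mul_const _) (.of_forall (hbound φ))
      rw [integral_mul_const, ← mul_assoc] at this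
      exact this⟩
  let v : 𝓢'(E, ℂ) := ContinuousLinearMap.toPointwiseConvergenceCLM _ _ _ _ A
  refine ⟨𝓕⁻ v, hG, fun φ => ⟨hint φ, ?_⟩⟩
  rw [FourierTransform.fourier_fourierInv_eq]
  rfl

theorem IsFourierTransform.apply_eq {u : 𝓢'(E, ℂ)} {G : E → ℂ} (h : IsFourierTransform u G)
    (φ : 𝓢(E, ℂ)) : u φ = ∫ k : E, G ((2 * Real.pi) • k) * (𝓕⁻ φ) k := by
  rw [← (h.2 (𝓕⁻ φ)).2, TemperedDistribution.fourier_apply,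
    FourierTransform.fourier_fourierInv_eq]

end Representatives

/-! ### The norms in characteristic coordinates. -/

theorem lintegral_comp_freqChart (σ : ℝ) {F : SpaceTime → ℝ≥0∞} (hF : Measurable F) :
    ∫⁻ p, F p = ∫⁻ ξ, ∫⁻ θ, F (freqChart σ (θ, ξ)) := by
  rw [← (measurePreserving_freqChart σ).lintegral_comp hF,
    show (volume : Measure (ℝ × ℝ)) = volume.prod volume from rfl,
    lintegral_prod_symm (fun z => F (freqChart σ z))
      (hF.comp (continuous_freqChart σ).measurable).aemeasurable]

/-- The square of the `Z`-norm in characteristic coordinates on the frequency side. -/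
noncomputable def zSq (σ s b : ℝ) (h : ℝ × ℝ → ℂ) : ℝ≥0∞ :=
  ∫⁻ ξ, ∫⁻ θ, (ENNReal.ofReal (bracket (θ - 2 * σ * ξ) ^ s * bracket θ ^ b) * ‖h (θ, ξ)‖ₑ) ^ 2

/-- The square of the `Y`-norm in characteristic coordinates on the frequency side. -/
noncomputable def ySq (s b : ℝ) (h : ℝ × ℝ → ℂ) : ℝ≥0∞ :=
  ∫⁻ ξ, (∫⁻ θ, ENNReal.ofReal (bracket ξ ^ s * bracket θ ^ b) * ‖h (θ, ξ)‖ₑ) ^ 2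

theorem lintegral_weight_eq_zSq (σ s b : ℝ) {G : SpaceTime → ℂ} (hG : Measurable G) :
    ∫⁻ p : SpaceTime,
      (ENNReal.ofReal (bracket (p 0 - σ * p 1) ^ s * bracket (p 0 + σ * p 1) ^ b) * ‖G p‖ₑ) ^ 2 =
      zSq σ s b fun z => G (freqChart σ z) := by
  rw [lintegral_comp_freqChart σ (by fun_prop)]
  unfold zSq
  refine lintegral_congr fun ξ => lintegral_congr fun θ => ?_
  simp only [freqChart_zero, freqChart_one]
  congr 6 <;> ring

/-- Representatives agree almost everywhere, so any one of them computes the infimum. -/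
theorem zNorm_eq (σ s b : ℝ) {u : 𝓢'(SpaceTime, ℂ)} {G : SpaceTime → ℂ}
    (h : IsFourierTransform u G) :
    ZNorm σ s b u = zSq σ s b (fun z => G (freqChart σ z)) ^ (1 / 2 : ℝ) := by
  have key : ∀ G', IsFourierTransform u G' → (∫⁻ p : SpaceTime,
      (ENNReal.ofReal (bracket (p 0 - σ * p 1) ^ s * bracket (p 0 + σ * p 1) ^ b) * ‖G' p‖ₑ) ^ 2) =
      zSq σ s b fun z => G (freqChart σ z) := by
    intro G' hG'
    rw [← lintegral_weight_eq_zSq σ s b h.1]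
    refine lintegral_congr_ae ?_
    filter_upwards [hG'.ae_eq h] with p hp
    rw [hp]
  unfold ZNorm
  refine le_antisymm (iInf₂_le_of_le G h (by rw [key G h])) (le_iInf₂ fun G' hG' => ?_)
  rw [key G' hG']

theorem hNorm_eq (s : ℝ) {f : 𝓢'(ℝ, ℂ)} {G : ℝ → ℂ} (h : IsFourierTransform f G) :
    HNorm s f = (∫⁻ ξ : ℝ, (ENNReal.ofReal (bracket ξ ^ s) * ‖G ξ‖ₑ) ^ 2) ^ (1 / 2 : ℝ) := by
  unfold HNorm
  refine le_antisymm (iInf₂_le_of_le G h le_rfl) (le_iInf₂ fun G' hG' => ?_)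
  refine le_of_eq ?_
  congr 1
  refine lintegral_congr_ae ?_
  filter_upwards [hG'.ae_eq h] with p hp
  rw [hp]

theorem yNorm_eq (σ s b : ℝ) {u : 𝓢'(SpaceTime, ℂ)} {G : SpaceTime → ℂ}
    (h : IsFourierTransform u G) :
    YNorm σ s b u = ySq s b (fun z => G (freqChart σ z)) ^ (1 / 2 : ℝ) := by
  have key : ∀ G', IsFourierTransform u G' → (∫⁻ ξ : ℝ, (∫⁻ τ : ℝ,
      ENNReal.ofReal (bracket ξ ^ s * bracket (τ + σ * ξ) ^ b) * ‖G' !₂[τ, ξ]‖ₑ) ^ 2) =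
      ySq s b fun z => G (freqChart σ z) := by
    intro G' hG'
    have h1 : ∀ᵐ z : ℝ × ℝ, G' (freqChart σ z) = G (freqChart σ z) :=
      (measurePreserving_freqChart σ).quasiMeasurePreserving.ae (hG'.ae_eq h)
    have h2 : ∀ᵐ z : ℝ × ℝ, G' (freqChart σ z.swap) = G (freqChart σ z.swap) :=
      (Measure.measurePreserving_swap (μ := (volume : Measure ℝ))
        (ν := (volume : Measure ℝ))).quasiMeasurePreserving.ae h1
    have h3 := Measure.ae_ae_of_ae_prod h2
    refine lintegral_congr_ae ?_
    filter_upwards [h3] with ξ hξ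
    congr 1
    rw [← lintegral_sub_right_eq_self (μ := volume) (fun τ => ENNReal.ofReal
      (bracket ξ ^ s * bracket (τ + σ * ξ) ^ b) * ‖G' !₂[τ, ξ]‖ₑ) (σ * ξ)]
    refine lintegral_congr_ae ?_
    filter_upwards [hξ] with θ hθ
    simp only [Prod.swap_prod_mk] at hθ
    rw [← hθ, sub_add_cancel]
    rfl
  unfold YNorm
  refine le_antisymm (iInf₂_le_of_le G h (by rw [key G h])) (le_iInf₂ fun G' hG' => ?_)
  rw [key G' hG']

/-- Since s ≥ -1 and b ≥ 0, the Z-weight decays by at most one power of 1 + ‖p‖. This lets a finite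
Z-norm control a polynomially weighted L¹ norm. -/
theorem inv_weight_le {σ s b : ℝ} (hσ : σ = 1 ∨ σ = -1) (hs : -1 ≤ s) (hb : 0 ≤ b)
    (p : SpaceTime) :
    1 ≤ bracket (p 0 - σ * p 1) ^ s * bracket (p 0 + σ * p 1) ^ b * (2 * (1 + ‖p‖)) := by
  have h1 := bracket_pos (p 0 - σ * p 1)
  have h2 : 1 ≤ bracket (p 0 + σ * p 1) ^ b := Real.one_le_rpow (one_le_bracket _) hb
  have h3 : bracket (p 0 - σ * p 1) ≤ 2 * (1 + ‖p‖) := by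
    have e1 := bracket_le_one_add_abs (p 0 - σ * p 1)
    have e2 := abs_sub (p 0) (σ * p 1)
    have e3 : |σ * p 1| = |p 1| := by
      rw [abs_mul]
      rcases hσ with rfl | rfl <;> simp
    have := abs_fst_le_norm p
    have := abs_snd_le_norm p
    linarith
  have h4 : (bracket (p 0 - σ * p 1))⁻¹ ≤ bracket (p 0 - σ * p 1) ^ s := by
    rw [← Real.rpow_neg_one]
    exact Real.rpow_le_rpow_of_exponent_le (one_le_bracket _) hs
  calc (1 : ℝ) = (bracket (p 0 - σ * p 1))⁻¹ * 1 * bracket (p 0 - σ * p 1) := by field_simp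
    _ ≤ _ := by gcongr

/-- A function with finite `Z`-norm is the Fourier transform of a tempered distribution. -/
theorem exists_isFourierTransform_of_zSq {σ s b : ℝ} (hσ : σ = 1 ∨ σ = -1) (hs : -1 ≤ s)
    (hb : 0 ≤ b) {G : SpaceTime → ℂ} (hG : Measurable G)
    (hfin : zSq σ s b (fun z => G (freqChart σ z)) ≠ ⊤) :
    ∃ u : 𝓢'(SpaceTime, ℂ), IsFourierTransform u G := by
  -- 3 = 1 + 2: one power pays for `inv_weight_le`, and (1 + ‖k‖)^{-2} is square integrable on the
  -- plane, ready for Cauchy-Schwarz.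
  refine exists_isFourierTransform hG 3 ?_
  set c : ℝ := 2 * Real.pi with hc
  have hc0 : c ≠ 0 := two_pi_ne_zero
  set w : SpaceTime → ℝ := fun p =>
    bracket (p 0 - σ * p 1) ^ s * bracket (p 0 + σ * p 1) ^ b with hw
  have hw0 : ∀ p, 0 ≤ w p := fun p => by
    have := bracket_pos (p 0 - σ * p 1)
    have := bracket_pos (p 0 + σ * p 1)
    positivity
  have hwm : Measurable w := by fun_prop
  have hpt : ∀ k : SpaceTime, ENNReal.ofReal ((1 + ‖k‖) ^ (-(3 : ℕ) : ℝ)) * ‖G (c • k)‖ₑ ≤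
      ENNReal.ofReal (2 * (1 + c) * (1 + ‖k‖) ^ (-2 : ℝ)) *
        (ENNReal.ofReal (w (c • k)) * ‖G (c • k)‖ₑ) := by
    intro k
    rw [← mul_assoc, ← ENNReal.ofReal_mul (by positivity)]
    gcongr
    have h1 : 1 ≤ w (c • k) * (2 * (1 + ‖c • k‖)) := inv_weight_le hσ hs hb (c • k)
    have h2 : ‖c • k‖ = c * ‖k‖ := by rw [norm_smul, Real.norm_of_nonneg (by positivity)]
    have h3 : 1 + c * ‖k‖ ≤ (1 + c) * (1 + ‖k‖) := by
      have : 0 < c := by positivity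
      nlinarith [norm_nonneg k]
    rw [h2] at h1
    have hk : (0 : ℝ) < 1 + ‖k‖ := by positivity
    have h5 := hw0 (c • k)
    calc (1 + ‖k‖) ^ (-(3 : ℕ) : ℝ) = (1 + ‖k‖) ^ (-(3 : ℕ) : ℝ) * 1 := by rw [mul_one]
      _ ≤ (1 + ‖k‖) ^ (-(3 : ℕ) : ℝ) * (w (c • k) * (2 * ((1 + c) * (1 + ‖k‖)))) := by
          gcongr
          refine h1.trans ?_
          gcongr
      _ = 2 * (1 + c) * ((1 + ‖k‖) ^ (-(3 : ℕ) : ℝ) * (1 + ‖k‖) ^ (1 : ℝ)) * w (c • k) := by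
          rw [Real.rpow_one]; ring
      _ = _ := by
          rw [← Real.rpow_add hk]
          norm_num
  have hsq1 : ∫⁻ k : SpaceTime, ENNReal.ofReal (2 * (1 + c) * (1 + ‖k‖) ^ (-2 : ℝ)) ^ 2 ≠ ⊤ := by
    have hi : Integrable fun k : SpaceTime => (2 * (1 + c)) ^ 2 * (1 + ‖k‖) ^ (-4 : ℝ) :=
      (integrable_one_add_norm (by norm_num)).const_mul _
    have := hi.2
    rw [hasFiniteIntegral_iff_ofReal (.of_forall fun k => by positivity)] at this
    refine ne_of_lt (lt_of_eq_of_lt ?_ this)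
    refine lintegral_congr fun k => ?_
    rw [← ENNReal.ofReal_pow (by positivity), mul_pow, ← Real.rpow_mul_natCast (by positivity)]
    norm_num
  have hsq2 : ∫⁻ k : SpaceTime, (ENNReal.ofReal (w (c • k)) * ‖G (c • k)‖ₑ) ^ 2 ≠ ⊤ := by
    have hm : Measurable fun p => (ENNReal.ofReal (w p) * ‖G p‖ₑ) ^ 2 := by fun_prop
    have h1 := lintegral_map (μ := volume) hm (by fun_prop : Measurable fun k : SpaceTime => c • k)
    rw [← h1, Measure.map_addHaar_smul volume hc0, lintegral_smul_measure,
      lintegral_weight_eq_zSq σ s b hG]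
    exact ENNReal.mul_ne_top ENNReal.ofReal_ne_top hfin
  refine ne_top_of_le_ne_top ?_ (lintegral_mono hpt)
  have hcs := lintegral_mul_sq_le (μ := (volume : Measure SpaceTime))
    (f := fun k => ENNReal.ofReal (2 * (1 + c) * (1 + ‖k‖) ^ (-2 : ℝ)))
    (g := fun k => ENNReal.ofReal (w (c • k)) * ‖G (c • k)‖ₑ)
    (by fun_prop) (Measurable.aemeasurable (by fun_prop))
  intro htop
  rw [htop] at hcs
  refine (ENNReal.mul_ne_top hsq1 hsq2) (top_le_iff.1 (le_trans ?_ hcs))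
  simp

end SmoothFunctions

/-! ### The extension on the frequency side and its Z-norm. -/

/-- The frequencies `|θ| ≤ 1 / T`. -/
def lowSet (T : ℝ) : Set ℝ := {θ | |θ| ≤ T⁻¹}

theorem measurableSet_lowSet (T : ℝ) : MeasurableSet (lowSet T) :=
  measurableSet_le measurable_norm measurable_const

/-- The high frequency Duhamel integrand. -/
noncomputable def highPart (T : ℝ) (h : ℝ × ℝ → ℂ) (z : ℝ × ℝ) : ℂ :=
  (lowSet T)ᶜ.indicator (fun θ => h (θ, z.2) / (Complex.I * θ)) z.1

/-- The kernel of the low frequency part of the Duhamel term, cut off at scale `T`. -/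
noncomputable def lowKernel (K : 𝓢(ℝ, ℂ)) (T ω θ : ℝ) : ℂ :=
  (T * K (T * (ω - θ)) - T * K (T * ω)) / (Complex.I * θ)

/-- The Fourier transform, in the coordinates `θ = τ + σ ξ` and `ξ`, of an extension of the
solution with data `fh` and forcing term `h` (given by their Fourier transforms). -/
noncomputable def duhamel (K : 𝓢(ℝ, ℂ)) (T : ℝ) (fh : ℝ → ℂ) (h : ℝ × ℝ → ℂ) (z : ℝ × ℝ) : ℂ :=
  K z.1 * fh z.2 + highPart T h z +
    K z.1 * (-(2 * Real.pi : ℂ)⁻¹ * ∫ θ, highPart T h (θ, z.2)) +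
    (2 * Real.pi : ℂ)⁻¹ * ∫ θ in lowSet T, h (θ, z.2) * lowKernel K T z.1 θ

theorem measurable_highPart (T : ℝ) {h : ℝ × ℝ → ℂ} (hh : Measurable h) :
    Measurable (highPart T h) := by
  have e : highPart T h = ({z : ℝ × ℝ | z.1 ∈ (lowSet T)ᶜ}).indicator
      fun z => h z / (Complex.I * z.1) := by
    funext z
    by_cases hz : z.1 ∈ (lowSet T)ᶜ
    · rw [highPart, indicator_of_mem hz, indicator_of_mem (by exact hz)]
    · rw [highPart, indicator_of_notMem hz, indicator_of_notMem (by exact hz)]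
  rw [e]
  exact Measurable.indicator (by fun_prop) (measurable_fst (measurableSet_lowSet T).compl)

theorem measurable_duhamel (K : 𝓢(ℝ, ℂ)) (T : ℝ) {fh : ℝ → ℂ} (hf : Measurable fh)
    {h : ℝ × ℝ → ℂ} (hh : Measurable h) : Measurable (duhamel K T fh h) := by
  have hK : Measurable K := K.continuous.measurable
  have h1 : Measurable fun z : ℝ × ℝ => ∫ θ, highPart T h (θ, z.2) := by
    refine (StronglyMeasurable.integral_prod_right' (f := fun y : (ℝ × ℝ) × ℝ =>
      highPart T h (y.2, y.1.2)) ?_).measurable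
    exact ((measurable_highPart T hh).comp (by fun_prop)).stronglyMeasurable
  have h2 : Measurable fun z : ℝ × ℝ =>
      ∫ θ in lowSet T, h (θ, z.2) * lowKernel K T z.1 θ := by
    refine (StronglyMeasurable.integral_prod_right' (f := fun y : (ℝ × ℝ) × ℝ =>
      h (y.2, y.1.2) * lowKernel K T y.1.1 y.2) ?_).measurable
    refine Measurable.stronglyMeasurable ?_
    unfold lowKernel
    fun_prop
  unfold duhamel
  have h3 := measurable_highPart T hh
  fun_prop

theorem add_sq_le_four_mul (x y : ℝ≥0∞) : (x + y) ^ 2 ≤ 4 * (x ^ 2 + y ^ 2) := by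
  have h : x + y ≤ 2 * max x y := by
    rw [two_mul]
    exact add_le_add (le_max_left _ _) (le_max_right _ _)
  calc (x + y) ^ 2 ≤ (2 * max x y) ^ 2 := by gcongr
    _ = 4 * (max x y) ^ 2 := by ring
    _ ≤ 4 * (x ^ 2 + y ^ 2) := by
        gcongr
        rcases max_choice x y with h | h <;> rw [h] <;> simp

/-- Here |θ| > 1/T ≥ 1, so |θ| is comparable to ⟨θ⟩ and (T⟨θ⟩)^{2ε} ≥ 1. The whole gain T^{2ε} at
high frequency comes from this. -/
theorem abs_inv_le_of_notMem_lowSet {T ε : ℝ} (hT : 0 < T) (hT1 : T ≤ 1) (hε : 0 < ε) {θ : ℝ}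
    (hθ : θ ∉ lowSet T) : |θ|⁻¹ ≤ 2 * T ^ (2 * ε) * bracket θ ^ (-1 + 2 * ε) := by
  have h1 : T⁻¹ < |θ| := not_le.1 hθ
  have h2 : 1 ≤ T⁻¹ := (one_le_inv₀ hT).2 hT1
  have hθ0 : 0 < |θ| := by linarith
  have hb := bracket_pos θ
  have h3 : |θ|⁻¹ ≤ 2 * bracket θ ^ (-1 : ℝ) := by
    rw [Real.rpow_neg_one, inv_le_comm₀ hθ0 (by positivity), mul_inv, inv_inv]
    have := bracket_le_one_add_abs θ
    linarith
  have h4 : 1 ≤ T ^ (2 * ε) * bracket θ ^ (2 * ε) := by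
    rw [← Real.mul_rpow hT.le hb.le]
    refine Real.one_le_rpow ?_ (by linarith)
    have : T⁻¹ ≤ bracket θ := h1.le.trans (abs_le_bracket θ)
    calc (1 : ℝ) = T * T⁻¹ := (mul_inv_cancel₀ hT.ne').symm
      _ ≤ _ := by gcongr
  calc |θ|⁻¹ ≤ 2 * bracket θ ^ (-1 : ℝ) * 1 := by rw [mul_one]; exact h3
    _ ≤ 2 * bracket θ ^ (-1 : ℝ) * (T ^ (2 * ε) * bracket θ ^ (2 * ε)) := by gcongr
    _ = 2 * T ^ (2 * ε) * (bracket θ ^ (-1 : ℝ) * bracket θ ^ (2 * ε)) := by ring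
    _ = _ := by rw [bracket_rpow_mul_rpow]

theorem enorm_highPart_le {T ε : ℝ} (hT : 0 < T) (hT1 : T ≤ 1) (hε : 0 < ε) (h : ℝ × ℝ → ℂ)
    (z : ℝ × ℝ) : ‖highPart T h z‖ₑ ≤
      2 * ENNReal.ofReal (T ^ (2 * ε)) *
        (ENNReal.ofReal (bracket z.1 ^ (-1 + 2 * ε)) * ‖h z‖ₑ) := by
  by_cases hz : z.1 ∈ lowSet T
  · rw [highPart, indicator_of_notMem (by simpa using hz)]
    simp
  · rw [highPart, indicator_of_mem (by exact hz)]
    have hb := bracket_pos z.1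
    rw [← ofReal_norm, ← ofReal_norm, ← ENNReal.ofReal_ofNat 2, ← ENNReal.ofReal_mul (by positivity),
      ← ENNReal.ofReal_mul (by positivity), ← ENNReal.ofReal_mul (by positivity)]
    apply ENNReal.ofReal_le_ofReal
    rw [norm_div, norm_mul, Complex.norm_I, one_mul, Complex.norm_real, Real.norm_eq_abs,
      div_eq_mul_inv]
    have := abs_inv_le_of_notMem_lowSet hT hT1 hε hz
    calc ‖h (z.1, z.2)‖ * |z.1|⁻¹ ≤
          ‖h z‖ * (2 * T ^ (2 * ε) * bracket z.1 ^ (-1 + 2 * ε)) := by gcongr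
      _ = _ := by ring

theorem norm_two_pi_inv_le : ‖(2 * Real.pi : ℂ)⁻¹‖ₑ ≤ 1 := by
  rw [← ofReal_norm, ← ENNReal.ofReal_one]
  apply ENNReal.ofReal_le_ofReal
  rw [norm_inv, norm_mul, Complex.norm_real, Real.norm_of_nonneg Real.pi_pos.le]
  refine inv_le_one_of_one_le₀ ?_
  have := Real.pi_gt_three
  norm_num
  linarith

/-- The weighted estimate of the extension for a fixed spatial frequency. -/
theorem exists_duhamel_fiber_le {s b ε : ℝ} (hs : -1 / 2 < s) (hs' : s < 0) (hb : 1 / 2 < b)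
    (hb' : b < 1) (hε : 0 < ε) (hε' : ε < 1 / 6) (K : 𝓢(ℝ, ℂ)) :
    ∃ C : ℝ≥0, ∀ σ : ℝ, σ = 1 ∨ σ = -1 → ∀ T : ℝ, 0 < T → T ≤ 1 →
      ∀ (fh : ℝ → ℂ) (h : ℝ × ℝ → ℂ), Measurable h → ∀ ξ : ℝ,
      ∫⁻ ω, (ENNReal.ofReal (bracket (ω - 2 * σ * ξ) ^ s * bracket ω ^ b) *
          ‖duhamel K T fh h (ω, ξ)‖ₑ) ^ 2 ≤
        C * ((ENNReal.ofReal (bracket ξ ^ s) * ‖fh ξ‖ₑ) ^ 2 +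
          ENNReal.ofReal (T ^ (2 * ε)) ^ 2 *
          ((∫⁻ θ, ENNReal.ofReal (bracket ξ ^ s * bracket θ ^ (-1 + 2 * ε)) * ‖h (θ, ξ)‖ₑ) ^ 2 +
          ∫⁻ θ, (ENNReal.ofReal (bracket (θ - 2 * σ * ξ) ^ s * bracket θ ^ (b - 1 + 2 * ε)) *
            ‖h (θ, ξ)‖ₑ) ^ 2)) := by
  obtain ⟨C₀, h₀⟩ := exists_weighted_profile_le s b hs'.le K
  obtain ⟨C₃, h₃⟩ := exists_low_part_le hs hs' hb hb' hε hε'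
  obtain ⟨A, hA0, hA⟩ := exists_difference_quotient_le K
  -- The 16 is (x + y)² ≤ 4(x² + y²) used twice. The parenthesis dominates the constants of the four
  -- pieces: C₀ for the data, 4 for the high part, 4C₀ for its correction, A²C₃ for the low part.
  refine ⟨16 * (4 * C₀ + 4 + A.toNNReal ^ 2 * C₃), fun σ hσ T hT hT1 fh h hh ξ => ?_⟩
  set t := ENNReal.ofReal (T ^ (2 * ε)) with ht
  set W : ℝ → ℝ≥0∞ := fun ω => ENNReal.ofReal (bracket (ω - 2 * σ * ξ) ^ s * bracket ω ^ b) with hW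
  set X := ENNReal.ofReal (bracket ξ ^ s) with hX
  set Y := ∫⁻ θ, ENNReal.ofReal (bracket ξ ^ s * bracket θ ^ (-1 + 2 * ε)) * ‖h (θ, ξ)‖ₑ with hY
  set Z := ∫⁻ θ, (ENNReal.ofReal (bracket (θ - 2 * σ * ξ) ^ s * bracket θ ^ (b - 1 + 2 * ε)) *
    ‖h (θ, ξ)‖ₑ) ^ 2 with hZ
  set c := ∫⁻ θ, ‖highPart T h (θ, ξ)‖ₑ with hc
  set ℓ := ∫⁻ θ in lowSet T, ‖h (θ, ξ)‖ₑ with hℓ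
  have hWm : Measurable W := by fun_prop
  have hKm : Measurable K := K.continuous.measurable
  have hhm : Measurable fun θ => h (θ, ξ) := hh.comp (by fun_prop)
  have hpm : Measurable fun θ => highPart T h (θ, ξ) := (measurable_highPart T hh).comp (by fun_prop)
  have hmul : ∀ r u v : ℝ, ENNReal.ofReal (bracket u ^ s * bracket v ^ r) =
      ENNReal.ofReal (bracket u ^ s) * ENNReal.ofReal (bracket v ^ r) := fun r u v => by
    have := bracket_pos u
    exact ENNReal.ofReal_mul (by positivity)
  have hpt : ∀ ω, ‖duhamel K T fh h (ω, ξ)‖ₑ ≤ ‖K ω‖ₑ * ‖fh ξ‖ₑ + ‖highPart T h (ω, ξ)‖ₑ +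
      (‖K ω‖ₑ * c + ENNReal.ofReal (A * (T ^ 2 * bracket (T * ω) ^ (-2 : ℝ))) * ℓ) := by
    intro ω
    unfold duhamel
    rw [add_assoc]
    refine (enorm_add_le _ _).trans (add_le_add ((enorm_add_le _ _).trans ?_)
      ((enorm_add_le _ _).trans (add_le_add ?_ ?_)))
    · rw [enorm_mul]
    · rw [enorm_mul, enorm_mul, enorm_neg]
      gcongr
      calc _ ≤ 1 * c := by
            gcongr
            · exact norm_two_pi_inv_le
            · exact enorm_integral_le_lintegral_enorm _
        _ = c := one_mul c
    · rw [enorm_mul]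
      calc _ ≤ 1 * ∫⁻ θ in lowSet T, ‖h (θ, ξ) * lowKernel K T ω θ‖ₑ := by
            gcongr
            · exact norm_two_pi_inv_le
            · exact enorm_integral_le_lintegral_enorm _
        _ ≤ ∫⁻ θ in lowSet T, ENNReal.ofReal (A * (T ^ 2 * bracket (T * ω) ^ (-2 : ℝ))) *
              ‖h (θ, ξ)‖ₑ := by
            rw [one_mul]
            refine setLIntegral_mono' (measurableSet_lowSet T) fun θ hθ => ?_
            rw [enorm_mul, mul_comm]
            gcongr
            rw [← ofReal_norm]
            exact ENNReal.ofReal_le_ofReal (hA T hT θ ω hθ)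
        _ = _ := lintegral_const_mul _ hhm.enorm
  -- The correction has amplitude c independent of ω, and the profile K turns the Z-weight into
  -- ⟨ξ⟩^s. An L¹ bound in θ is then what is needed, which is the role of the Y-norm.
  have hcle : X * c ≤ 2 * t * Y := by
    calc X * c ≤ X * ∫⁻ θ, 2 * t * (ENNReal.ofReal (bracket θ ^ (-1 + 2 * ε)) * ‖h (θ, ξ)‖ₑ) := by
          gcongr
          exact lintegral_mono fun θ => enorm_highPart_le hT hT1 hε h (θ, ξ)
      _ = 2 * t * (X * ∫⁻ θ, ENNReal.ofReal (bracket θ ^ (-1 + 2 * ε)) * ‖h (θ, ξ)‖ₑ) := by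
          rw [lintegral_const_mul _ (by fun_prop)]
          ring
      _ = 2 * t * Y := by
          rw [hY]
          simp_rw [hmul, mul_assoc]
          rw [lintegral_const_mul _ (by fun_prop)]
  have i0 : ∫⁻ ω, (W ω * (‖K ω‖ₑ * ‖fh ξ‖ₑ)) ^ 2 ≤ C₀ * (X * ‖fh ξ‖ₑ) ^ 2 := by
    simp_rw [← mul_assoc, mul_pow _ ‖fh ξ‖ₑ]
    rw [lintegral_mul_const _ (by fun_prop), ← mul_assoc]
    gcongr
    exact h₀ σ hσ ξ
  have i2 : ∫⁻ ω, (W ω * (‖K ω‖ₑ * c)) ^ 2 ≤ 4 * C₀ * (t ^ 2 * Y ^ 2) := by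
    simp_rw [← mul_assoc, mul_pow _ c]
    rw [lintegral_mul_const _ (by fun_prop)]
    calc _ ≤ C₀ * X ^ 2 * c ^ 2 := by
          gcongr
          exact h₀ σ hσ ξ
      _ = C₀ * (X * c) ^ 2 := by ring
      _ ≤ C₀ * (2 * t * Y) ^ 2 := by gcongr
      _ = _ := by ring
  have i1 : ∫⁻ ω, (W ω * ‖highPart T h (ω, ξ)‖ₑ) ^ 2 ≤ 4 * (t ^ 2 * Z) := by
    calc _ ≤ ∫⁻ ω, (2 * t) ^ 2 * (ENNReal.ofReal (bracket (ω - 2 * σ * ξ) ^ s *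
          bracket ω ^ (b - 1 + 2 * ε)) * ‖h (ω, ξ)‖ₑ) ^ 2 := by
          refine lintegral_mono fun ω => ?_
          rw [← mul_pow]
          refine pow_le_pow_left' ?_ 2
          calc W ω * ‖highPart T h (ω, ξ)‖ₑ ≤ W ω * (2 * t *
                (ENNReal.ofReal (bracket ω ^ (-1 + 2 * ε)) * ‖h (ω, ξ)‖ₑ)) := by
                gcongr
                exact enorm_highPart_le hT hT1 hε h (ω, ξ)
            _ = 2 * t * (ENNReal.ofReal (bracket (ω - 2 * σ * ξ) ^ s) *
                (ENNReal.ofReal (bracket ω ^ b) * ENNReal.ofReal (bracket ω ^ (-1 + 2 * ε))) *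
                ‖h (ω, ξ)‖ₑ) := by
                simp only [hW, hmul]
                ring
            _ = _ := by
                have hb := bracket_pos ω
                rw [← ENNReal.ofReal_mul (by positivity), bracket_rpow_mul_rpow, ← hmul,
                  show b + (-1 + 2 * ε) = b - 1 + 2 * ε by ring]
      _ = 4 * (t ^ 2 * Z) := by
          rw [lintegral_const_mul _ (by fun_prop), hZ]
          ring
  have i3 : ∫⁻ ω, (W ω * (ENNReal.ofReal (A * (T ^ 2 * bracket (T * ω) ^ (-2 : ℝ))) * ℓ)) ^ 2 ≤
      A.toNNReal ^ 2 * C₃ * (t ^ 2 * Z) := by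
    have h4 := h₃ T hT hT1 (2 * σ * ξ) (fun θ => ‖h (θ, ξ)‖ₑ) hhm.enorm
    have e : ∀ ω, (W ω * (ENNReal.ofReal (A * (T ^ 2 * bracket (T * ω) ^ (-2 : ℝ))) * ℓ)) ^ 2 =
        (A.toNNReal : ℝ≥0∞) ^ 2 * (ENNReal.ofReal (bracket (ω - 2 * σ * ξ) ^ s * bracket ω ^ b *
          (T ^ 2 * bracket (T * ω) ^ (-2 : ℝ))) * ℓ) ^ 2 := fun ω => by
      have h5 := bracket_pos (ω - 2 * σ * ξ)
      have h6 := bracket_pos ω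
      rw [ENNReal.ofReal_mul (p := bracket (ω - 2 * σ * ξ) ^ s * bracket ω ^ b) (by positivity),
        ENNReal.ofReal_mul hA0, ← mul_pow]
      change _ = (ENNReal.ofReal A * _) ^ 2
      congr 1
      simp only [hW]
      ring
    simp_rw [e]
    rw [lintegral_const_mul _ (by fun_prop), mul_assoc (_ ^ 2) (C₃ : ℝ≥0∞) (t ^ 2 * Z)]
    refine mul_le_mul' le_rfl ?_
    rw [← mul_assoc]
    exact h4
  have hsum : ∫⁻ ω, (W ω * ‖duhamel K T fh h (ω, ξ)‖ₑ) ^ 2 ≤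
      16 * ((∫⁻ ω, (W ω * (‖K ω‖ₑ * ‖fh ξ‖ₑ)) ^ 2) +
        (∫⁻ ω, (W ω * ‖highPart T h (ω, ξ)‖ₑ) ^ 2) +
        ((∫⁻ ω, (W ω * (‖K ω‖ₑ * c)) ^ 2) +
        ∫⁻ ω, (W ω * (ENNReal.ofReal (A * (T ^ 2 * bracket (T * ω) ^ (-2 : ℝ))) * ℓ)) ^ 2)) := by
    rw [← lintegral_add_left (by fun_prop), ← lintegral_add_left (by fun_prop),
      ← lintegral_add_left (by fun_prop), ← lintegral_const_mul _ (by fun_prop)]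
    refine lintegral_mono fun ω => ?_
    refine (pow_le_pow_left' (mul_le_mul_right (hpt ω) (W ω)) 2).trans ?_
    rw [mul_add, mul_add, mul_add]
    refine (add_sq_le_four_mul _ _).trans ?_
    refine (mul_le_mul' le_rfl
      (add_le_add (add_sq_le_four_mul _ _) (add_sq_le_four_mul _ _))).trans (le_of_eq ?_)
    ring
  refine hsum.trans ?_
  calc _ ≤ 16 * ((C₀ * (X * ‖fh ξ‖ₑ) ^ 2 + 4 * (t ^ 2 * Z)) + (4 * C₀ * (t ^ 2 * Y ^ 2) +
        A.toNNReal ^ 2 * C₃ * (t ^ 2 * Z))) := by gcongr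
    -- The added terms are exactly the slack up to the common constant, so that the last step is an
    -- identity in ℝ≥0∞.
    _ ≤ 16 * ((C₀ * (X * ‖fh ξ‖ₑ) ^ 2 + 4 * (t ^ 2 * Z)) + (4 * C₀ * (t ^ 2 * Y ^ 2) +
        A.toNNReal ^ 2 * C₃ * (t ^ 2 * Z))) + 16 * ((3 * C₀ + 4 + A.toNNReal ^ 2 * C₃) *
        (X * ‖fh ξ‖ₑ) ^ 2 + (4 + A.toNNReal ^ 2 * C₃) * (t ^ 2 * Y ^ 2) +
        4 * C₀ * (t ^ 2 * Z)) := le_self_add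
    _ = _ := by
        push_cast
        ring

/-- The norm of the extension. -/
theorem exists_duhamel_zSq_le {s b ε : ℝ} (hs : -1 / 2 < s) (hs' : s < 0) (hb : 1 / 2 < b)
    (hb' : b < 1) (hε : 0 < ε) (hε' : ε < 1 / 6) (K : 𝓢(ℝ, ℂ)) :
    ∃ C : ℝ≥0, ∀ σ : ℝ, σ = 1 ∨ σ = -1 → ∀ T : ℝ, 0 < T → T ≤ 1 →
      ∀ (fh : ℝ → ℂ) (h : ℝ × ℝ → ℂ), Measurable fh → Measurable h →
      zSq σ s b (duhamel K T fh h) ≤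
        C * ((∫⁻ ξ, (ENNReal.ofReal (bracket ξ ^ s) * ‖fh ξ‖ₑ) ^ 2) +
          ENNReal.ofReal (T ^ (2 * ε)) ^ 2 *
          (ySq s (-1 + 2 * ε) h + zSq σ s (b - 1 + 2 * ε) h)) := by
  obtain ⟨C, hC⟩ := exists_duhamel_fiber_le hs hs' hb hb' hε hε' K
  refine ⟨C, fun σ hσ T hT hT1 fh h hf hh => ?_⟩
  refine (lintegral_mono fun ξ => hC σ hσ T hT hT1 fh h hh ξ).trans (le_of_eq ?_)
  have hy : Measurable fun ξ => (∫⁻ θ, ENNReal.ofReal (bracket ξ ^ s * bracket θ ^ (-1 + 2 * ε)) *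
      ‖h (θ, ξ)‖ₑ) ^ 2 := by
    refine Measurable.pow_const (Measurable.lintegral_prod_right' (f := fun y : ℝ × ℝ =>
      ENNReal.ofReal (bracket y.1 ^ s * bracket y.2 ^ (-1 + 2 * ε)) * ‖h (y.2, y.1)‖ₑ) ?_) 2
    fun_prop
  have hz : Measurable fun ξ => ∫⁻ θ, (ENNReal.ofReal (bracket (θ - 2 * σ * ξ) ^ s *
      bracket θ ^ (b - 1 + 2 * ε)) * ‖h (θ, ξ)‖ₑ) ^ 2 := by
    refine Measurable.lintegral_prod_right' (f := fun y : ℝ × ℝ =>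
      (ENNReal.ofReal (bracket (y.2 - 2 * σ * y.1) ^ s * bracket y.2 ^ (b - 1 + 2 * ε)) *
        ‖h (y.2, y.1)‖ₑ) ^ 2) ?_
    fun_prop
  have hx : Measurable fun ξ => (ENNReal.ofReal (bracket ξ ^ s) * ‖fh ξ‖ₑ) ^ 2 := by fun_prop
  rw [lintegral_const_mul _ (by exact hx.add ((hy.add hz).const_mul _)), lintegral_add_left hx,
    lintegral_const_mul _ (by exact hy.add hz), lintegral_add_left hy]
  rfl

/-! ### Pairing with test functions through their symbols. -/

/-- The inverse Fourier transform of a test function, without the normalizing constant and in the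
coordinates `θ = τ + σ ξ` and `ξ`. -/
noncomputable def symbol (σ : ℝ) (Φ : 𝓢(SpaceTime, ℂ)) (z : ℝ × ℝ) : ℂ :=
  (𝓕⁻ Φ) ((2 * Real.pi)⁻¹ • freqChart σ z)

theorem continuous_symbol (σ : ℝ) (Φ : 𝓢(SpaceTime, ℂ)) : Continuous (symbol σ Φ) :=
  (𝓕⁻ Φ).continuous.comp ((continuous_freqChart σ).const_smul (2 * Real.pi)⁻¹)

theorem symbol_eq_integral (σ : ℝ) (Φ : 𝓢(SpaceTime, ℂ)) (z : ℝ × ℝ) :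
    symbol σ Φ z =
      ∫ p : SpaceTime, Complex.exp (↑(p 0 * (z.1 - σ * z.2) + p 1 * z.2) * Complex.I) * Φ p := by
  rw [symbol, fourierInv_schwartz_apply]
  refine integral_congr_ae (.of_forall fun p => ?_)
  simp only [inner_smul_right, inner_spaceTime, freqChart_zero, freqChart_one]
  rw [mul_inv_cancel_left₀ two_pi_ne_zero]

/-- θ is a linear functional of the frequency, so rapid decay of 𝓕⁻Φ gives decay in θ uniformly in
ξ; the power -2 suffices for integrability in θ. -/
theorem exists_symbol_le (σ : ℝ) (Φ : 𝓢(SpaceTime, ℂ)) :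
    ∃ M : ℝ, 0 ≤ M ∧ ∀ z, ‖symbol σ Φ z‖ ≤ M * bracket z.1 ^ (-2 : ℝ) := by
  set c : ℝ := 2 * Real.pi with hc
  have hc0 : 0 < c := by positivity
  refine ⟨2 ^ 2 * (Finset.Iic (2, 0)).sup (fun m => SchwartzMap.seminorm ℂ m.1 m.2) (𝓕⁻ Φ) *
    (c * (1 + |σ|) + 1) ^ 2, by positivity, fun z => ?_⟩
  set q := c⁻¹ • freqChart σ z with hq
  have h := SchwartzMap.one_add_le_sup_seminorm_apply (𝕜 := ℂ) (m := (2, 0)) (k := 2) (n := 0)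
    le_rfl le_rfl (𝓕⁻ Φ) q
  rw [norm_iteratedFDeriv_zero] at h
  have h0 : c * q 0 = z.1 - σ * z.2 := by
    simp [hq, hc0.ne']
  have h1 : c * q 1 = z.2 := by
    simp [hq, hc0.ne']
  have hz : |z.1| ≤ c * (1 + |σ|) * ‖q‖ := by
    have e : z.1 = c * q 0 + σ * (c * q 1) := by rw [h0, h1]; ring
    have a0 := abs_fst_le_norm q
    have a1 := abs_snd_le_norm q
    calc |z.1| ≤ |c * q 0| + |σ * (c * q 1)| := by rw [e]; exact abs_add_le _ _
      _ = c * |q 0| + |σ| * (c * |q 1|) := by rw [abs_mul c, abs_mul σ, abs_mul c, abs_of_pos hc0]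
      _ ≤ c * ‖q‖ + |σ| * (c * ‖q‖) := by gcongr
      _ = _ := by ring
  have hb : bracket z.1 ≤ (c * (1 + |σ|) + 1) * (1 + ‖q‖) := by
    have := bracket_le_one_add_abs z.1
    have : 0 ≤ c * (1 + |σ|) := by positivity
    nlinarith [norm_nonneg q]
  have hbp := bracket_pos z.1
  rw [Real.rpow_neg hbp.le, ← div_eq_mul_inv, le_div_iff₀ (by positivity), Real.rpow_ofNat]
  change ‖(𝓕⁻ Φ) q‖ * _ ≤ _
  calc ‖(𝓕⁻ Φ) q‖ * bracket z.1 ^ 2 ≤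
        ‖(𝓕⁻ Φ) q‖ * ((c * (1 + |σ|) + 1) * (1 + ‖q‖)) ^ 2 := by gcongr
    _ = ((1 + ‖q‖) ^ 2 * ‖(𝓕⁻ Φ) q‖) * (c * (1 + |σ|) + 1) ^ 2 := by ring
    _ ≤ _ := by gcongr

theorem IsFourierTransform.integrable_mul_symbol {u : 𝓢'(SpaceTime, ℂ)} {G : SpaceTime → ℂ}
    (h : IsFourierTransform u G) (σ : ℝ) (Φ : 𝓢(SpaceTime, ℂ)) :
    Integrable fun z => G (freqChart σ z) * symbol σ Φ z := by
  have h1 := (h.2 (𝓕⁻ Φ)).1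
  have h2 : Integrable fun p : SpaceTime => G p * (𝓕⁻ Φ) ((2 * Real.pi)⁻¹ • p) := by
    rw [← integrable_comp_smul_iff volume _ two_pi_ne_zero]
    refine h1.congr (.of_forall fun k => ?_)
    simp only [inv_smul_smul₀ two_pi_ne_zero]
  exact ((measurePreserving_freqChart σ).integrable_comp_emb (measurableEmbedding_freqChart σ)).2 h2

/-- The pairing with a test function, in characteristic coordinates. -/
theorem IsFourierTransform.apply_eq_symbol {u : 𝓢'(SpaceTime, ℂ)} {G : SpaceTime → ℂ}
    (h : IsFourierTransform u G) (σ : ℝ) (Φ : 𝓢(SpaceTime, ℂ)) :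
    u Φ = ((2 * Real.pi : ℂ) ^ 2)⁻¹ *
      ∫ ξ : ℝ, ∫ θ : ℝ, G (freqChart σ (θ, ξ)) * symbol σ Φ (θ, ξ) := by
  have e1 := Measure.integral_comp_smul (volume : Measure SpaceTime)
    (fun p => G p * (𝓕⁻ Φ) ((2 * Real.pi)⁻¹ • p)) (2 * Real.pi)
  simp only [inv_smul_smul₀ two_pi_ne_zero] at e1
  rw [h.apply_eq, e1, ← (measurePreserving_freqChart σ).integral_comp
    (measurableEmbedding_freqChart σ)]
  have e2 := integral_prod_symm _ (h.integrable_mul_symbol σ Φ)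
  rw [← show (volume : Measure (ℝ × ℝ)) = volume.prod volume from rfl] at e2
  rw [← e2, finrank_euclideanSpace_fin, abs_of_pos (by positivity), Complex.real_smul]
  push_cast
  rfl

theorem IsFourierTransform.integrable_mul_fourierInv {f : 𝓢'(ℝ, ℂ)} {G : ℝ → ℂ}
    (h : IsFourierTransform f G) (χ : 𝓢(ℝ, ℂ)) :
    Integrable fun ξ => G ξ * (𝓕⁻ χ) ((2 * Real.pi)⁻¹ * ξ) := by
  rw [← integrable_comp_smul_iff volume _ two_pi_ne_zero]
  refine (h.2 (𝓕⁻ χ)).1.congr (.of_forall fun k => ?_)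
  simp only [smul_eq_mul, inv_mul_cancel_left₀ two_pi_ne_zero]

theorem IsFourierTransform.apply_eq_integral {f : 𝓢'(ℝ, ℂ)} {G : ℝ → ℂ}
    (h : IsFourierTransform f G) (χ : 𝓢(ℝ, ℂ)) :
    f χ = (2 * Real.pi : ℂ)⁻¹ * ∫ ξ : ℝ, G ξ * (𝓕⁻ χ) ((2 * Real.pi)⁻¹ * ξ) := by
  have e1 := Measure.integral_comp_smul (volume : Measure ℝ)
    (fun ξ => G ξ * (𝓕⁻ χ) ((2 * Real.pi)⁻¹ * ξ)) (2 * Real.pi)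
  simp only [smul_eq_mul, inv_mul_cancel_left₀ two_pi_ne_zero] at e1
  rw [h.apply_eq]
  simp only [smul_eq_mul]
  rw [e1, Module.finrank_self, abs_of_pos (by positivity), Complex.real_smul]
  push_cast
  rw [pow_one]

/-- A Schwartz function whose inverse Fourier transform is constant near the origin. -/
theorem exists_reproducing_kernel : ∃ K : 𝓢(ℝ, ℂ), ∀ t : ℝ, |t| ≤ 1 →
    ∫ v : ℝ, Complex.exp (↑(t * v) * Complex.I) * K v = 2 * Real.pi := by
  obtain ⟨ρ, hρ, -⟩ := exists_cutoff
  have hc : (2 * Real.pi)⁻¹ ≠ 0 := inv_ne_zero two_pi_ne_zero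
  refine ⟨SchwartzMap.compCLMOfContinuousLinearEquiv ℂ
    (ContinuousLinearEquiv.unitsEquivAut ℝ (Units.mk0 (2 * Real.pi)⁻¹ hc)) (𝓕 ρ), fun t ht => ?_⟩
  have h1 : (𝓕⁻ (𝓕 ρ)) t = 1 := by
    rw [FourierTransform.fourierInv_fourier_eq, hρ t ht]
  rw [fourierInv_schwartz_apply] at h1
  have e := Measure.integral_comp_mul_left (fun k : ℝ =>
    Complex.exp (↑(2 * Real.pi * inner ℝ k t) * Complex.I) * (𝓕 ρ) k) (2 * Real.pi)⁻¹
  rw [h1, inv_inv, abs_of_pos (by positivity), Complex.real_smul, mul_one] at e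
  push_cast at e
  rw [← e]
  refine integral_congr_ae (.of_forall fun v => ?_)
  simp only [SchwartzMap.compCLMOfContinuousLinearEquiv_apply, Function.comp,
    ContinuousLinearEquiv.unitsEquivAut_apply, Units.val_mk0, RCLike.inner_apply, conj_trivial]
  rw [mul_comm v]
  congr 3
  push_cast
  have : (Real.pi : ℂ) ≠ 0 := by exact_mod_cast Real.pi_ne_zero
  field_simp

theorem integrable_scaled_kernel (K : 𝓢(ℝ, ℂ)) {S : ℝ} (hS : 0 < S) (θ : ℝ) :
    Integrable fun ω : ℝ => (S : ℂ) * K (S * (ω - θ)) := by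
  refine Integrable.const_mul ?_ _
  have h1 : Integrable fun ω : ℝ => K (S * ω) :=
    (integrable_comp_mul_left_iff K hS.ne').2 K.integrable
  exact h1.comp_sub_right θ

/-- A test function supported in the strip is reproduced by the kernel at every scale which is at
least the width of the strip. -/
theorem integral_symbol_mul_kernel {K : 𝓢(ℝ, ℂ)}
    (hK : ∀ t : ℝ, |t| ≤ 1 → ∫ v : ℝ, Complex.exp (↑(t * v) * Complex.I) * K v = 2 * Real.pi)
    {σ T S : ℝ} (hS : 0 < S) (hTS : T ≤ S) {Φ : 𝓢(SpaceTime, ℂ)} (hΦ : tsupport Φ ⊆ strip T)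
    (θ ξ : ℝ) :
    ∫ ω, symbol σ Φ (ω, ξ) * (S * K (S * (ω - θ))) = 2 * Real.pi * symbol σ Φ (θ, ξ) := by
  have hfi : Integrable (fun y : ℝ × SpaceTime =>
      Complex.exp (↑(y.2 0 * (y.1 - σ * ξ) + y.2 1 * ξ) * Complex.I) *
        (S * K (S * (y.1 - θ)) * Φ y.2)) (volume.prod volume) := by
    refine ((integrable_scaled_kernel K hS θ).mul_prod Φ.integrable).bdd_mul (c := 1) ?_ (.of_forall fun y => ?_)
    · exact Continuous.aestronglyMeasurable (by fun_prop)
    · rw [Complex.norm_exp_ofReal_mul_I]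
  have e1 : ∀ ω : ℝ, symbol σ Φ (ω, ξ) * (S * K (S * (ω - θ))) =
      ∫ p : SpaceTime, Complex.exp (↑(p 0 * (ω - σ * ξ) + p 1 * ξ) * Complex.I) *
        (S * K (S * (ω - θ)) * Φ p) := by
    intro ω
    rw [symbol_eq_integral, ← integral_mul_const]
    refine integral_congr_ae (.of_forall fun p => ?_)
    simp only
    ring
  simp_rw [e1]
  rw [integral_integral_swap hfi, symbol_eq_integral, ← integral_const_mul]
  refine integral_congr_ae (.of_forall fun p => ?_)
  simp only
  by_cases hp : p ∈ strip T
  · have hpS : |S⁻¹ * p 0| ≤ 1 := by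
      have : |p 0| ≤ T := abs_le.2 ⟨hp.1.le, hp.2.le⟩
      rw [abs_mul, abs_of_pos (by positivity), ← div_eq_inv_mul, div_le_one hS]
      linarith
    have h2 := hK _ hpS
    have h3 := Measure.integral_comp_mul_left (fun v : ℝ =>
      Complex.exp (↑(S⁻¹ * p 0 * v) * Complex.I) * K v) S
    rw [h2, abs_of_pos (by positivity), ← integral_sub_right_eq_self _ θ] at h3
    have e2 : ∀ ω : ℝ, Complex.exp (↑(p 0 * (ω - σ * ξ) + p 1 * ξ) * Complex.I) *
        (S * K (S * (ω - θ)) * Φ p) =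
        Complex.exp (↑(p 0 * (θ - σ * ξ) + p 1 * ξ) * Complex.I) * Φ p * S *
          (Complex.exp (↑(S⁻¹ * p 0 * (S * (ω - θ))) * Complex.I) * K (S * (ω - θ))) := by
      intro ω
      have e3 : Complex.exp (↑(p 0 * (ω - σ * ξ) + p 1 * ξ) * Complex.I) =
          Complex.exp (↑(p 0 * (θ - σ * ξ) + p 1 * ξ) * Complex.I) *
          Complex.exp (↑(S⁻¹ * p 0 * (S * (ω - θ))) * Complex.I) := by
        rw [← Complex.exp_add, ← add_mul, ← Complex.ofReal_add]
        congr 3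
        field_simp
        ring
      rw [e3]
      ring
    simp_rw [e2]
    rw [integral_const_mul, h3, Complex.real_smul]
    have : (S : ℂ) ≠ 0 := by exact_mod_cast hS.ne'
    push_cast
    field_simp
  · have : Φ p = 0 := by
      by_contra h
      exact hp (hΦ (subset_tsupport _ h))
    simp [this]

/-! ### The pairing at a fixed spatial frequency. -/

section Fiber

variable {T ε : ℝ} {h : ℝ × ℝ → ℂ} {ξ : ℝ}

theorem integrable_highPart (hT : 0 < T) (hT1 : T ≤ 1) (hε : 0 < ε) (hh : Measurable h)
    (hfin : ∫⁻ θ, ENNReal.ofReal (bracket θ ^ (-1 + 2 * ε)) * ‖h (θ, ξ)‖ₑ ≠ ⊤) :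
    Integrable fun θ => highPart T h (θ, ξ) := by
  refine ⟨((measurable_highPart T hh).comp (by fun_prop)).aestronglyMeasurable, ?_⟩
  refine lt_of_le_of_lt (lintegral_mono fun θ => enorm_highPart_le hT hT1 hε h (θ, ξ)) ?_
  rw [lintegral_const_mul _ (by fun_prop)]
  exact ENNReal.mul_lt_top (ENNReal.mul_lt_top (by simp) ENNReal.ofReal_lt_top) hfin.lt_top

theorem integrableOn_lowSet (hT : 0 < T) (hε' : ε < 1 / 6) (hh : Measurable h)
    (hfin : ∫⁻ θ, ENNReal.ofReal (bracket θ ^ (-1 + 2 * ε)) * ‖h (θ, ξ)‖ₑ ≠ ⊤) :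
    IntegrableOn (fun θ => h (θ, ξ)) (lowSet T) := by
  have hhm : Measurable fun θ => h (θ, ξ) := hh.comp (by fun_prop)
  refine ⟨hhm.aestronglyMeasurable, ?_⟩
  set a : ℝ := (1 + T⁻¹) ^ (-1 + 2 * ε) with ha
  have ha0 : 0 < a := by positivity
  have hle : ENNReal.ofReal a * ∫⁻ θ in lowSet T, ‖h (θ, ξ)‖ₑ ≤
      ∫⁻ θ, ENNReal.ofReal (bracket θ ^ (-1 + 2 * ε)) * ‖h (θ, ξ)‖ₑ := by
    rw [← lintegral_const_mul _ hhm.enorm]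
    refine (setLIntegral_mono' (measurableSet_lowSet T) fun θ hθ => ?_).trans
      (setLIntegral_le_lintegral _ _)
    gcongr
    refine Real.rpow_le_rpow_of_nonpos (bracket_pos θ) ?_ (by linarith)
    have h1 := bracket_le_one_add_abs θ
    have h2 : |θ| ≤ T⁻¹ := hθ
    linarith
  refine lt_top_iff_ne_top.2 fun htop => ?_
  have htop' : ∫⁻ θ in lowSet T, ‖h (θ, ξ)‖ₑ = ⊤ := htop
  rw [htop', ENNReal.mul_top (by simpa using ha0)] at hle
  exact hfin (top_le_iff.1 hle)

/-- The pairing of the extension with a test function supported in the strip, for a fixed spatial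
frequency. -/
theorem integral_duhamel_mul_symbol {K : 𝓢(ℝ, ℂ)}
    (hK : ∀ t : ℝ, |t| ≤ 1 → ∫ v : ℝ, Complex.exp (↑(t * v) * Complex.I) * K v = 2 * Real.pi)
    (hT : 0 < T) (hT1 : T ≤ 1) (hε : 0 < ε) (hε' : ε < 1 / 6) (hh : Measurable h)
    (hfin : ∫⁻ θ, ENNReal.ofReal (bracket θ ^ (-1 + 2 * ε)) * ‖h (θ, ξ)‖ₑ ≠ ⊤)
    (fh : ℝ → ℂ) (σ : ℝ) {Φ : 𝓢(SpaceTime, ℂ)} (hΦ : tsupport Φ ⊆ strip T) :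
    ∫ ω, duhamel K T fh h (ω, ξ) * symbol σ Φ (ω, ξ) =
      2 * Real.pi * fh ξ * symbol σ Φ (0, ξ) +
        ∫ θ : ℝ, h (θ, ξ) * ((symbol σ Φ (θ, ξ) - symbol σ Φ (0, ξ)) / (Complex.I * θ)) := by
  obtain ⟨M, hM0, hM⟩ := exists_symbol_le σ Φ
  obtain ⟨A, hA0, hA⟩ := exists_difference_quotient_le K
  set B : ℝ → ℂ := fun ω => symbol σ Φ (ω, ξ) with hB
  change ∫ ω, duhamel K T fh h (ω, ξ) * B ω = 2 * Real.pi * fh ξ * B 0 +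
    ∫ θ : ℝ, h (θ, ξ) * ((B θ - B 0) / (Complex.I * θ))
  have hπ : (2 * Real.pi : ℂ) ≠ 0 := by exact_mod_cast two_pi_ne_zero
  have hBc : Continuous B := (continuous_symbol σ Φ).comp (by fun_prop)
  have hBm : ∀ ω, ‖B ω‖ ≤ M := fun ω => (hM (ω, ξ)).trans <| by
    have : bracket ω ^ (-2 : ℝ) ≤ 1 :=
      Real.rpow_le_one_of_one_le_of_nonpos (one_le_bracket ω) (by norm_num)
    simpa using mul_le_mul_of_nonneg_left this hM0
  have hBi : Integrable B :=
    ((integrable_bracket_rpow (by norm_num)).const_mul M).mono' hBc.aestronglyMeasurable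
      (.of_forall fun ω => hM (ω, ξ))
  have hrep : ∀ S : ℝ, 0 < S → T ≤ S → ∀ θ : ℝ,
      ∫ ω, B ω * (S * K (S * (ω - θ))) = 2 * Real.pi * B θ := fun S hS hTS θ =>
    integral_symbol_mul_kernel hK hS hTS hΦ θ ξ
  have hmulB : ∀ {F : ℝ → ℂ}, Integrable F → Integrable fun ω => F ω * B ω := fun hF =>
    hF.mul_bdd (c := M) hBc.aestronglyMeasurable (.of_forall hBm)
  -- Scale 1 is admissible in the reproducing identity because T ≤ 1.
  have hKB : ∫ ω, K ω * B ω = 2 * Real.pi * B 0 := by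
    have := hrep 1 one_pos hT1 0
    simpa [mul_comm] using this
  have hHi := integrable_highPart hT hT1 hε hh hfin
  have hLi := integrableOn_lowSet hT hε' hh hfin
  set c : ℂ := ∫ θ, highPart T h (θ, ξ) with hc
  set P : ℝ × ℝ → ℂ := fun y => B y.1 * (h (y.2, ξ) * lowKernel K T y.1 y.2) with hP
  have hPi : Integrable P (volume.prod (volume.restrict (lowSet T))) := by
    have h1 := (hBi.mul_prod hLi).norm.mul_const (A * (T ^ 2 * 1))
    refine h1.mono' ?_ ?_
    · refine Measurable.aestronglyMeasurable ?_
      have hBm' := hBc.measurable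
      have hKm : Measurable K := K.continuous.measurable
      simp only [hP, lowKernel]
      fun_prop
    · have e : (volume : Measure ℝ).prod (volume.restrict (lowSet T)) =
          ((volume : Measure ℝ).prod volume).restrict (univ ×ˢ lowSet T) := by
        rw [← Measure.prod_restrict, Measure.restrict_univ]
      rw [e]
      refine ae_restrict_of_forall_mem (MeasurableSet.univ.prod (measurableSet_lowSet T))
        fun y hy => ?_
      simp only [hP]
      rw [norm_mul, norm_mul, norm_mul, mul_assoc]
      gcongr
      refine (hA T hT y.2 y.1 hy.2).trans ?_
      gcongr
      exact Real.rpow_le_one_of_one_le_of_nonpos (one_le_bracket _) (by norm_num)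
  -- Both terms of `lowKernel` are reproduced at scale T, one evaluating B at θ and the other at 0.
  have hinner : ∀ θ, ∫ ω, P (ω, θ) = 2 * Real.pi *
      (h (θ, ξ) * ((B θ - B 0) / (Complex.I * θ))) := by
    intro θ
    have i1 : Integrable fun ω => B ω * ((T : ℂ) * K (T * (ω - θ))) :=
      (hmulB (integrable_scaled_kernel K hT θ)).congr (.of_forall fun ω => mul_comm _ _)
    have i2 : Integrable fun ω => B ω * ((T : ℂ) * K (T * (ω - 0))) :=
      (hmulB (integrable_scaled_kernel K hT 0)).congr (.of_forall fun ω => mul_comm _ _)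
    have e : ∀ ω, P (ω, θ) = h (θ, ξ) / (Complex.I * θ) *
        (B ω * ((T : ℂ) * K (T * (ω - θ))) - B ω * ((T : ℂ) * K (T * (ω - 0)))) := by
      intro ω
      simp only [hP, lowKernel, sub_zero]
      ring
    simp_rw [e]
    rw [integral_const_mul, integral_sub i1 i2, hrep T hT le_rfl θ, hrep T hT le_rfl 0]
    ring
  have hlowi : IntegrableOn (fun θ : ℝ => h (θ, ξ) * ((B θ - B 0) / (Complex.I * θ)))
      (lowSet T) := by
    have h1 := hPi.integral_prod_right
    simp only [hinner] at h1
    have h2 := h1.const_mul (2 * Real.pi : ℂ)⁻¹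
    simp only [inv_mul_cancel_left₀ hπ] at h2
    exact h2
  have hlow : ∫ ω, B ω * ∫ θ in lowSet T, h (θ, ξ) * lowKernel K T ω θ =
      2 * Real.pi * ∫ θ in lowSet T, h (θ, ξ) * ((B θ - B 0) / (Complex.I * θ)) := by
    have h1 : ∀ ω, B ω * ∫ θ in lowSet T, h (θ, ξ) * lowKernel K T ω θ =
        ∫ θ in lowSet T, P (ω, θ) := fun ω => (integral_const_mul _ _).symm
    simp_rw [h1]
    rw [integral_integral_swap (f := fun ω θ => P (ω, θ)) hPi]
    simp_rw [hinner]
    rw [integral_const_mul]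
  have hlowi' : Integrable fun ω => B ω * ∫ θ in lowSet T, h (θ, ξ) * lowKernel K T ω θ := by
    have h1 := hPi.integral_prod_left
    refine h1.congr (.of_forall fun ω => ?_)
    exact integral_const_mul (μ := volume.restrict (lowSet T)) (B ω) _
  have hhigh : Integrable fun θ => highPart T h (θ, ξ) * (B θ - B 0) := by
    have := (hmulB hHi).sub (hHi.mul_const (B 0))
    refine this.congr (.of_forall fun θ => ?_)
    simp only [Pi.sub_apply]
    ring
  -- On the low set the quotient comes from the cut-off kernel. Off it, the high part supplies B(θ)
  -- and the correction by a free wave supplies -B(0).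
  have hsplit : ∫ θ : ℝ, h (θ, ξ) * ((B θ - B 0) / (Complex.I * θ)) =
      (∫ θ in lowSet T, h (θ, ξ) * ((B θ - B 0) / (Complex.I * θ))) +
        ∫ θ, highPart T h (θ, ξ) * (B θ - B 0) := by
    rw [← integral_indicator (measurableSet_lowSet T),
      ← integral_add ((integrable_indicator_iff (measurableSet_lowSet T)).2 hlowi) hhigh]
    refine integral_congr_ae (.of_forall fun θ => ?_)
    simp only [highPart]
    by_cases hθ : θ ∈ lowSet T
    · rw [indicator_of_mem hθ, indicator_of_notMem (by simpa using hθ), zero_mul, add_zero]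
    · rw [indicator_of_notMem hθ, indicator_of_mem (by exact hθ), zero_add]
      ring
  have hhigh' : ∫ θ, highPart T h (θ, ξ) * (B θ - B 0) =
      (∫ θ, highPart T h (θ, ξ) * B θ) - c * B 0 := by
    rw [hc, ← integral_mul_const, ← integral_sub (hmulB hHi) (hHi.mul_const _)]
    refine integral_congr_ae (.of_forall fun θ => ?_)
    simp only
    ring
  have hexp : ∀ ω, duhamel K T fh h (ω, ξ) * B ω =
      (fh ξ - (2 * Real.pi : ℂ)⁻¹ * c) * (K ω * B ω) + highPart T h (ω, ξ) * B ω +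
        (2 * Real.pi : ℂ)⁻¹ * (B ω * ∫ θ in lowSet T, h (θ, ξ) * lowKernel K T ω θ) := by
    intro ω
    simp only [duhamel, ← hc]
    ring
  simp_rw [hexp]
  have j1 := (hmulB K.integrable).const_mul (fh ξ - (2 * Real.pi : ℂ)⁻¹ * c)
  rw [integral_add (by exact j1.add (hmulB hHi)) (hlowi'.const_mul _), integral_add j1 (hmulB hHi),
    integral_const_mul, integral_const_mul, hKB, hlow, hsplit, hhigh']
  field_simp
  ring

end Fiber

/-! ### From fibers to distributions: equation and initial value of the extension. -/

theorem ae_lintegral_ne_top_of_ySq {s r : ℝ} {h : ℝ × ℝ → ℂ} (hh : Measurable h)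
    (hy : ySq s r h ≠ ⊤) :
    ∀ᵐ ξ : ℝ, ∫⁻ θ, ENNReal.ofReal (bracket θ ^ r) * ‖h (θ, ξ)‖ₑ ≠ ⊤ := by
  have hm : Measurable fun ξ => (∫⁻ θ, ENNReal.ofReal (bracket ξ ^ s * bracket θ ^ r) *
      ‖h (θ, ξ)‖ₑ) ^ 2 := by
    refine Measurable.pow_const (Measurable.lintegral_prod_right' (f := fun y : ℝ × ℝ =>
      ENNReal.ofReal (bracket y.1 ^ s * bracket y.2 ^ r) * ‖h (y.2, y.1)‖ₑ) ?_) 2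
    fun_prop
  filter_upwards [ae_lt_top hm hy] with ξ hξ
  have hb := bracket_pos ξ
  have e : ∫⁻ θ, ENNReal.ofReal (bracket ξ ^ s * bracket θ ^ r) * ‖h (θ, ξ)‖ₑ =
      ENNReal.ofReal (bracket ξ ^ s) * ∫⁻ θ, ENNReal.ofReal (bracket θ ^ r) * ‖h (θ, ξ)‖ₑ := by
    rw [← lintegral_const_mul _ (by fun_prop)]
    refine lintegral_congr fun θ => ?_
    rw [ENNReal.ofReal_mul (by positivity), mul_assoc]
  rw [e] at hξ
  intro htop
  have h0 : ENNReal.ofReal (bracket ξ ^ s) ≠ 0 := by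
    simpa using Real.rpow_pos_of_pos hb s
  rw [htop, ENNReal.mul_top h0] at hξ
  simp at hξ

/-- This supplies the dominating function for the limit at t = 0. The Y-norm gives L¹ in θ and L² in
ξ with weight ⟨ξ⟩^s, and the decay of χ leaves ⟨ξ⟩^{-2-s} in L² for Cauchy-Schwarz. -/
theorem integrable_of_ySq {s ε : ℝ} (hs : -1 / 2 < s) (hε : 0 < ε) {h : ℝ × ℝ → ℂ}
    (hh : Measurable h) (hy : ySq s (-1 + 2 * ε) h ≠ ⊤) (χ : 𝓢(ℝ, ℂ)) :
    Integrable fun z : ℝ × ℝ => bracket z.1 ^ (-1 : ℝ) * ‖χ z.2‖ * ‖h z‖ := by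
  obtain ⟨C, hC0, hC⟩ := exists_norm_le_bracket_rpow χ 2
  have hχm : Measurable χ := χ.continuous.measurable
  have hm : Measurable fun z : ℝ × ℝ => bracket z.1 ^ (-1 : ℝ) * ‖χ z.2‖ * ‖h z‖ := by fun_prop
  refine ⟨hm.aestronglyMeasurable, ?_⟩
  set Y : ℝ → ℝ≥0∞ := fun ξ => ∫⁻ θ, ENNReal.ofReal (bracket ξ ^ s * bracket θ ^ (-1 + 2 * ε)) *
    ‖h (θ, ξ)‖ₑ with hY
  have hYm : Measurable Y := by
    refine Measurable.lintegral_prod_right' (f := fun y : ℝ × ℝ =>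
      ENNReal.ofReal (bracket y.1 ^ s * bracket y.2 ^ (-1 + 2 * ε)) * ‖h (y.2, y.1)‖ₑ) ?_
    fun_prop
  have hpt : ∀ ξ θ : ℝ, ‖bracket θ ^ (-1 : ℝ) * ‖χ ξ‖ * ‖h (θ, ξ)‖‖ₑ ≤
      ENNReal.ofReal (C * bracket ξ ^ (-2 - s)) *
        (ENNReal.ofReal (bracket ξ ^ s * bracket θ ^ (-1 + 2 * ε)) * ‖h (θ, ξ)‖ₑ) := by
    intro ξ θ
    have h1 := bracket_pos ξ
    have h2 := bracket_pos θ
    rw [← ofReal_norm, ← ofReal_norm, ← ENNReal.ofReal_mul (by positivity),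
      ← ENNReal.ofReal_mul (by positivity), Real.norm_of_nonneg (by positivity)]
    apply ENNReal.ofReal_le_ofReal
    have h3 : bracket θ ^ (-1 : ℝ) ≤ bracket θ ^ (-1 + 2 * ε) :=
      Real.rpow_le_rpow_of_exponent_le (one_le_bracket θ) (by linarith)
    have h4 : ‖χ ξ‖ ≤ C * (bracket ξ ^ (-2 - s) * bracket ξ ^ s) := by
      rw [bracket_rpow_mul_rpow, sub_add_cancel]
      exact_mod_cast hC ξ
    calc bracket θ ^ (-1 : ℝ) * ‖χ ξ‖ * ‖h (θ, ξ)‖ ≤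
          bracket θ ^ (-1 + 2 * ε) * (C * (bracket ξ ^ (-2 - s) * bracket ξ ^ s)) *
            ‖h (θ, ξ)‖ := by gcongr
      _ = _ := by ring
  have hle : ∫⁻ z : ℝ × ℝ, ‖bracket z.1 ^ (-1 : ℝ) * ‖χ z.2‖ * ‖h z‖‖ₑ ≤
      ∫⁻ ξ, ENNReal.ofReal (C * bracket ξ ^ (-2 - s)) * Y ξ := by
    rw [show (volume : Measure (ℝ × ℝ)) = volume.prod volume from rfl,
      lintegral_prod_symm _ hm.enorm.aemeasurable]
    refine lintegral_mono fun ξ => ?_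
    simp only [hY]
    rw [← lintegral_const_mul _ (by fun_prop)]
    exact lintegral_mono fun θ => hpt ξ θ
  have hsq : ∫⁻ ξ, ENNReal.ofReal (C * bracket ξ ^ (-2 - s)) ^ 2 ≠ ⊤ := by
    have hi := (integrable_bracket_rpow (r := -4 - 2 * s) (by linarith)).const_mul (C ^ 2)
    have := hi.2
    rw [hasFiniteIntegral_iff_ofReal (.of_forall fun ξ => by
      have := bracket_pos ξ
      positivity)] at this
    refine ne_of_lt (lt_of_eq_of_lt (lintegral_congr fun ξ => ?_) this)
    have hb := bracket_pos ξ
    rw [← ENNReal.ofReal_pow (by positivity), mul_pow, ← Real.rpow_mul_natCast hb.le]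
    congr 3
    push_cast
    ring
  have hcs := lintegral_mul_sq_le (μ := (volume : Measure ℝ))
    (f := fun ξ => ENNReal.ofReal (C * bracket ξ ^ (-2 - s))) (g := Y) (by fun_prop)
    hYm.aemeasurable
  refine lt_of_le_of_lt hle (lt_top_iff_ne_top.2 fun htop => ?_)
  rw [htop] at hcs
  refine (ENNReal.mul_ne_top hsq hy) (top_le_iff.1 (le_trans ?_ hcs))
  simp

/-- For |θ| ≤ 1/δ the mean value bound gives O(δ), and δ⟨θ⟩ ≤ 2. For |θ| > 1/δ ≥ 1 boundedness of g
divided by |θ| is enough. Uniformity in δ is what dominated convergence needs. -/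
theorem exists_dilation_quotient_le (g : 𝓢(ℝ, ℂ)) :
    ∃ C : ℝ, 0 ≤ C ∧ ∀ δ : ℝ, 0 < δ → δ ≤ 1 → ∀ θ ω : ℝ,
      ‖(g (δ * (ω - θ)) - g (δ * ω)) / (Complex.I * θ)‖ ≤ C * bracket θ ^ (-1 : ℝ) := by
  obtain ⟨A, hA0, hA⟩ := exists_difference_quotient_le g
  set M := SchwartzMap.seminorm ℝ 0 0 g with hM
  have hM0 : 0 ≤ M := by positivity
  refine ⟨2 * A + 4 * M, by positivity, fun δ hδ hδ1 θ ω => ?_⟩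
  have hb := bracket_pos θ
  have hb1 := bracket_le_one_add_abs θ
  rw [Real.rpow_neg_one, ← div_eq_mul_inv, le_div_iff₀ hb]
  by_cases hθ : |θ| ≤ δ⁻¹
  · have h1 := hA δ hδ θ ω hθ
    have e : ((δ : ℂ) * g (δ * (ω - θ)) - δ * g (δ * ω)) / (Complex.I * θ) =
        δ * ((g (δ * (ω - θ)) - g (δ * ω)) / (Complex.I * θ)) := by ring
    rw [e, norm_mul, Complex.norm_real, Real.norm_of_nonneg hδ.le] at h1
    have h2 : bracket (δ * ω) ^ (-2 : ℝ) ≤ 1 :=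
      Real.rpow_le_one_of_one_le_of_nonpos (one_le_bracket _) (by norm_num)
    have h3 : ‖(g (δ * (ω - θ)) - g (δ * ω)) / (Complex.I * θ)‖ ≤ A * δ := by
      refine le_of_mul_le_mul_left (h1.trans ?_) hδ
      calc A * (δ ^ 2 * bracket (δ * ω) ^ (-2 : ℝ)) ≤ A * (δ ^ 2 * 1) := by gcongr
        _ = _ := by ring
    have h4 : δ * |θ| ≤ 1 := by
      calc δ * |θ| ≤ δ * δ⁻¹ := by gcongr
        _ = 1 := mul_inv_cancel₀ hδ.ne'
    calc _ ≤ A * δ * (1 + |θ|) := by gcongr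
      _ = A * (δ + δ * |θ|) := by ring
      _ ≤ A * (1 + 1) := by gcongr
      _ ≤ _ := by linarith
  · have h1 : δ⁻¹ < |θ| := not_le.1 hθ
    have h2 : 1 ≤ δ⁻¹ := (one_le_inv₀ hδ).2 hδ1
    have hθ0 : 0 < |θ| := by linarith
    rw [norm_div, norm_mul, Complex.norm_I, one_mul, Complex.norm_real, Real.norm_eq_abs,
      div_mul_eq_mul_div, div_le_iff₀ hθ0]
    have h3 := norm_sub_le (g (δ * (ω - θ))) (g (δ * ω))
    have h4 := SchwartzMap.norm_le_seminorm ℝ g (δ * (ω - θ))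
    have h5 := SchwartzMap.norm_le_seminorm ℝ g (δ * ω)
    calc _ ≤ (2 * M) * (2 * |θ|) := by
          gcongr
          · linarith
          · linarith
      _ ≤ _ := by nlinarith

/-- The characteristic derivative acts through θ alone, which is the reason for these coordinates;
in particular its symbol vanishes at θ = 0. -/
theorem symbol_lineDerivOp (σ : ℝ) (Ψ : 𝓢(SpaceTime, ℂ)) (z : ℝ × ℝ) :
    symbol σ (∂_{direction σ} Ψ) z = -(Complex.I * z.1) * symbol σ Ψ z := by
  have hm : (fun p : SpaceTime => inner ℝ p (direction σ)).HasTemperateGrowth := by fun_prop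
  rw [symbol, SchwartzMap.fourierInv_lineDerivOp_eq, smul_apply,
    SchwartzMap.smulLeftCLM_apply_apply hm, symbol, inner_smul_left, inner_spaceTime]
  have hπ : (Real.pi : ℂ) ≠ 0 := by exact_mod_cast Real.pi_ne_zero
  simp only [freqChart_zero, freqChart_one, direction_zero, direction_one, Complex.real_smul,
    smul_eq_mul, conj_trivial]
  push_cast
  field_simp
  ring

theorem symbol_tensor (σ : ℝ) (η χ : 𝓢(ℝ, ℂ)) (z : ℝ × ℝ) :
    symbol σ (shearTensor 0 η χ) z =
      (𝓕 η) ((2 * Real.pi)⁻¹ * (σ * z.2 - z.1)) * (𝓕⁻ χ) ((2 * Real.pi)⁻¹ * z.2) := by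
  rw [symbol, fourierInv_tensor, SchwartzMap.fourierInv_coe η, Real.fourierInv_eq_fourier_neg,
    ← SchwartzMap.fourier_coe]
  simp only [PiLp.smul_apply, freqChart_zero, freqChart_one, smul_eq_mul]
  congr 2
  ring

section Extension

variable {s ε σ T : ℝ} {K : 𝓢(ℝ, ℂ)} {f : 𝓢'(ℝ, ℂ)} {fh : ℝ → ℂ} {F g : 𝓢'(SpaceTime, ℂ)}
  {H G : SpaceTime → ℂ}

/-- The action of the extension on test functions supported in the strip. -/
theorem extension_apply (hT : 0 < T) (hT1 : T ≤ 1) (hε : 0 < ε) (hε' : ε < 1 / 6)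
    (hK : ∀ t : ℝ, |t| ≤ 1 → ∫ v : ℝ, Complex.exp (↑(t * v) * Complex.I) * K v = 2 * Real.pi)
    (hH : Measurable H) (hy : ySq s (-1 + 2 * ε) (fun z => H (freqChart σ z)) ≠ ⊤)
    (hg : IsFourierTransform g G)
    (hG : ∀ z, G (freqChart σ z) = duhamel K T fh (fun z => H (freqChart σ z)) z)
    {Φ : 𝓢(SpaceTime, ℂ)} (hΦ : tsupport Φ ⊆ strip T) :
    g Φ = ((2 * Real.pi : ℂ) ^ 2)⁻¹ * ∫ ξ : ℝ, (2 * Real.pi * fh ξ * symbol σ Φ (0, ξ) +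
      ∫ θ : ℝ, H (freqChart σ (θ, ξ)) *
        ((symbol σ Φ (θ, ξ) - symbol σ Φ (0, ξ)) / (Complex.I * θ))) := by
  have hh : Measurable fun z => H (freqChart σ z) := hH.comp (continuous_freqChart σ).measurable
  rw [hg.apply_eq_symbol σ Φ]
  congr 1
  refine integral_congr_ae ?_
  filter_upwards [ae_lintegral_ne_top_of_ySq hh hy] with ξ hξ
  simp only [hG]
  exact integral_duhamel_mul_symbol hK hT hT1 hε hε' hh hξ fh σ hΦ

/-- The extension solves the transport equation in the strip. -/
theorem extension_lineDerivOp (hT : 0 < T) (hT1 : T ≤ 1) (hε : 0 < ε) (hε' : ε < 1 / 6)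
    (hK : ∀ t : ℝ, |t| ≤ 1 → ∫ v : ℝ, Complex.exp (↑(t * v) * Complex.I) * K v = 2 * Real.pi)
    (hH : IsFourierTransform F H) (hy : ySq s (-1 + 2 * ε) (fun z => H (freqChart σ z)) ≠ ⊤)
    (hg : IsFourierTransform g G)
    (hG : ∀ z, G (freqChart σ z) = duhamel K T fh (fun z => H (freqChart σ z)) z)
    {Ψ : 𝓢(SpaceTime, ℂ)} (hΨ : tsupport Ψ ⊆ strip T) :
    g (∂_{direction σ} Ψ) = -F Ψ := by
  rw [extension_apply hT hT1 hε hε' hK hH.1 hy hg hG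
    ((SchwartzMap.tsupport_lineDerivOp_subset _ Ψ).trans hΨ), hH.apply_eq_symbol σ Ψ, ← mul_neg,
    ← integral_neg]
  congr 1
  refine integral_congr_ae (.of_forall fun ξ => ?_)
  simp only [symbol_lineDerivOp]
  rw [← integral_neg]
  -- At θ = 0 the symbol of the derivative is zero, so the data term and the subtracted term drop
  -- out; for θ ≠ 0 the factor -iθ cancels the denominator.
  simp only [Complex.ofReal_zero, mul_zero, neg_zero, zero_mul, zero_add, sub_zero]
  refine integral_congr_ae ?_
  have h0 : ∀ᵐ θ : ℝ, θ ≠ 0 := by simp [ae_iff, measure_singleton]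
  filter_upwards [h0] with θ hθ
  have : (θ : ℂ) ≠ 0 := by exact_mod_cast hθ
  field_simp

/-- The extension attains the initial value. -/
theorem tendsto_extension (hs : -1 / 2 < s) (hT : 0 < T) (hT1 : T ≤ 1) (hε : 0 < ε)
    (hε' : ε < 1 / 6)
    (hK : ∀ t : ℝ, |t| ≤ 1 → ∫ v : ℝ, Complex.exp (↑(t * v) * Complex.I) * K v = 2 * Real.pi)
    (hf : IsFourierTransform f fh) (hH : Measurable H)
    (hy : ySq s (-1 + 2 * ε) (fun z => H (freqChart σ z)) ≠ ⊤) (hg : IsFourierTransform g G)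
    (hG : ∀ z, G (freqChart σ z) = duhamel K T fh (fun z => H (freqChart σ z)) z)
    {γ : 𝓢(ℝ, ℂ)} {m : ℝ → 𝓢(ℝ, ℂ)} (hγ : γ 0 = 1)
    (hm : ∀ δ : ℝ, 0 < δ → (∀ k, (𝓕 (m δ)) k = γ (δ * k)) ∧ tsupport (m δ) ⊆ Icc (-δ) δ)
    (χ : 𝓢(ℝ, ℂ)) :
    Filter.Tendsto (fun δ => g (shearTensor 0 (m δ) χ)) (nhdsWithin 0 (Ioi 0)) (nhds (f χ)) := by
  set c : ℝ := (2 * Real.pi)⁻¹ with hc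
  have hc0 : 0 < c := by positivity
  have hc1 : c ≤ 1 := inv_le_one_of_one_le₀ (by linarith [Real.pi_gt_three])
  obtain ⟨χ₁, hχ₁⟩ : ∃ χ₁ : 𝓢(ℝ, ℂ), ∀ ξ, χ₁ ξ = (𝓕⁻ χ) (c * ξ) :=
    ⟨SchwartzMap.compCLMOfContinuousLinearEquiv ℂ
      (ContinuousLinearEquiv.unitsEquivAut ℝ (Units.mk0 c hc0.ne')) (𝓕⁻ χ), fun ξ => by
        simp [mul_comm]⟩
  set h : ℝ × ℝ → ℂ := fun z => H (freqChart σ z) with hh'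
  have hh : Measurable h := hH.comp (continuous_freqChart σ).measurable
  have hsym : ∀ δ : ℝ, 0 < δ → ∀ z : ℝ × ℝ, symbol σ (shearTensor 0 (m δ) χ) z =
      γ (δ * c * (σ * z.2 - z.1)) * χ₁ z.2 := by
    intro δ hδ z
    rw [symbol_tensor, (hm δ hδ).1, hχ₁, mul_assoc]
  obtain ⟨C, hC0, hC⟩ := exists_dilation_quotient_le γ
  set M := SchwartzMap.seminorm ℝ 0 0 γ
  have hM : ∀ x, ‖γ x‖ ≤ M := SchwartzMap.norm_le_seminorm ℝ γ
  have hγm : Measurable γ := γ.continuous.measurable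
  have hχm : Measurable χ₁ := χ₁.continuous.measurable
  have hfm : Measurable fh := hf.1
  -- P is the data term and Q the forcing term. As δ → 0 all dilated factors tend to γ(0) = 1, so P
  -- tends to the pairing of f with χ and the difference in Q tends to 0.
  set P : ℝ → ℝ → ℂ := fun δ ξ => fh ξ * (γ (δ * c * (σ * ξ)) * χ₁ ξ) with hP
  set Q : ℝ → ℝ × ℝ → ℂ := fun δ z => h z *
    ((γ (δ * c * (σ * z.2 - z.1)) - γ (δ * c * (σ * z.2))) / (Complex.I * z.1) * χ₁ z.2) with hQ
  have hfχ : Integrable fun ξ => fh ξ * χ₁ ξ := by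
    simp only [hχ₁]
    exact hf.integrable_mul_fourierInv χ
  have hPb : ∀ δ ξ, ‖P δ ξ‖ ≤ M * ‖fh ξ * χ₁ ξ‖ := by
    intro δ ξ
    simp only [hP, norm_mul]
    calc _ ≤ ‖fh ξ‖ * (M * ‖χ₁ ξ‖) := by
          gcongr
          exact hM _
      _ = _ := by ring
  have hPm : ∀ δ, AEStronglyMeasurable (P δ) := fun δ => by
    refine Measurable.aestronglyMeasurable ?_
    simp only [hP]
    fun_prop
  have hQb : ∀ δ : ℝ, 0 < δ → δ ≤ 1 → ∀ z : ℝ × ℝ,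
      ‖Q δ z‖ ≤ C * (bracket z.1 ^ (-1 : ℝ) * ‖χ₁ z.2‖ * ‖h z‖) := by
    intro δ hδ hδ1 z
    have h1 := hC (δ * c) (by positivity) (by nlinarith) z.1 (σ * z.2)
    simp only [hQ]
    rw [norm_mul, norm_mul]
    calc _ ≤ ‖h z‖ * (C * bracket z.1 ^ (-1 : ℝ) * ‖χ₁ z.2‖) := by gcongr
      _ = _ := by ring
  have hQm : ∀ δ, AEStronglyMeasurable (Q δ) := fun δ => by
    refine Measurable.aestronglyMeasurable ?_
    simp only [hQ]
    fun_prop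
  have hbi := (integrable_of_ySq hs hε hh hy χ₁).const_mul C
  have hev : ∀ᶠ δ in nhdsWithin (0 : ℝ) (Ioi 0), δ ∈ Ioo 0 T := Ioo_mem_nhdsGT hT
  have hformula : ∀ᶠ δ in nhdsWithin (0 : ℝ) (Ioi 0), g (shearTensor 0 (m δ) χ) =
      ((2 * Real.pi : ℂ) ^ 2)⁻¹ * (2 * Real.pi * (∫ ξ, P δ ξ) + ∫ z, Q δ z) := by
    filter_upwards [hev] with δ hδ
    have hQi : Integrable (Q δ) :=
      hbi.mono' (hQm δ) (.of_forall (hQb δ hδ.1 (by linarith [hδ.2])))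
    have hPi : Integrable (P δ) := (hfχ.norm.const_mul M).mono' (hPm δ) (.of_forall (hPb δ))
    rw [extension_apply hT hT1 hε hε' hK hH hy hg hG (tsupport_shearTensor_subset 0
      ((hm δ hδ.1).2.trans (Icc_subset_Ioo (by linarith [hδ.2]) hδ.2)) χ)]
    congr 1
    rw [show (volume : Measure (ℝ × ℝ)) = volume.prod volume from rfl, integral_prod_symm _ hQi,
      ← integral_const_mul, ← integral_add (hPi.const_mul _) hQi.integral_prod_right]
    refine integral_congr_ae (.of_forall fun ξ => ?_)
    simp only [hsym δ hδ.1, hP, hQ, sub_zero, mul_assoc]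
    congr 1
    refine integral_congr_ae (.of_forall fun θ => ?_)
    simp only [hh']
    ring
  refine Filter.Tendsto.congr' (hformula.mono fun δ h => h.symm) ?_
  have hlim : ∀ a b : ℝ, Filter.Tendsto (fun δ : ℝ => γ (δ * a * b)) (nhdsWithin 0 (Ioi 0))
      (nhds 1) := by
    intro a b
    have : Continuous fun δ : ℝ => γ (δ * a * b) := γ.continuous.comp (by fun_prop)
    have h1 := this.tendsto 0
    simp only [zero_mul, hγ] at h1
    exact h1.mono_left nhdsWithin_le_nhds
  have hPlim : Filter.Tendsto (fun δ => ∫ ξ, P δ ξ) (nhdsWithin 0 (Ioi 0))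
      (nhds (∫ ξ, fh ξ * χ₁ ξ)) := by
    refine tendsto_integral_filter_of_dominated_convergence (fun ξ => M * ‖fh ξ * χ₁ ξ‖)
      (.of_forall hPm) (.of_forall fun δ => .of_forall (hPb δ)) (hfχ.norm.const_mul M)
      (.of_forall fun ξ => ?_)
    have := ((hlim c (σ * ξ)).mul_const (χ₁ ξ)).const_mul (fh ξ)
    simpa using this
  have hQlim : Filter.Tendsto (fun δ => ∫ z, Q δ z) (nhdsWithin 0 (Ioi 0)) (nhds 0) := by
    have := tendsto_integral_filter_of_dominated_convergence (μ := volume)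
      (l := nhdsWithin (0 : ℝ) (Ioi 0)) (F := Q) (f := fun _ => 0) _ (.of_forall hQm)
      (hev.mono fun δ hδ => .of_forall (hQb δ hδ.1 (by linarith [hδ.2]))) hbi
      (.of_forall fun z => ?_)
    · simpa using this
    · have h1 := (((((hlim c (σ * z.2 - z.1)).sub (hlim c (σ * z.2))).div_const
        (Complex.I * z.1)).mul_const (χ₁ z.2)).const_mul (h z))
      simpa using h1
  have hfin := ((hPlim.const_mul (2 * Real.pi : ℂ)).add hQlim).const_mul ((2 * Real.pi : ℂ) ^ 2)⁻¹
  refine hfin.trans (le_of_eq ?_)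
  rw [hf.apply_eq_integral χ]
  simp only [hχ₁, add_zero]
  congr 1
  have hπ : (Real.pi : ℂ) ≠ 0 := by exact_mod_cast Real.pi_ne_zero
  rw [← mul_assoc]
  congr 1
  field_simp

end Extension

/-! ### Identification with the given solution and the final estimate. -/

theorem transport_apply (σ : ℝ) (u : 𝓢'(SpaceTime, ℂ)) (Ψ : 𝓢(SpaceTime, ℂ)) :
    transport σ u Ψ = -u (∂_{direction σ} Ψ) := by
  have e : ∂_{direction σ} Ψ = ∂_{EuclideanSpace.single (0 : Fin 2) (1 : ℝ)} Ψ +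
      (σ : ℂ) • ∂_{EuclideanSpace.single (1 : Fin 2) (1 : ℝ)} Ψ := by
    ext p
    simp only [SchwartzMap.lineDerivOp_apply_eq_fderiv, add_apply, smul_apply]
    have hd : direction σ = EuclideanSpace.single (0 : Fin 2) (1 : ℝ) +
        σ • EuclideanSpace.single (1 : Fin 2) (1 : ℝ) := by
      ext i
      fin_cases i <;> simp
    rw [hd, map_add, map_smul, Complex.real_smul, smul_eq_mul]
  rw [e, map_add, map_smul]
  change u (-∂_{EuclideanSpace.single (0 : Fin 2) (1 : ℝ)} Ψ) +
    (σ : ℂ) • u (-∂_{EuclideanSpace.single (1 : Fin 2) (1 : ℝ)} Ψ) = _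
  rw [map_neg, map_neg, smul_neg, neg_add]

/-- Pairing with m_δ averages the continuous function t ↦ u t χ over [-δ, δ]; mass 1 fixes the limit
and L¹ norm 1 controls the error. -/
theorem HasInitialValue.tendsto {T : ℝ} (hT : 0 < T) {ψ : 𝓢'(SpaceTime, ℂ)} {f : 𝓢'(ℝ, ℂ)}
    (h : HasInitialValue T ψ f) {m : ℝ → 𝓢(ℝ, ℂ)}
    (hm : ∀ δ : ℝ, 0 < δ → tsupport (m δ) ⊆ Icc (-δ) δ ∧ ∫ t, m δ t = 1 ∧ ∫ t, ‖m δ t‖ = 1)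
    (χ : 𝓢(ℝ, ℂ)) :
    Filter.Tendsto (fun δ => ψ (shearTensor 0 (m δ) χ)) (nhdsWithin 0 (Ioi 0)) (nhds (f χ)) := by
  obtain ⟨u, hu, rfl, hψ⟩ := h
  have hv : ContinuousOn (fun t => u t χ) (Ioo (-T) T) :=
    (PointwiseConvergenceCLM.evalCLM (RingHom.id ℂ) ℂ χ).continuous.comp_continuousOn hu
  have h0 : (0 : ℝ) ∈ Ioo (-T) T := ⟨by linarith, hT⟩
  have hv0 := hv.continuousAt (Ioo_mem_nhds h0.1 h0.2)
  rw [Metric.tendsto_nhdsWithin_nhds]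
  intro r hr
  obtain ⟨d, hd, hdr⟩ := Metric.continuousAt_iff.1 hv0 (r / 2) (by positivity)
  refine ⟨min d T, lt_min hd hT, fun δ hδ hδd => ?_⟩
  have hδ0 : 0 < δ := hδ
  rw [Real.dist_eq, sub_zero, abs_of_pos hδ0] at hδd
  obtain ⟨hsupp, hone, hnorm⟩ := hm δ hδ0
  have hsub : Icc (-δ) δ ⊆ Ioo (-T) T :=
    Icc_subset_Ioo (by linarith [min_le_right d T]) (by linarith [min_le_right d T])
  rw [hψ (m δ) χ (shearTensor 0 (m δ) χ) (hsupp.trans hsub) fun p => by simp]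
  have hzero : ∀ t, t ∉ Icc (-δ) δ → m δ t = 0 := fun t ht => by
    by_contra hne
    exact ht (hsupp (subset_tsupport _ hne))
  have hi1 : Integrable fun t => m δ t * u t χ := by
    rw [← integrableOn_iff_integrable_of_support_subset (s := Icc (-δ) δ)]
    · exact ((m δ).continuous.continuousOn.mul (hv.mono hsub)).integrableOn_Icc
    · intro t ht
      by_contra hne
      exact ht (by simp [hzero t hne])
  have hi2 : Integrable fun t => m δ t * u 0 χ := (m δ).integrable.mul_const _
  have e : (∫ t, m δ t * u t χ) - u 0 χ = ∫ t, m δ t * (u t χ - u 0 χ) := by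
    simp_rw [mul_sub]
    rw [integral_sub hi1 hi2, integral_mul_const, hone, one_mul]
  rw [dist_eq_norm, e]
  have hle : ‖∫ t, m δ t * (u t χ - u 0 χ)‖ ≤ ∫ t, ‖m δ t‖ * (r / 2) := by
    refine norm_integral_le_of_norm_le ((m δ).integrable.norm.mul_const _) (.of_forall fun t => ?_)
    rw [norm_mul]
    by_cases ht : t ∈ Icc (-δ) δ
    · gcongr
      rw [← dist_eq_norm]
      refine (hdr ?_).le
      rw [Real.dist_eq, sub_zero]
      exact lt_of_le_of_lt (abs_le.2 ht) (hδd.trans_le (min_le_left _ _))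
    · simp [hzero t ht]
  rw [integral_mul_const, hnorm, one_mul] at hle
  linarith

/-- Any extension with the right action on test functions agrees with the solution. -/
theorem IsSolution.eqOnStrip {σ T : ℝ} (hσ : σ = 1 ∨ σ = -1) (hT : 0 < T) (hT1 : T ≤ 1)
    {ψ F F' g : 𝓢'(SpaceTime, ℂ)} {f : 𝓢'(ℝ, ℂ)} (h : IsSolution σ T ψ F f)
    (hF : EqOnStrip T F' F)
    (hg : ∀ Ψ : 𝓢(SpaceTime, ℂ), tsupport Ψ ⊆ strip T → g (∂_{direction σ} Ψ) = -F' Ψ)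
    {γ : 𝓢(ℝ, ℂ)} {m : ℝ → 𝓢(ℝ, ℂ)} (hγ : γ 0 = 1)
    (hm : ∀ δ : ℝ, 0 < δ → (∀ k, (𝓕 (m δ)) k = γ (δ * k)) ∧ tsupport (m δ) ⊆ Icc (-δ) δ ∧
      ∫ t, m δ t = 1 ∧ ∫ t, ‖m δ t‖ = 1)
    (h0 : ∀ χ : 𝓢(ℝ, ℂ), Filter.Tendsto (fun δ => g (shearTensor 0 (m δ) χ))
      (nhdsWithin 0 (Ioi 0)) (nhds (f χ))) :
    EqOnStrip T g ψ := by
  refine isVanishingOn_of_transport hσ hT hT1 (g - ψ) (fun Ψ hΨ => ?_) hγ hm fun χ => ?_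
  · have h1 : transport σ ψ Ψ - F Ψ = 0 := h.1 Ψ hΨ
    have h2 : F' Ψ - F Ψ = 0 := hF Ψ hΨ
    rw [transport_apply] at h1
    change g (∂_{direction σ} Ψ) - ψ (∂_{direction σ} Ψ) = 0
    rw [hg Ψ hΨ]
    linear_combination h1 - h2
  · have := (h0 χ).sub (h.2.tendsto hT (fun δ hδ => (hm δ hδ).2) χ)
    rw [sub_self] at this
    exact this

theorem exists_of_iInf_ne_top {α : Type*} {p : α → Prop} {φ : α → ℝ≥0∞}
    (h : ⨅ (a : α) (_ : p a), φ a ≠ ⊤) : ∃ a, p a := by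
  by_contra! hne
  exact h (by simp [hne])

/-- The estimate for a fixed extension of the forcing term. -/
theorem exists_zNormStrip_le {s ε b : ℝ} (hs : -1 / 2 < s) (hs' : s < 0) (hε : 0 < ε)
    (hε' : ε < 1 / 6) (hb : 1 / 2 < b) (hb' : b < 1) :
    ∃ C : ℝ≥0, C ≠ 0 ∧ ∀ σ : ℝ, σ = 1 ∨ σ = -1 → ∀ T : ℝ, 0 < T → T < 1 →
      ∀ (ψ F F' : 𝓢'(SpaceTime, ℂ)) (f : 𝓢'(ℝ, ℂ)), IsSolution σ T ψ F f → EqOnStrip T F' F →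
        ZNormStrip σ s b T ψ ≤ C * (ENNReal.ofReal (T ^ (1 / 2 - b)) * HNorm s f +
          ENNReal.ofReal (T ^ ε) *
            (YNorm σ s (-1 + 2 * ε) F' + ZNorm σ s (b - 1 + 2 * ε) F')) := by
  obtain ⟨K, hK⟩ := exists_reproducing_kernel
  obtain ⟨γ, m, hγ, hm⟩ := exists_mollifier
  obtain ⟨C, hC⟩ := exists_duhamel_zSq_le hs hs' hb hb' hε hε' K
  -- Taking square roots needs C ≤ (1 + C)². The summand 1 also keeps the constant nonzero, so that
  -- an infinite norm makes the right-hand side infinite.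
  refine ⟨1 + C, by positivity, fun σ hσ T hT hT1 ψ F F' f hψ hF => ?_⟩
  have hTb : 0 < T ^ (1 / 2 - b) := by positivity
  have hTε : 0 < T ^ ε := by positivity
  have hC0 : ((1 + C : ℝ≥0) : ℝ≥0∞) ≠ 0 := by
    rw [ENNReal.coe_ne_zero]
    positivity
  by_cases hHfin : HNorm s f = ⊤
  · rw [hHfin, ENNReal.mul_top (by simpa using hTb), top_add, ENNReal.mul_top hC0]
    exact le_top
  by_cases hYfin : YNorm σ s (-1 + 2 * ε) F' = ⊤
  · rw [hYfin, top_add, ENNReal.mul_top (by simpa using hTε), add_top, ENNReal.mul_top hC0]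
    exact le_top
  by_cases hZfin : ZNorm σ s (b - 1 + 2 * ε) F' = ⊤
  · rw [hZfin, add_top, ENNReal.mul_top (by simpa using hTε), add_top, ENNReal.mul_top hC0]
    exact le_top
  obtain ⟨fh, hfh⟩ := exists_of_iInf_ne_top hHfin
  obtain ⟨H, hH⟩ := exists_of_iInf_ne_top hYfin
  rw [hNorm_eq s hfh] at hHfin ⊢
  rw [yNorm_eq σ s _ hH] at hYfin ⊢
  rw [zNorm_eq σ s _ hH] at hZfin ⊢
  set h : ℝ × ℝ → ℂ := fun z => H (freqChart σ z) with hh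
  have hhm : Measurable h := hH.1.comp (continuous_freqChart σ).measurable
  set a := ∫⁻ ξ : ℝ, (ENNReal.ofReal (bracket ξ ^ s) * ‖fh ξ‖ₑ) ^ 2
  set y := ySq s (-1 + 2 * ε) h
  set z := zSq σ s (b - 1 + 2 * ε) h
  have hhalf : ∀ x : ℝ≥0∞, x ^ (1 / 2 : ℝ) ≠ ⊤ → x ≠ ⊤ := by
    rintro x hx rfl
    exact hx (ENNReal.top_rpow_of_pos (by norm_num))
  have ha := hhalf a hHfin
  have hy := hhalf y hYfin
  have hz := hhalf z hZfin
  set t := ENNReal.ofReal (T ^ (2 * ε)) with ht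
  have hle := hC σ hσ T hT hT1.le fh h hfh.1 hhm
  set G : SpaceTime → ℂ := fun p => duhamel K T fh h (p 0 + σ * p 1, p 1) with hG
  have hGm : Measurable G := (measurable_duhamel K T hfh.1 hhm).comp (by fun_prop)
  have hGc : ∀ z, G (freqChart σ z) = duhamel K T fh h z := fun z => by simp [hG]
  have hGfun : (fun z => G (freqChart σ z)) = duhamel K T fh h := funext hGc
  have hfin : zSq σ s b (fun z => G (freqChart σ z)) ≠ ⊤ := by
    rw [hGfun]
    refine ne_top_of_le_ne_top ?_ hle
    exact ENNReal.mul_ne_top ENNReal.coe_ne_top (ENNReal.add_ne_top.2 ⟨ha, ENNReal.mul_ne_top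
      (by simp) (ENNReal.add_ne_top.2 ⟨hy, hz⟩)⟩)
  obtain ⟨g, hg⟩ := exists_isFourierTransform_of_zSq hσ (by linarith) (by linarith) hGm hfin
  have heq : EqOnStrip T g ψ := hψ.eqOnStrip hσ hT hT1.le hF
    (fun Ψ hΨ => extension_lineDerivOp hT hT1.le hε hε' hK hH hy hg hGc hΨ) hγ hm fun χ =>
    tendsto_extension hs hT hT1.le hε hε' hK hfh hH.1 hy hg hGc hγ
      (fun δ hδ => ⟨(hm δ hδ).1, (hm δ hδ).2.1⟩) χ
  have hsq : ∀ x : ℝ≥0∞, (x ^ (1 / 2 : ℝ)) ^ 2 = x := fun x => by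
    rw [← ENNReal.rpow_mul_natCast]
    norm_num
  have hsq' : ∀ x : ℝ≥0∞, (x ^ 2) ^ (1 / 2 : ℝ) = x := fun x => by
    rw [← ENNReal.rpow_natCast_mul]
    norm_num
  calc ZNormStrip σ s b T ψ ≤ ZNorm σ s b g := iInf₂_le g heq
    _ = zSq σ s b (duhamel K T fh h) ^ (1 / 2 : ℝ) := by rw [zNorm_eq σ s b hg, hGfun]
    _ ≤ (((1 + C : ℝ≥0) * (a ^ (1 / 2 : ℝ) + t * (y ^ (1 / 2 : ℝ) + z ^ (1 / 2 : ℝ)))) ^ 2)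
          ^ (1 / 2 : ℝ) := by
        gcongr
        refine hle.trans ?_
        have h1 : (C : ℝ≥0∞) ≤ ((1 + C : ℝ≥0) : ℝ≥0∞) ^ 2 := by
          push_cast
          calc (C : ℝ≥0∞) ≤ C + (1 + C + C ^ 2) := le_self_add
            _ = _ := by ring
        rw [mul_pow]
        refine mul_le_mul' h1 ?_
        generalize hA : a ^ (1 / 2 : ℝ) = A
        generalize hY : y ^ (1 / 2 : ℝ) = Y
        generalize hZ : z ^ (1 / 2 : ℝ) = Z
        have e1 : a = A ^ 2 := by rw [← hA, hsq]
        have e2 : y = Y ^ 2 := by rw [← hY, hsq]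
        have e3 : z = Z ^ 2 := by rw [← hZ, hsq]
        change a + t ^ 2 * (y + z) ≤ _
        rw [e1, e2, e3]
        calc A ^ 2 + t ^ 2 * (Y ^ 2 + Z ^ 2) ≤ A ^ 2 + t ^ 2 * (Y ^ 2 + Z ^ 2) +
              (2 * A * (t * (Y + Z)) + 2 * t ^ 2 * Y * Z) := le_self_add
          _ = _ := by ring
    _ = (1 + C : ℝ≥0) * (a ^ (1 / 2 : ℝ) + t * (y ^ (1 / 2 : ℝ) + z ^ (1 / 2 : ℝ))) := hsq' _
    -- The bound obtained has factors 1 and T^{2ε}. As T < 1 and b > 1/2, one has 1 ≤ T^{1/2-b} and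
    -- T^{2ε} ≤ T^ε.
    _ ≤ _ := by
        gcongr
        · refine le_mul_of_one_le_left' ?_
          rw [ENNReal.one_le_ofReal]
          exact Real.one_le_rpow_of_pos_of_le_one_of_nonpos hT hT1.le (by linarith)
        · rw [ht]
          exact ENNReal.ofReal_le_ofReal
            (Real.rpow_le_rpow_of_exponent_ge hT hT1.le (by linarith))

end NullSobolev

theorem corollary4p4 (s ε b : ℝ) (hs : -1 / 2 < s) (hs' : s < 0) (hε : 0 < ε) (hε' : ε < 1 / 6)
    (hb : 1 / 2 < b) (hb' : b < min (1 + ε) (1 + s)) :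
    ∃ C : ℝ≥0, ∀ σ : ℝ, σ = 1 ∨ σ = -1 → ∀ T : ℝ, 0 < T → T < 1 →
      ∀ (ψ F : 𝓢'(NullSobolev.SpaceTime, ℂ)) (f : 𝓢'(ℝ, ℂ)),
        NullSobolev.IsSolution σ T ψ F f →
        NullSobolev.ZNormStrip σ s b T ψ ≤
          C * (ENNReal.ofReal (T ^ (1 / 2 - b)) * NullSobolev.HNorm s f +
            ENNReal.ofReal (T ^ ε) *
              ⨅ (F' : 𝓢'(NullSobolev.SpaceTime, ℂ)) (_ : NullSobolev.EqOnStrip T F' F),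
                (NullSobolev.YNorm σ s (-1 + 2 * ε) F' +
                  NullSobolev.ZNorm σ s (b - 1 + 2 * ε) F')) := by
  -- Since s < 0, the bound b < 1 + s gives b < 1, the form used by the weighted estimates.
  have hb1 : b < 1 := by linarith [min_le_right (1 + ε) (1 + s)]
  obtain ⟨C, hC0, hC⟩ := NullSobolev.exists_zNormStrip_le hs hs' hε hε' hb hb1
  refine ⟨C, fun σ hσ T hT hT1 ψ F f hψ => ?_⟩
  have hTε : ENNReal.ofReal (T ^ ε) ≠ 0 := by
    simpa using Real.rpow_pos_of_pos hT ε
  have hC0' : (C : ℝ≥0∞) ≠ 0 := by simpa using hC0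
  -- Factors that are neither 0 nor ∞ pass through the infimum, which reduces the claim to a single
  -- F'.
  simp only [ENNReal.mul_iInf_of_ne hTε ENNReal.ofReal_ne_top, ENNReal.add_iInf,
    ENNReal.mul_iInf_of_ne hC0' ENNReal.coe_ne_top]
  exact le_iInf₂ fun F' hF => hC σ hσ T hT hT1 ψ F F' f hψ hF
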